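/- Let $(M,g,I)$ be a weak Kähler Banach manifold: a smooth Banach manifold $M$ with a smooth, possibly only weak, Riemannian metric $g$ (a field of continuous positive definite symmetric bilinear forms on the tangent spaces) which has a smooth Levi-Civita connection $\nabla$, and a smooth almost complex structure $I$ which is a fibrewise isometry and is parallel. Let a Banach Lie group $G$ with Lie algebra $\mathfrak g$ act smoothly on $M$ with a moment map, i.e. a smooth equivariant map $\mu:M\to\mathfrak g^*$ such that $\langle d\mu(v),\rho\rangle=g(v,I\check\rho)$ for all tangent vectors $v$ and all $\rho\in\mathfrak g$, where $\check\rho$ is the fundamental vector field of $\rho$. Put $\check{\mathfrak g}_m=\{\check\rho_m:\rho\in\mathfrak g\}$. Let $c\in\mathfrak g^*$ be fixed by the coadjoint action, and suppose that $M_c=\mu^{-1}(c)$ is a submanifold of $M$ with $T_mM_c=\operatorname{Ker} d\mu_m$ for all $m\in M_c$, and that the action of $G$ on $M_c$ is free, proper, isometric and elliptic; elliptic means that $\Lambda(T_mM)=\Lambda(\check{\mathfrak g}_m)$ for every $m\in M_c$, where $\Lambda(v)(\rho)=g(v,\check\rho)$. Let $Q=M_c/G$ be the Kähler quotient, with its quotient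 manifold structure, its quotient metric and its Levi-Civita connection. For $m\in M_c$ let $H_m=(\check{\mathfrak g}_m\oplus I\check{\mathfrak g}_m)^\perp\subset T_mM$, which is identified with the tangent space of $Q$ at the orbit of $m$. For $X,Y\in H_m$ let $A(X,Y)$ be the $\check{\mathfrak g}_m$-component of $\nabla_X\tilde Y$, where $\tilde Y$ is any local vector field which extends $Y$ and takes values in $H$ along $M_c$, and let $$V(m)=\sup\Bigl\{\frac{|A(X,Y)|}{|X||Y|}\;:\;X,Y\in H_m\setminus\{0\}\Bigr\}\in[0,+\infty].$$ Then for every $p\in Q$, every $m\in M_c$ projecting to $p$ and every plane $\pi\subset T_pQ$ with horizontal lift $\tilde\pi\subset H_m\subset T_mM$, the sectional curvatures satisfy $$|K_Q(p)(\pi)-K_M(m)(\tilde\pi)|\le 5V(m)^2.$$ Moreover, if $T_pQ\neq 0$, then $$\sup_{\pi}\bigl(K_Q(p)(\pi)-K_M(m)(\tilde\pi)\bigr)\ge V(m)^2,$$ where the supremum, possibly $+\infty$, is taken over all planes $\pi\subset T_pQ$. -/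

import Mathlib

open scoped Manifold ContDiff Topology ENNReal Bundle
open Bundle

noncomputable section

/-! ### Weak Riemannian and weak Kähler Banach manifolds -/

section Metric

variable (E : Type*) [NormedAddCommGroup E] [NormedSpace ℝ E] [CompleteSpace E]
  (M : Type*) [TopologicalSpace M] [ChartedSpace E M] [IsManifold 𝓘(ℝ, E) ∞ M]

/-- A weak Riemannian structure on a smooth Banach manifold `M` modelled on `E`, with a smooth
Levi-Civita connection: a smooth field of continuous positive definite symmetric bilinear forms on
the tangent spaces (which need not induce their topology), and a smooth torsion-free connection
which is compatible with it. As the metric is weak, the existence of the connection is part of the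
data; its uniqueness follows from the Koszul formula. -/
structure WeakRiemannianStructure where
  /-- The metric tensor. -/
  metric (x : M) : TangentSpace 𝓘(ℝ, E) x →L[ℝ] TangentSpace 𝓘(ℝ, E) x →L[ℝ] ℝ
  metric_symm : ∀ x v w, metric x v w = metric x w v
  metric_pos : ∀ x v, v ≠ 0 → 0 < metric x v v
  metric_smooth : ContMDiff 𝓘(ℝ, E) (𝓘(ℝ, E).prod 𝓘(ℝ, E →L[ℝ] E →L[ℝ] ℝ)) ∞
    (fun x ↦ TotalSpace.mk' (E →L[ℝ] E →L[ℝ] ℝ)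
      (E := fun x : M ↦ TangentSpace 𝓘(ℝ, E) x →L[ℝ] TangentSpace 𝓘(ℝ, E) x →L[ℝ] ℝ)
      x (metric x))
  /-- The Levi-Civita connection; `cov Y x u` is the covariant derivative of `Y` at `x` along the
  tangent vector `u`. -/
  cov : CovariantDerivative 𝓘(ℝ, E) E (TangentSpace 𝓘(ℝ, E) : M → Type _)
  cov_smooth : ∀ U : Set M, IsOpen U → ContMDiffCovariantDerivativeOn E ∞ cov.toFun U
  cov_metric : ∀ (Y Z : Π x : M, TangentSpace 𝓘(ℝ, E) x) (x : M) (u : TangentSpace 𝓘(ℝ, E) x),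
    MDiffAt (T% Y) x → MDiffAt (T% Z) x →
      mvfderiv 𝓘(ℝ, E) (fun y ↦ metric y (Y y) (Z y)) x u =
        metric x (cov Y x u) (Z x) + metric x (Y x) (cov Z x u)
  cov_torsion : ∀ (X Y : Π x : M, TangentSpace 𝓘(ℝ, E) x) (x : M),
    MDiffAt (T% X) x → MDiffAt (T% Y) x →
      cov Y x (X x) - cov X x (Y x) = VectorField.mlieBracket 𝓘(ℝ, E) X Y x

/-- A weak Kähler structure: a weak Riemannian structure with Levi-Civita connection, together with
a smooth almost complex structure which is a fibrewise isometry and is parallel. -/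
structure WeakKahlerStructure extends WeakRiemannianStructure E M where
  /-- The almost complex structure. -/
  J (x : M) : TangentSpace 𝓘(ℝ, E) x →L[ℝ] TangentSpace 𝓘(ℝ, E) x
  J_smooth : ContMDiff 𝓘(ℝ, E) (𝓘(ℝ, E).prod 𝓘(ℝ, E →L[ℝ] E)) ∞
    (fun x ↦ TotalSpace.mk' (E →L[ℝ] E)
      (E := fun x : M ↦ TangentSpace 𝓘(ℝ, E) x →L[ℝ] TangentSpace 𝓘(ℝ, E) x) x (J x))
  J_sq : ∀ x v, J x (J x v) = -v
  J_isometry : ∀ x v w, metric x (J x v) (J x w) = metric x v w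
  J_parallel : ∀ (Y : Π x : M, TangentSpace 𝓘(ℝ, E) x) (x : M) (u : TangentSpace 𝓘(ℝ, E) x),
    MDiffAt (T% Y) x → cov (fun y ↦ J y (Y y)) x u = J x (cov Y x u)

end Metric

/-! ### Curvature -/

namespace WeakRiemannianStructure

variable {E : Type*} [NormedAddCommGroup E] [NormedSpace ℝ E] [CompleteSpace E]
  {M : Type*} [TopologicalSpace M] [ChartedSpace E M] [IsManifold 𝓘(ℝ, E) ∞ M]
  (S : WeakRiemannianStructure E M)

/-- The length of a tangent vector. -/
def length {x : M} (v : TangentSpace 𝓘(ℝ, E) x) : ℝ := √(S.metric x v v)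

/-- The curvature `R(u, v) w = ∇_U ∇_V W - ∇_V ∇_U W - ∇_[U, V] W` at `x`, where `U`, `V`, `W` are
the extensions of `u`, `v`, `w` to smooth local vector fields that are constant in the preferred
chart at `x`. -/
def curvature {x : M} (u v w : TangentSpace 𝓘(ℝ, E) x) : TangentSpace 𝓘(ℝ, E) x :=
  letI U : Π y : M, TangentSpace 𝓘(ℝ, E) y := FiberBundle.extend E u
  letI V : Π y : M, TangentSpace 𝓘(ℝ, E) y := FiberBundle.extend E v
  letI W : Π y : M, TangentSpace 𝓘(ℝ, E) y := FiberBundle.extend E w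
  S.cov (fun y ↦ S.cov W y (V y)) x u - S.cov (fun y ↦ S.cov W y (U y)) x v
    - S.cov W x (VectorField.mlieBracket 𝓘(ℝ, E) U V x)

/-- `u`, `v` is an orthonormal basis of the plane `P`. -/
def IsOrthonormalBasisOf {x : M} (P : Submodule ℝ (TangentSpace 𝓘(ℝ, E) x))
    (b : TangentSpace 𝓘(ℝ, E) x × TangentSpace 𝓘(ℝ, E) x) : Prop :=
  S.metric x b.1 b.1 = 1 ∧ S.metric x b.2 b.2 = 1 ∧ S.metric x b.1 b.2 = 0 ∧
    Submodule.span ℝ {b.1, b.2} = P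

open Classical in
/-- The sectional curvature `K(P) = g(R(u, v) v, u)` of a plane `P` in the tangent space at `x`,
where `u`, `v` is an orthonormal basis of `P` (and zero if `P` is not two-dimensional). -/
def sectionalCurvature {x : M} (P : Submodule ℝ (TangentSpace 𝓘(ℝ, E) x)) : ℝ :=
  if h : ∃ b, S.IsOrthonormalBasisOf P b then
    S.metric x (S.curvature h.choose.1 h.choose.2 h.choose.2) h.choose.1
  else 0

end WeakRiemannianStructure

/-! ### Group actions and moment maps

`G` is a Banach Lie group modelled on the Banach space `EG`. Its Lie algebra, the tangent space
at `1`, is by definition the space `EG`, and its dual is the Banach space `EG →L[ℝ] ℝ`. -/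

section Action

variable {E : Type*} [NormedAddCommGroup E] [NormedSpace ℝ E] [CompleteSpace E]
  {M : Type*} [TopologicalSpace M] [ChartedSpace E M] [IsManifold 𝓘(ℝ, E) ∞ M]
  {EG : Type*} [NormedAddCommGroup EG] [NormedSpace ℝ EG] [CompleteSpace EG]
  (G : Type*) [TopologicalSpace G] [ChartedSpace EG G] [Group G] [LieGroup 𝓘(ℝ, EG) ∞ G]
  [MulAction G M] [ContMDiffSMul 𝓘(ℝ, EG) 𝓘(ℝ, E) ∞ G M]

/-- The infinitesimal action at `m`: `fundamental G m ρ` is the value at `m` of the fundamental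
vector field of the Lie algebra element `ρ`. -/
def fundamental (m : M) : EG →L[ℝ] TangentSpace 𝓘(ℝ, E) m :=
  mfderiv 𝓘(ℝ, EG) 𝓘(ℝ, E) (fun a : G ↦ a • m) 1

/-- The tangent space to the orbit: the image of the Lie algebra in the tangent space at `m`. -/
def orbitTangent (m : M) : Submodule ℝ (TangentSpace 𝓘(ℝ, E) m) :=
  (fundamental (E := E) (EG := EG) G m).range

variable {G} in
/-- The adjoint action of `a` on the Lie algebra. -/
def adjointAction (a : G) : EG →L[ℝ] EG :=
  mfderiv 𝓘(ℝ, EG) 𝓘(ℝ, EG) (fun b : G ↦ a * b * a⁻¹) 1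

variable {G} in
/-- The coadjoint action of `a` on the dual of the Lie algebra. -/
def coadjointAction (a : G) (ξ : EG →L[ℝ] ℝ) : EG →L[ℝ] ℝ :=
  ξ ∘L adjointAction (EG := EG) a⁻¹

/-- The pointwise adjoint `Λ` of the infinitesimal action: `Λ(v)(ρ)` is the inner product of `v`
with the fundamental vector field of `ρ`. -/
def WeakRiemannianStructure.Lam (S : WeakRiemannianStructure E M) (m : M) :
    TangentSpace 𝓘(ℝ, E) m →ₗ[ℝ] (EG →L[ℝ] ℝ) where
  toFun v := (S.metric m v) ∘L fundamental (E := E) (EG := EG) G m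
  map_add' v w := by ext; simp
  map_smul' r v := by ext; simp

/-- The action is elliptic at `m`: `Λ` has the same image on the whole tangent space and on the
tangent space to the orbit. -/
def WeakRiemannianStructure.IsEllipticAt (S : WeakRiemannianStructure E M) (m : M) : Prop :=
  LinearMap.range (S.Lam (EG := EG) G m) =
    (orbitTangent (E := E) (EG := EG) G m).map (S.Lam (EG := EG) G m)

/-- `μ` is a moment map for the action of `G` on the weak Kähler manifold `M`: it is smooth,
equivariant, and `⟨dμ(v), ρ⟩ = g(v, J ρ̌)` for all tangent vectors `v` and all `ρ` in the
Lie algebra, where `ρ̌` is the fundamental vector field of `ρ`. The action is Hamiltonian if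
it has a moment map. -/
structure WeakKahlerStructure.IsMomentMap (S : WeakKahlerStructure E M)
    (G : Type*) [TopologicalSpace G] [ChartedSpace EG G] [Group G] [LieGroup 𝓘(ℝ, EG) ∞ G]
    [MulAction G M] [ContMDiffSMul 𝓘(ℝ, EG) 𝓘(ℝ, E) ∞ G M]
    (μ : M → (EG →L[ℝ] ℝ)) : Prop where
  smooth : ContMDiff 𝓘(ℝ, E) 𝓘(ℝ, EG →L[ℝ] ℝ) ∞ μ
  equivariant : ∀ (a : G) (m : M), μ (a • m) = coadjointAction a (μ m)
  moment : ∀ (m : M) (v : TangentSpace 𝓘(ℝ, E) m) (ρ : EG),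
    mvfderiv 𝓘(ℝ, E) μ m v ρ = S.metric m v (S.J m (fundamental G m ρ))

end Action

/-! ### The Kähler quotient -/

section Quotient

variable {E : Type*} [NormedAddCommGroup E] [NormedSpace ℝ E] [CompleteSpace E]
  {M : Type*} [TopologicalSpace M] [ChartedSpace E M] [IsManifold 𝓘(ℝ, E) ∞ M]
  {EG : Type*} [NormedAddCommGroup EG] [NormedSpace ℝ EG] [CompleteSpace EG]
  (G : Type*) [TopologicalSpace G] [ChartedSpace EG G] [Group G] [LieGroup 𝓘(ℝ, EG) ∞ G]
  [MulAction G M] [ContMDiffSMul 𝓘(ℝ, EG) 𝓘(ℝ, E) ∞ G M]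

/-- The `c`-level set of the moment map, with the subspace topology. -/
abbrev LevelSet (μ : M → (EG →L[ℝ] ℝ)) (c : EG →L[ℝ] ℝ) : Type _ := {m : M // μ m = c}

/-- The space of `G`-orbits in the `c`-level set, with the quotient topology. -/
abbrev KahlerQuotient (μ : M → (EG →L[ℝ] ℝ)) (c : EG →L[ℝ] ℝ) : Type _ :=
  Quotient ((MulAction.orbitRel G M).comap (Subtype.val : LevelSet μ c → M))

/-- The orbit projection of the level set. -/
def quotientProj (μ : M → (EG →L[ℝ] ℝ)) (c : EG →L[ℝ] ℝ) (m : LevelSet μ c) :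
    KahlerQuotient G μ c := Quotient.mk _ m

section

variable {EN : Type*} [NormedAddCommGroup EN] [NormedSpace ℝ EN]
  (μ : M → (EG →L[ℝ] ℝ)) (c : EG →L[ℝ] ℝ) [ChartedSpace EN (LevelSet μ c)]

/-- The differential at `m` of the inclusion of the level set in `M`. -/
def inclDeriv (m : LevelSet μ c) :
    TangentSpace 𝓘(ℝ, EN) m →L[ℝ] TangentSpace 𝓘(ℝ, E) (m : M) :=
  mfderiv 𝓘(ℝ, EN) 𝓘(ℝ, E) (Subtype.val : LevelSet μ c → M) m

/-- The given manifold structure makes the level set a (regular) submanifold of `M`: the inclusion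
is a smooth embedding, and the tangent space of the level set at `m` is the kernel of `dμ`. -/
structure IsLevelSubmanifold (E EN : Type*) [NormedAddCommGroup E] [NormedSpace ℝ E]
    [NormedAddCommGroup EN] [NormedSpace ℝ EN]
    {M : Type*} [TopologicalSpace M] [ChartedSpace E M]
    (μ : M → (EG →L[ℝ] ℝ)) (c : EG →L[ℝ] ℝ) [ChartedSpace EN (LevelSet μ c)] : Prop where
  embedding : Manifold.IsSmoothEmbedding 𝓘(ℝ, EN) 𝓘(ℝ, E) ∞ (Subtype.val : LevelSet μ c → M)
  tangent : ∀ m : LevelSet μ c,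
    (mfderiv 𝓘(ℝ, EN) 𝓘(ℝ, E) (Subtype.val : LevelSet μ c → M) m).range =
      (mvfderiv 𝓘(ℝ, E) μ (m : M)).ker

/-- The restriction of the action to the level set is free, proper, isometric (for the metric
induced on the level set) and elliptic. -/
structure WeakRiemannianStructure.IsGoodOnLevel (S : WeakRiemannianStructure E M)
    (EN : Type*) [NormedAddCommGroup EN] [NormedSpace ℝ EN]
    (G : Type*) [TopologicalSpace G] [ChartedSpace EG G] [Group G] [LieGroup 𝓘(ℝ, EG) ∞ G]
    [MulAction G M] [ContMDiffSMul 𝓘(ℝ, EG) 𝓘(ℝ, E) ∞ G M]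
    (μ : M → (EG →L[ℝ] ℝ)) (c : EG →L[ℝ] ℝ) [ChartedSpace EN (LevelSet μ c)] : Prop where
  free : ∀ (a : G) (m : LevelSet μ c), a • (m : M) = m → a = 1
  proper : IsProperMap (fun q : G × LevelSet μ c ↦ (q.1 • (q.2 : M), (q.2 : M)))
  isometric : ∀ (a : G) (m : LevelSet μ c) (v w : TangentSpace 𝓘(ℝ, EN) m),
    S.metric (a • (m : M))
        (mfderiv 𝓘(ℝ, E) 𝓘(ℝ, E) (fun x : M ↦ a • x) (m : M) (inclDeriv μ c m v))
        (mfderiv 𝓘(ℝ, E) 𝓘(ℝ, E) (fun x : M ↦ a • x) (m : M) (inclDeriv μ c m w)) =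
      S.metric (m : M) (inclDeriv μ c m v) (inclDeriv μ c m w)
  elliptic : ∀ m : LevelSet μ c, S.IsEllipticAt (EG := EG) G (m : M)

end

namespace WeakKahlerStructure

variable (S : WeakKahlerStructure E M)

/-- The horizontal space at `m`: the tangent vectors orthogonal to the tangent space of the orbit
and to its image under the complex structure. -/
def horizontal (m : M) : Submodule ℝ (TangentSpace 𝓘(ℝ, E) m) where
  carrier := {v | ∀ ρ : EG, S.metric m v (fundamental G m ρ) = 0 ∧
    S.metric m v (S.J m (fundamental G m ρ)) = 0}
  add_mem' hv hw ρ := by simp [(hv ρ).1, (hv ρ).2, (hw ρ).1, (hw ρ).2]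
  zero_mem' ρ := by simp
  smul_mem' r v hv ρ := by simp [(hv ρ).1, (hv ρ).2]

/-- `Z = A(X, Y)`, where `A` is the O'Neill tensor: `X` and `Y` are horizontal at the point `m` of
the level set, and `Z` is the component in the tangent space of the orbit of the covariant
derivative along `X` of a local vector field which extends `Y` and is horizontal along the level
set. -/
def IsONeill (μ : M → (EG →L[ℝ] ℝ)) (m : M)
    (X Y Z : TangentSpace 𝓘(ℝ, E) m) : Prop :=
  X ∈ S.horizontal (EG := EG) G m ∧ Y ∈ S.horizontal (EG := EG) G m ∧
  Z ∈ orbitTangent (E := E) (EG := EG) G m ∧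
  ∃ Yext : Π x : M, TangentSpace 𝓘(ℝ, E) x,
    CMDiffAt ∞ (T% Yext) m ∧ Yext m = Y ∧
    (∀ᶠ x in 𝓝 m, μ x = μ m → Yext x ∈ S.horizontal (EG := EG) G x) ∧
    ∀ W ∈ orbitTangent (E := E) (EG := EG) G m, S.metric m (S.cov Yext m X - Z) W = 0

/-- The pointwise norm `V(m)` of the O'Neill tensor, possibly infinite: the supremum of
`|A(X, Y)| / (|X| |Y|)` over all nonzero horizontal vectors `X`, `Y` at `m`. -/
def oneillNorm (μ : M → (EG →L[ℝ] ℝ)) (m : M) : ℝ≥0∞ :=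
  ⨆ (X : TangentSpace 𝓘(ℝ, E) m) (Y : TangentSpace 𝓘(ℝ, E) m) (Z : TangentSpace 𝓘(ℝ, E) m)
    (_ : X ≠ 0) (_ : Y ≠ 0) (_ : S.IsONeill G μ m X Y Z),
    ENNReal.ofReal (S.length Z / (S.length X * S.length Y))

variable {EN : Type*} [NormedAddCommGroup EN] [NormedSpace ℝ EN]
  {EQ : Type*} [NormedAddCommGroup EQ] [NormedSpace ℝ EQ] [CompleteSpace EQ]
  (μ : M → (EG →L[ℝ] ℝ)) (c : EG →L[ℝ] ℝ) [ChartedSpace EN (LevelSet μ c)]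
  [ChartedSpace EQ (KahlerQuotient G μ c)]

/-- The differential at `m` of the orbit projection of the level set. -/
def projDeriv (m : LevelSet μ c) :
    TangentSpace 𝓘(ℝ, EN) m →L[ℝ] TangentSpace 𝓘(ℝ, EQ) (quotientProj G μ c m) :=
  mfderiv 𝓘(ℝ, EN) 𝓘(ℝ, EQ) (quotientProj G μ c) m

/-- The weak Riemannian structure `T` is the one of the Kähler quotient: the orbit space carries
its quotient manifold structure, for which the orbit projection is a submersion, and the metric for
which the differential of the projection is isometric on horizontal vectors. -/
structure IsKahlerQuotientStructure [IsManifold 𝓘(ℝ, EQ) ∞ (KahlerQuotient G μ c)]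
    (EN : Type*) [NormedAddCommGroup EN] [NormedSpace ℝ EN] [ChartedSpace EN (LevelSet μ c)]
    (T : WeakRiemannianStructure EQ (KahlerQuotient G μ c)) : Prop where
  submersion : Manifold.IsSubmersion 𝓘(ℝ, EN) 𝓘(ℝ, EQ) ∞ (quotientProj G μ c)
  metric : ∀ (m : LevelSet μ c) (v w : TangentSpace 𝓘(ℝ, EN) m),
    inclDeriv μ c m v ∈ S.horizontal (EG := EG) G (m : M) →
    inclDeriv μ c m w ∈ S.horizontal (EG := EG) G (m : M) →
      T.metric (quotientProj G μ c m) (projDeriv G μ c m v) (projDeriv G μ c m w) =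
        S.metric (m : M) (inclDeriv μ c m v) (inclDeriv μ c m w)

/-- The horizontal lift to the tangent space of `M` at `m` of a subspace `P` of the tangent space
of the quotient at the orbit of `m`: all horizontal vectors which are tangent to the level set and
project into `P`. -/
def horizontalLift (EN : Type*) [NormedAddCommGroup EN] [NormedSpace ℝ EN]
    [ChartedSpace EN (LevelSet μ c)] (m : LevelSet μ c)
    (P : Submodule ℝ (TangentSpace 𝓘(ℝ, EQ) (quotientProj G μ c m))) :
    Submodule ℝ (TangentSpace 𝓘(ℝ, E) (m : M)) :=
  (P.comap (projDeriv (EN := EN) G μ c m).toLinearMap).map (inclDeriv μ c m).toLinearMap ⊓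
    S.horizontal (EG := EG) G (m : M)

end WeakKahlerStructure

end Quotient

end

noncomputable section

set_option synthInstance.maxHeartbeats 200000
set_option linter.unusedSectionVars false

/-! ### Directional derivatives of bilinear expressions -/

section Calculus

variable {X E F : Type*} [NormedAddCommGroup X] [NormedSpace ℝ X]
  [NormedAddCommGroup E] [NormedSpace ℝ E] [NormedAddCommGroup F] [NormedSpace ℝ F]

/-! Everything is computed in charts, with `ψ` the inclusion of the level set, `p` the orbit
projection and `P` the orthogonal projection onto the tangent spaces of the orbits. Along the level
set the metric induced by `ψ` is the pull-back of the quotient metric by `p` plus a vertical form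
(`pulledForm_split`).

For any smooth map, immersion or not, the skew combination of second derivatives of a pulled-back
metric equals the ambient Riemann tensor plus products of covariant second derivatives of the map
(`pulledForm_riemannForm`). Applying this to both `ψ` and `p`, and observing that on horizontal
vectors the vertical form only contributes products of first derivatives, gives the Gauss and
O'Neill equations in one stroke (`riemannForm_sub`): for horizontal orthonormal `i`, `j`, K_Q − K_M
= 3|A(i,j)|² + ⟨B(i,i), B(j,j)⟩ − |B(i,j)|². Here A is the O'Neill tensor, and B is the second
fundamental form of the level set, turned by J into a vertical vector.

The Kähler condition ties B to A. As J is parallel, preserves horizontality and maps vertical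
vectors to vectors orthogonal to the orbit, A(X, JY) = B(X, Y) (`A_J`). So on unit vectors both
tensors are bounded by V, and the difference of curvatures lies between −2V² and 4V².

For the lower bound take the complex line of a unit vector v. There A(v, Jv) = B(v, v) = B(Jv, Jv),
while B(v, Jv) = A(Jv, Jv) = 0 by skewness, so the difference of curvatures is 4|B(v,v)|²
(`exists_plane`). Since B is symmetric, polarization bounds it on pairs of unit vectors by its
values on the diagonal (`g_B_le`), hence V is controlled by complex lines alone.

A weak metric provides neither orthogonal projections nor Christoffel symbols. Ellipticity, together
with the description of the tangent space of the level set as the orthogonal complement of Jǧ,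
splits TM as the sum of that tangent space and Jǧ; inverting this splitting yields a smooth `P`
(`exists_isVertProj`). Curvature is used only with lowered indices, so Christoffel symbols of the
second kind are needed at one point only. -/

lemma fderiv_bilinear_apply {G : X → E →L[ℝ] E →L[ℝ] ℝ} {a b : X → E} {n : X}
    (hG : DifferentiableAt ℝ G n) (ha : DifferentiableAt ℝ a n) (hb : DifferentiableAt ℝ b n)
    (u : X) :
    fderiv ℝ (fun n ↦ G n (a n) (b n)) n u =
      fderiv ℝ G n u (a n) (b n) + G n (fderiv ℝ a n u) (b n) + G n (a n) (fderiv ℝ b n u) := by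
  rw [fderiv_clm_apply (hG.clm_apply ha) hb, fderiv_clm_apply hG ha]
  simp
  ring

/-- The second directional derivative of `f`, first along `k` and then along `i`. -/
def dirDeriv₂ (f : X → F) (n i k : X) : F := fderiv ℝ (fun y ↦ fderiv ℝ f y k) n i

lemma dirDeriv₂_eq {f : X → F} {n : X} (hf : ContDiffAt ℝ 2 f n) (i k : X) :
    dirDeriv₂ f n i k = fderiv ℝ (fderiv ℝ f) n i k := by
  have h : DifferentiableAt ℝ (fderiv ℝ f) n :=
    (hf.fderiv_right (m := 1) (by norm_num)).differentiableAt (by norm_num)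
  rw [dirDeriv₂, fderiv_clm_apply h (by fun_prop)]
  simp

lemma dirDeriv₂_comm {f : X → F} {n : X} (hf : ContDiffAt ℝ 2 f n) (i k : X) :
    dirDeriv₂ f n i k = dirDeriv₂ f n k i := by
  rw [dirDeriv₂_eq hf, dirDeriv₂_eq hf]
  exact (hf.isSymmSndFDerivAt (by simp)) i k

lemma dirDeriv₂_congr {f f' : X → F} {n : X} (h : f =ᶠ[𝓝 n] f') (i k : X) :
    dirDeriv₂ f n i k = dirDeriv₂ f' n i k := by
  unfold dirDeriv₂
  congr 1
  refine Filter.EventuallyEq.fderiv_eq ?_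
  filter_upwards [h.fderiv (𝕜 := ℝ)] with y hy
  rw [hy]

lemma dirDeriv₂_add {f f' : X → F} {n : X} (hf : ContDiffAt ℝ 2 f n) (hf' : ContDiffAt ℝ 2 f' n)
    (i k : X) :
    dirDeriv₂ (fun y ↦ f y + f' y) n i k = dirDeriv₂ f n i k + dirDeriv₂ f' n i k := by
  have e : ∀ᶠ y in 𝓝 n, DifferentiableAt ℝ f y :=
    (hf.eventually (by simp)).mono fun y hy ↦ hy.differentiableAt (by norm_num)
  have e' : ∀ᶠ y in 𝓝 n, DifferentiableAt ℝ f' y :=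
    (hf'.eventually (by simp)).mono fun y hy ↦ hy.differentiableAt (by norm_num)
  have h : DifferentiableAt ℝ (fderiv ℝ f) n :=
    (hf.fderiv_right (m := 1) (by norm_num)).differentiableAt (by norm_num)
  have h' : DifferentiableAt ℝ (fderiv ℝ f') n :=
    (hf'.fderiv_right (m := 1) (by norm_num)).differentiableAt (by norm_num)
  have : (fun y ↦ fderiv ℝ (fun y ↦ f y + f' y) y k) =ᶠ[𝓝 n]
      fun y ↦ fderiv ℝ f y k + fderiv ℝ f' y k := by
    filter_upwards [e, e'] with y hy hy'
    rw [fderiv_fun_add hy hy']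
    rfl
  unfold dirDeriv₂
  rw [this.fderiv_eq, fderiv_fun_add (h.clm_apply (by fun_prop)) (h'.clm_apply (by fun_prop))]
  rfl

lemma dirDeriv₂_bilinear {G : X → E →L[ℝ] E →L[ℝ] ℝ} {a b : X → E} {n : X}
    (hG : ContDiffAt ℝ 2 G n) (ha : ContDiffAt ℝ 2 a n) (hb : ContDiffAt ℝ 2 b n) (i k : X) :
    dirDeriv₂ (fun n ↦ G n (a n) (b n)) n i k =
      dirDeriv₂ G n i k (a n) (b n) + fderiv ℝ G n k (fderiv ℝ a n i) (b n)
        + fderiv ℝ G n k (a n) (fderiv ℝ b n i)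
      + (fderiv ℝ G n i (fderiv ℝ a n k) (b n) + G n (dirDeriv₂ a n i k) (b n)
        + G n (fderiv ℝ a n k) (fderiv ℝ b n i))
      + (fderiv ℝ G n i (a n) (fderiv ℝ b n k) + G n (fderiv ℝ a n i) (fderiv ℝ b n k)
        + G n (a n) (dirDeriv₂ b n i k)) := by
  have dG : ∀ᶠ y in 𝓝 n, DifferentiableAt ℝ G y :=
    (hG.eventually (by simp)).mono fun y hy ↦ hy.differentiableAt (by norm_num)
  have da : ∀ᶠ y in 𝓝 n, DifferentiableAt ℝ a y :=
    (ha.eventually (by simp)).mono fun y hy ↦ hy.differentiableAt (by norm_num)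
  have db : ∀ᶠ y in 𝓝 n, DifferentiableAt ℝ b y :=
    (hb.eventually (by simp)).mono fun y hy ↦ hy.differentiableAt (by norm_num)
  have hG' : DifferentiableAt ℝ (fun y ↦ fderiv ℝ G y k) n :=
    ((hG.fderiv_right (m := 1) (by norm_num)).differentiableAt (by norm_num)).clm_apply
      (by fun_prop)
  have ha' : DifferentiableAt ℝ (fun y ↦ fderiv ℝ a y k) n :=
    ((ha.fderiv_right (m := 1) (by norm_num)).differentiableAt (by norm_num)).clm_apply
      (by fun_prop)
  have hb' : DifferentiableAt ℝ (fun y ↦ fderiv ℝ b y k) n :=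
    ((hb.fderiv_right (m := 1) (by norm_num)).differentiableAt (by norm_num)).clm_apply
      (by fun_prop)
  have e : (fun y ↦ fderiv ℝ (fun n ↦ G n (a n) (b n)) y k) =ᶠ[𝓝 n] fun y ↦
      (fderiv ℝ G y k (a y) (b y) + G y (fderiv ℝ a y k) (b y))
        + G y (a y) (fderiv ℝ b y k) := by
    filter_upwards [dG, da, db] with y h1 h2 h3
    exact fderiv_bilinear_apply h1 h2 h3 k
  have t1 := dG.self_of_nhds
  have t2 := da.self_of_nhds
  have t3 := db.self_of_nhds
  rw [dirDeriv₂, e.fderiv_eq, fderiv_fun_add, fderiv_fun_add]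
  · simp only [add_apply]
    rw [fderiv_bilinear_apply hG' t2 t3, fderiv_bilinear_apply t1 ha' t3,
      fderiv_bilinear_apply t1 t2 hb']
    rfl
  · exact (hG'.clm_apply t2).clm_apply t3
  · exact (t1.clm_apply ha').clm_apply t3
  · exact ((hG'.clm_apply t2).clm_apply t3).add ((t1.clm_apply ha').clm_apply t3)
  · exact (t1.clm_apply t2).clm_apply hb'

lemma fderiv_comp_apply' {g : E → F} {ψ : X → E} {n : X} (hg : DifferentiableAt ℝ g (ψ n))
    (hψ : DifferentiableAt ℝ ψ n) (u : X) :
    fderiv ℝ (fun n ↦ g (ψ n)) n u = fderiv ℝ g (ψ n) (fderiv ℝ ψ n u) := by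
  have := fderiv_comp n hg hψ
  rw [show (fun n ↦ g (ψ n)) = g ∘ ψ from rfl, this]
  rfl

lemma dirDeriv₂_comp {g : E → F} {ψ : X → E} {n : X} (hg : ContDiffAt ℝ 2 g (ψ n))
    (hψ : ContDiffAt ℝ 2 ψ n) (i k : X) :
    dirDeriv₂ (fun n ↦ g (ψ n)) n i k =
      dirDeriv₂ g (ψ n) (fderiv ℝ ψ n i) (fderiv ℝ ψ n k)
        + fderiv ℝ g (ψ n) (dirDeriv₂ ψ n i k) := by
  have dψ : ∀ᶠ y in 𝓝 n, DifferentiableAt ℝ ψ y :=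
    (hψ.eventually (by simp)).mono fun y hy ↦ hy.differentiableAt (by norm_num)
  have dg : ∀ᶠ y in 𝓝 n, DifferentiableAt ℝ g (ψ y) :=
    hψ.continuousAt.eventually
      ((hg.eventually (by simp)).mono fun y hy ↦ hy.differentiableAt (by norm_num))
  have hg' : DifferentiableAt ℝ (fderiv ℝ g) (ψ n) :=
    (hg.fderiv_right (m := 1) (by norm_num)).differentiableAt (by norm_num)
  have hψ' : DifferentiableAt ℝ (fun y ↦ fderiv ℝ ψ y k) n :=
    ((hψ.fderiv_right (m := 1) (by norm_num)).differentiableAt (by norm_num)).clm_apply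
      (by fun_prop)
  have e : (fun y ↦ fderiv ℝ (fun n ↦ g (ψ n)) y k) =ᶠ[𝓝 n] fun y ↦
      fderiv ℝ g (ψ y) (fderiv ℝ ψ y k) := by
    filter_upwards [dψ, dg] with y h1 h2
    exact fderiv_comp_apply' h2 h1 k
  have c := dψ.self_of_nhds
  have hc : DifferentiableAt ℝ (fun y ↦ fderiv ℝ g (ψ y)) n := hg'.comp n c
  rw [dirDeriv₂, e.fderiv_eq, fderiv_clm_apply hc hψ', dirDeriv₂_eq hg]
  simp only [add_apply, ContinuousLinearMap.comp_apply,
    ContinuousLinearMap.flip_apply]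
  rw [fderiv_comp_apply' hg' c, add_comm]
  rfl

end Calculus

/-! ### Curvature of a metric in a chart -/

section LocalMetric

variable {X E : Type*} [NormedAddCommGroup X] [NormedSpace ℝ X]
  [NormedAddCommGroup E] [NormedSpace ℝ E]

/-- The Christoffel symbols of the first kind of the local metric `g`. -/
def christoffel (g : E → E →L[ℝ] E →L[ℝ] ℝ) (x u v w : E) : ℝ :=
  (fderiv ℝ g x u v w + fderiv ℝ g x v u w - fderiv ℝ g x w u v) / 2

/-- The Riemann tensor with lowered indices of the local metric `g`, where `Γ` are the Christoffel
symbols of the second kind at the point `x`. -/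
def riemannForm (g : E → E →L[ℝ] E →L[ℝ] ℝ) (Γ : E → E → E) (x u v w z : E) : ℝ :=
  (dirDeriv₂ g x u w v z - dirDeriv₂ g x u z v w - dirDeriv₂ g x v w u z
    + dirDeriv₂ g x v z u w) / 2 - g x (Γ v w) (Γ u z) + g x (Γ u w) (Γ v z)

/-- The symmetry of `g` near `x`. -/
def SymmNear (g : E → E →L[ℝ] E →L[ℝ] ℝ) (x : E) : Prop := ∀ᶠ y in 𝓝 x, ∀ u v, g y u v = g y v u

lemma fderiv_apply₂ {g : X → E →L[ℝ] E →L[ℝ] ℝ} {x : X} (hg : DifferentiableAt ℝ g x) (u : X)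
    (v w : E) : fderiv ℝ (fun y ↦ g y v w) x u = fderiv ℝ g x u v w := by
  rw [fderiv_bilinear_apply hg (by fun_prop) (by fun_prop)]
  simp

lemma SymmNear.fderiv_symm {g : E → E →L[ℝ] E →L[ℝ] ℝ} {x : E} (h : SymmNear g x)
    (hg : DifferentiableAt ℝ g x) (u v w : E) : fderiv ℝ g x u v w = fderiv ℝ g x u w v := by
  rw [← fderiv_apply₂ hg, ← fderiv_apply₂ hg]
  congr 1
  refine Filter.EventuallyEq.fderiv_eq ?_
  filter_upwards [h] with y hy
  exact hy v w

lemma dirDeriv₂_apply₂ {g : X → E →L[ℝ] E →L[ℝ] ℝ} {x : X} (hg : ContDiffAt ℝ 2 g x) (i k : X)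
    (v w : E) : dirDeriv₂ (fun y ↦ g y v w) x i k = dirDeriv₂ g x i k v w := by
  have hc : ∀ (v : E) (y : X), fderiv ℝ (fun _ : X ↦ v) y = 0 := fun v y ↦ by simp
  have h0 : ∀ v : E, dirDeriv₂ (fun _ : X ↦ v) x i k = 0 := fun v ↦ by simp [dirDeriv₂]
  rw [dirDeriv₂_bilinear hg contDiffAt_const contDiffAt_const]
  simp [hc, h0]

lemma SymmNear.dirDeriv₂_symm {g : E → E →L[ℝ] E →L[ℝ] ℝ} {x : E} (h : SymmNear g x)
    (hg : ContDiffAt ℝ 2 g x) (i k v w : E) : dirDeriv₂ g x i k v w = dirDeriv₂ g x i k w v := by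
  rw [← dirDeriv₂_apply₂ hg, ← dirDeriv₂_apply₂ hg]
  refine dirDeriv₂_congr ?_ _ _
  filter_upwards [h] with y hy
  exact hy v w

lemma christoffel_comm {g : E → E →L[ℝ] E →L[ℝ] ℝ} {x : E} (h : SymmNear g x)
    (hg : DifferentiableAt ℝ g x) (u v w : E) : christoffel g x u v w = christoffel g x v u w := by
  unfold christoffel
  rw [h.fderiv_symm hg w u v]
  ring

/-- The coefficient in the directions `u`, `v` of the quadratic form obtained from the local
metric `g` along the map `ψ` and the family `α` of linear maps. -/
def pulledForm (g : E → E →L[ℝ] E →L[ℝ] ℝ) (ψ : X → E) (α : X → X →L[ℝ] E) (u v : X) (n : X) : ℝ :=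
  g (ψ n) (α n u) (α n v)

lemma fderiv_pulledForm {g : E → E →L[ℝ] E →L[ℝ] ℝ} {ψ : X → E} {α : X → X →L[ℝ] E} {n : X}
    (hg : DifferentiableAt ℝ g (ψ n)) (hψ : DifferentiableAt ℝ ψ n) (hα : DifferentiableAt ℝ α n)
    (u v k : X) :
    fderiv ℝ (pulledForm g ψ α u v) n k =
      fderiv ℝ g (ψ n) (fderiv ℝ ψ n k) (α n u) (α n v)
        + g (ψ n) (fderiv ℝ (fun n ↦ α n u) n k) (α n v)
        + g (ψ n) (α n u) (fderiv ℝ (fun n ↦ α n v) n k) := by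
  unfold pulledForm
  have hgc : DifferentiableAt ℝ (fun n ↦ g (ψ n)) n :=
    DifferentiableAt.comp (g := g) n hg hψ
  rw [fderiv_bilinear_apply hgc
    (hα.clm_apply (by fun_prop)) (hα.clm_apply (by fun_prop)), fderiv_comp_apply' (g := g) hg hψ]

lemma contDiffAt_pulledForm {g : E → E →L[ℝ] E →L[ℝ] ℝ} {ψ : X → E} {α : X → X →L[ℝ] E} {n : X}
    (hg : ContDiffAt ℝ 2 g (ψ n)) (hψ : ContDiffAt ℝ 2 ψ n) (hα : ContDiffAt ℝ 2 α n)
    (u v : X) : ContDiffAt ℝ 2 (pulledForm g ψ α u v) n :=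
  ((hg.comp n hψ).clm_apply (hα.clm_apply contDiffAt_const)).clm_apply
    (hα.clm_apply contDiffAt_const)

/-- The derivative of the pulled-back metric produces six terms with second derivatives of `ψ`; by
their symmetry four of them cancel in the Koszul combination. Nothing requires `ψ` to be an
immersion, so the identity serves the submersion `p` as well. -/
lemma pulledForm_christoffel {g : E → E →L[ℝ] E →L[ℝ] ℝ} {ψ : X → E} {n : X}
    (hs : SymmNear g (ψ n)) (hg : DifferentiableAt ℝ g (ψ n)) (hψ : ContDiffAt ℝ 2 ψ n)
    (u v w : X) :
    (fderiv ℝ (pulledForm g ψ (fderiv ℝ ψ) v w) n u + fderiv ℝ (pulledForm g ψ (fderiv ℝ ψ) u w) n v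
      - fderiv ℝ (pulledForm g ψ (fderiv ℝ ψ) u v) n w) / 2 =
    g (ψ n) (dirDeriv₂ ψ n u v) (fderiv ℝ ψ n w)
      + christoffel g (ψ n) (fderiv ℝ ψ n u) (fderiv ℝ ψ n v) (fderiv ℝ ψ n w) := by
  have hα : DifferentiableAt ℝ (fderiv ℝ ψ) n :=
    (hψ.fderiv_right (m := 1) (by norm_num)).differentiableAt (by norm_num)
  have hψ' := hψ.differentiableAt (by norm_num)
  have key : ∀ a b c : X, fderiv ℝ (pulledForm g ψ (fderiv ℝ ψ) a b) n c =
      fderiv ℝ g (ψ n) (fderiv ℝ ψ n c) (fderiv ℝ ψ n a) (fderiv ℝ ψ n b)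
        + g (ψ n) (dirDeriv₂ ψ n c a) (fderiv ℝ ψ n b)
        + g (ψ n) (fderiv ℝ ψ n a) (dirDeriv₂ ψ n c b) :=
    fun a b c ↦ fderiv_pulledForm hg hψ' hα a b c
  rw [key, key, key, christoffel, dirDeriv₂_comm hψ v u, dirDeriv₂_comm hψ w u,
    dirDeriv₂_comm hψ w v, hs.self_of_nhds (fderiv ℝ ψ n v) (dirDeriv₂ ψ n u w)]
  have := hs.self_of_nhds (fderiv ℝ ψ n u) (dirDeriv₂ ψ n v w)
  linarith

/-- The covariant derivative at `n` of the vector field `∂_k ψ` along `ψ` in the direction `j`. -/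
def secondForm (Γ : E → E → E) (ψ : X → E) (n j k : X) : E :=
  dirDeriv₂ ψ n j k + Γ (fderiv ℝ ψ n j) (fderiv ℝ ψ n k)

set_option maxHeartbeats 1000000 in
-- This is the Gauss equation in a form that survives degenerate pull-backs. The left side is the
-- leading part of the lowered Riemann tensor of the pulled-back form; third derivatives of `ψ` drop
-- out of it, and the remaining second derivatives complete to the covariant ones in `secondForm`.
lemma pulledForm_riemannForm {g : E → E →L[ℝ] E →L[ℝ] ℝ} {Γ : E → E → E} {ψ : X → E} {n : X}
    (hs : SymmNear g (ψ n)) (hg : ContDiffAt ℝ 2 g (ψ n)) (hψ : ContDiffAt ℝ 3 ψ n)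
    (hΓ : ∀ u v w, g (ψ n) (Γ u v) w = christoffel g (ψ n) u v w) (i j k l : X) :
    (dirDeriv₂ (pulledForm g ψ (fderiv ℝ ψ) j l) n i k
      - dirDeriv₂ (pulledForm g ψ (fderiv ℝ ψ) j k) n i l
      - dirDeriv₂ (pulledForm g ψ (fderiv ℝ ψ) i l) n j k
      + dirDeriv₂ (pulledForm g ψ (fderiv ℝ ψ) i k) n j l) / 2 =
    riemannForm g Γ (ψ n) (fderiv ℝ ψ n i) (fderiv ℝ ψ n j) (fderiv ℝ ψ n k) (fderiv ℝ ψ n l)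
      + g (ψ n) (secondForm Γ ψ n j k) (secondForm Γ ψ n i l)
      - g (ψ n) (secondForm Γ ψ n i k) (secondForm Γ ψ n j l) := by
  have hψ2 : ContDiffAt ℝ 2 ψ n := hψ.of_le (by norm_num)
  have hα : ContDiffAt ℝ 2 (fderiv ℝ ψ) n := hψ.fderiv_right (by norm_num)
  have hg' := hg.differentiableAt (by norm_num)
  have hψ' := hψ.differentiableAt (by norm_num)
  have key : ∀ a b c d : X, dirDeriv₂ (pulledForm g ψ (fderiv ℝ ψ) c d) n a b =
      _ := fun a b c d ↦
    dirDeriv₂_bilinear (G := fun n ↦ g (ψ n)) (hg.comp n hψ2) (a := fun n ↦ fderiv ℝ ψ n c)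
      (hα.clm_apply contDiffAt_const) (b := fun n ↦ fderiv ℝ ψ n d)
      (hα.clm_apply contDiffAt_const) a b
  have S : ∀ a b, fderiv ℝ (fun n ↦ fderiv ℝ ψ n a) n b = dirDeriv₂ ψ n b a := fun a b ↦ rfl
  have Sc : ∀ a b, dirDeriv₂ ψ n a b = dirDeriv₂ ψ n b a := dirDeriv₂_comm hψ2
  -- `T1` and `T2` together give the full symmetry of the third derivatives of `ψ`, which makes them
  -- cancel in the final linear combination.
  have T1 : ∀ a b c, dirDeriv₂ (fun n ↦ fderiv ℝ ψ n c) n a b =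
      dirDeriv₂ (fun n ↦ fderiv ℝ ψ n c) n b a :=
    fun a b c ↦ dirDeriv₂_comm (hα.clm_apply contDiffAt_const) a b
  have T2 : ∀ a b c, dirDeriv₂ (fun n ↦ fderiv ℝ ψ n c) n a b =
      dirDeriv₂ (fun n ↦ fderiv ℝ ψ n b) n a c := by
    intro a b c
    change fderiv ℝ (fun y ↦ dirDeriv₂ ψ y b c) n a = fderiv ℝ (fun y ↦ dirDeriv₂ ψ y c b) n a
    congr 1
    refine Filter.EventuallyEq.fderiv_eq ?_
    filter_upwards [hψ2.eventually (by simp)] with y hy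
    exact dirDeriv₂_comm hy b c
  have sy := hs.self_of_nhds
  have dsy := hs.fderiv_symm hg'
  have C : ∀ a b u, g (ψ n) (Γ a b) u = _ := fun a b u ↦ hΓ a b u
  have C' : ∀ a b u, g (ψ n) u (Γ a b) = _ := fun a b u ↦ (sy _ _).trans (hΓ a b u)
  simp only [christoffel] at C C'
  simp only [key, riemannForm, secondForm, map_add, add_apply, C', C, S,
    dirDeriv₂_comp hg hψ2, fderiv_comp_apply' hg' hψ']
  rw [T2 i l j, T2 j k i, T1 j i k, T2 j l i, T1 j i l,
    T2 i l k, T2 j l k, T2 i k j]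
  rw [Sc j i, Sc k i, Sc k j, Sc l i, Sc l j, Sc l k]
  generalize dirDeriv₂ ψ n i j = ij, dirDeriv₂ ψ n i k = ik, dirDeriv₂ ψ n i l = il,
    dirDeriv₂ ψ n j k = jk, dirDeriv₂ ψ n j l = jl, dirDeriv₂ ψ n k l = kl,
    fderiv ℝ ψ n i = vi, fderiv ℝ ψ n j = vj, fderiv ℝ ψ n k = vk, fderiv ℝ ψ n l = vl at *
  linarith [sy jl ik, sy il jk, dsy vi jk vl, dsy vi jl vk, dsy vj ik vl, dsy vj il vk]

end LocalMetric

/-! ### The Kähler quotient in charts -/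

/-- The Kähler quotient seen in charts: `ψ` is the inclusion of the level set and `p` the orbit
projection, `g` and `J` are the Kähler structure, `gQ` is the quotient metric, and `Γ`, `ΓQ` are the
Christoffel symbols at the base point. The tangent space of the orbit through `ψ n` is the image
under `fderiv ℝ ψ n` of the kernel of `fderiv ℝ p n`. -/
structure LocalKahlerQuotient (X E Q : Type*) [NormedAddCommGroup X] [NormedSpace ℝ X]
    [NormedAddCommGroup E] [NormedSpace ℝ E] [NormedAddCommGroup Q] [NormedSpace ℝ Q] where
  g : E → E →L[ℝ] E →L[ℝ] ℝ
  J : E → E →L[ℝ] E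
  gQ : Q → Q →L[ℝ] Q →L[ℝ] ℝ
  ψ : X → E
  p : X → Q
  n₀ : X
  Γ : E → E → E
  ΓQ : Q → Q → Q
  g_smooth : ContDiffAt ℝ ∞ g (ψ n₀)
  J_smooth : ContDiffAt ℝ ∞ J (ψ n₀)
  gQ_smooth : ContDiffAt ℝ ∞ gQ (p n₀)
  ψ_smooth : ContDiffAt ℝ ∞ ψ n₀
  p_smooth : ContDiffAt ℝ ∞ p n₀
  g_symm : SymmNear g (ψ n₀)
  gQ_symm : SymmNear gQ (p n₀)
  g_pos : ∀ᶠ y in 𝓝 (ψ n₀), ∀ v, v ≠ 0 → 0 < g y v v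
  gQ_pos : ∀ v, v ≠ 0 → 0 < gQ (p n₀) v v
  J_sq : ∀ᶠ y in 𝓝 (ψ n₀), ∀ v, J y (J y v) = -v
  J_isometry : ∀ᶠ y in 𝓝 (ψ n₀), ∀ v w, g y (J y v) (J y w) = g y v w
  orthogonal : ∀ᶠ n in 𝓝 n₀, ∀ v w, fderiv ℝ p n w = 0 →
    g (ψ n) (fderiv ℝ ψ n v) (J (ψ n) (fderiv ℝ ψ n w)) = 0
  riemannian : ∀ᶠ n in 𝓝 n₀, ∀ v v',
    (∀ w, fderiv ℝ p n w = 0 → g (ψ n) (fderiv ℝ ψ n v) (fderiv ℝ ψ n w) = 0) →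
    (∀ w, fderiv ℝ p n w = 0 → g (ψ n) (fderiv ℝ ψ n v') (fderiv ℝ ψ n w) = 0) →
      gQ (p n) (fderiv ℝ p n v) (fderiv ℝ p n v') =
        g (ψ n) (fderiv ℝ ψ n v) (fderiv ℝ ψ n v')
  injective : Function.Injective (fderiv ℝ ψ n₀)
  rightInverse : ∃ s : Q →L[ℝ] X, ∀ q, fderiv ℝ p n₀ (s q) = q
  elliptic : ∀ e, ∃ w, fderiv ℝ p n₀ w = 0 ∧
    ∀ w', fderiv ℝ p n₀ w' = 0 → g (ψ n₀) (e - fderiv ℝ ψ n₀ w) (fderiv ℝ ψ n₀ w') = 0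
  tangent : ∀ e, (∀ w, fderiv ℝ p n₀ w = 0 → g (ψ n₀) e (J (ψ n₀) (fderiv ℝ ψ n₀ w)) = 0) →
    ∃ v, fderiv ℝ ψ n₀ v = e
  Γ_spec : ∀ u v w, g (ψ n₀) (Γ u v) w = christoffel g (ψ n₀) u v w
  ΓQ_spec : ∀ u v w, gQ (p n₀) (ΓQ u v) w = christoffel gQ (p n₀) u v w

namespace LocalKahlerQuotient

variable {X E Q : Type*} [NormedAddCommGroup X] [NormedSpace ℝ X]
    [NormedAddCommGroup E] [NormedSpace ℝ E] [NormedAddCommGroup Q] [NormedSpace ℝ Q]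
    (L : LocalKahlerQuotient X E Q)

lemma contDiffAt_fderiv_ψ : ContDiffAt ℝ ∞ (fderiv ℝ L.ψ) L.n₀ :=
  L.ψ_smooth.fderiv_right (by simp)

lemma contDiffAt_fderiv_p : ContDiffAt ℝ ∞ (fderiv ℝ L.p) L.n₀ :=
  L.p_smooth.fderiv_right (by simp)

lemma continuousAt_ψ : Filter.Tendsto L.ψ (𝓝 L.n₀) (𝓝 (L.ψ L.n₀)) := L.ψ_smooth.continuousAt

lemma metric_J_left {y : E} (h₁ : ∀ v, L.J y (L.J y v) = -v)
    (h₂ : ∀ v w, L.g y (L.J y v) (L.J y w) = L.g y v w) (v w : E) :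
    L.g y (L.J y v) w = - L.g y v (L.J y w) := by
  have := h₂ v (L.J y w)
  rw [h₁] at this
  simp at this
  linarith

lemma eq_zero_of_metric_self {v : E} (h : L.g (L.ψ L.n₀) v v = 0) : v = 0 := by
  by_contra hv
  exact (L.g_pos.self_of_nhds v hv).ne' h

/-- A smooth family of projections onto the kernels of the differentials of the submersion. -/
lemma exists_kernelProj [CompleteSpace Q] : ∃ B : X → X →L[ℝ] X, ContDiffAt ℝ ∞ B L.n₀ ∧
    (∀ᶠ n in 𝓝 L.n₀, ∀ w, fderiv ℝ L.p n (B n w) = 0) ∧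
    ∀ w, fderiv ℝ L.p L.n₀ w = 0 → B L.n₀ w = w := by
  obtain ⟨s, hs⟩ := L.rightInverse
  have hsm : ContDiffAt ℝ ∞ (fun n ↦ fderiv ℝ L.p n ∘L s) L.n₀ :=
    L.contDiffAt_fderiv_p.clm_comp contDiffAt_const
  have h0 : fderiv ℝ L.p L.n₀ ∘L s = (ContinuousLinearEquiv.refl ℝ Q : Q →L[ℝ] Q) := by
    ext q
    simp [hs]
  have hinv : ContDiffAt ℝ ∞ (fun n ↦ (fderiv ℝ L.p n ∘L s).inverse) L.n₀ := by
    refine ContDiffAt.comp (g := ContinuousLinearMap.inverse) L.n₀ ?_ hsm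
    rw [h0]
    exact contDiffAt_map_inverse _
  refine ⟨fun n ↦ ContinuousLinearMap.id ℝ X -
    s ∘L ((fderiv ℝ L.p n ∘L s).inverse ∘L fderiv ℝ L.p n), ?_, ?_, ?_⟩
  · exact contDiffAt_const.sub
      (contDiffAt_const.clm_comp (hinv.clm_comp L.contDiffAt_fderiv_p))
  · have hopen : ∀ᶠ A in 𝓝 (fderiv ℝ L.p L.n₀ ∘L s), A.IsInvertible := by
      rw [h0]
      exact (ContinuousLinearEquiv.refl ℝ Q).nhds
    filter_upwards [hsm.continuousAt.eventually hopen] with n hn w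
    simp only [sub_apply, ContinuousLinearMap.comp_apply, map_sub,
      ContinuousLinearMap.id_apply]
    have := hn.self_apply_inverse (fderiv ℝ L.p n w)
    simp only [ContinuousLinearMap.comp_apply] at this
    rw [this, sub_self]
  · intro w hw
    simp [hw]

/-- `P` is the family of orthogonal projections onto the tangent spaces of the orbits. -/
structure IsVertProj (P : X → E →L[ℝ] E) : Prop where
  smooth : ContDiffAt ℝ ∞ P L.n₀
  mem : ∀ᶠ n in 𝓝 L.n₀, ∀ e, ∃ w, fderiv ℝ L.p n w = 0 ∧ P n e = fderiv ℝ L.ψ n w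
  orthogonal : ∀ᶠ n in 𝓝 L.n₀, ∀ e w, fderiv ℝ L.p n w = 0 →
    L.g (L.ψ n) (e - P n e) (fderiv ℝ L.ψ n w) = 0

lemma exists_isVertProj [CompleteSpace X] [CompleteSpace E] [CompleteSpace Q] :
    ∃ P : X → E →L[ℝ] E, L.IsVertProj P := by
  obtain ⟨B, hB, hBK, hB0⟩ := L.exists_kernelProj
  let K : Submodule ℝ X := (fderiv ℝ L.p L.n₀).ker
  have hK : IsClosed (K : Set X) := (fderiv ℝ L.p L.n₀).isClosed_ker
  have : CompleteSpace K := hK.completeSpace_coe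
  have hJψ : ContDiffAt ℝ ∞ (fun n ↦ L.J (L.ψ n)) L.n₀ :=
    ContDiffAt.comp (g := L.J) L.n₀ L.J_smooth L.ψ_smooth
  -- `Φ n` is the sum map of the tangent space of the level set and J of the vertical space. The
  -- fixed space `K` parametrizes the vertical spaces through `B n`, so all `Φ n` have the same
  -- domain.
  let Φ : X → (X × K) →L[ℝ] E := fun n ↦ (fderiv ℝ L.ψ n) ∘L (ContinuousLinearMap.fst ℝ X K) +
    L.J (L.ψ n) ∘L (fderiv ℝ L.ψ n ∘L (B n ∘L (K.subtypeL ∘L ContinuousLinearMap.snd ℝ X K)))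
  have hΦ : ContDiffAt ℝ ∞ Φ L.n₀ := (L.contDiffAt_fderiv_ψ.clm_comp contDiffAt_const).add
    (hJψ.clm_comp (L.contDiffAt_fderiv_ψ.clm_comp (hB.clm_comp contDiffAt_const)))
  have Φ_apply : ∀ n x, Φ n x = fderiv ℝ L.ψ n x.1 +
      L.J (L.ψ n) (fderiv ℝ L.ψ n (B n x.2)) := fun n x ↦ rfl
  have sy := L.g_symm.self_of_nhds
  have Js := L.J_sq.self_of_nhds
  have Ji := L.J_isometry.self_of_nhds
  have or := L.orthogonal.self_of_nhds
  have hinj : Function.Injective (Φ L.n₀) := by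
    rw [injective_iff_map_eq_zero]
    rintro ⟨v, w⟩ h
    rw [Φ_apply, hB0 _ w.2] at h
    have hw : fderiv ℝ L.p L.n₀ w = 0 := w.2
    have h1 : fderiv ℝ L.ψ L.n₀ v = 0 := by
      apply L.eq_zero_of_metric_self
      have := congrArg (L.g (L.ψ L.n₀) (fderiv ℝ L.ψ L.n₀ v)) h
      rw [map_add, or v w hw, add_zero, map_zero] at this
      exact this
    rw [h1, zero_add] at h
    have h2 : fderiv ℝ L.ψ L.n₀ w = 0 := by
      have := Js (fderiv ℝ L.ψ L.n₀ w)
      rw [h, map_zero] at this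
      simpa using this.symm
    have h3 : v = 0 := L.injective (by rw [h1, map_zero])
    have h4 : (w : X) = 0 := L.injective (by rw [h2, map_zero])
    ext
    · exact h3
    · exact h4
  have hsurj : Function.Surjective (Φ L.n₀) := by
    intro e
    -- Projecting `J e` to the orbit leaves a remainder orthogonal to the vertical space; −J turns
    -- it into e + J dψ(w), which is orthogonal to J of the vertical space and hence tangent to the
    -- level set.
    obtain ⟨w, hw, hw'⟩ := L.elliptic (L.J (L.ψ L.n₀) e)
    obtain ⟨v, hv⟩ := L.tangent (e + L.J (L.ψ L.n₀) (fderiv ℝ L.ψ L.n₀ w)) (by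
      intro w' h'
      have := hw' w' h'
      rw [← Ji, map_sub, Js, sub_eq_add_neg, ← neg_add, map_neg] at this
      simp at this ⊢
      linarith)
    refine ⟨(v, ⟨-w, by simp [K, hw]⟩), ?_⟩
    rw [Φ_apply, hB0 _ (by simp [hw]), hv]
    simp
  -- A continuous linear bijection of Banach spaces is an isomorphism. Isomorphisms are open and
  -- inversion is smooth, so the splitting at the base point propagates to a neighbourhood.
  let e₀ : (X × K) ≃L[ℝ] E := ContinuousLinearEquiv.ofBijective (Φ L.n₀)
    (LinearMap.ker_eq_bot.2 hinj) (LinearMap.range_eq_top.2 hsurj)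
  have he₀ : Φ L.n₀ = e₀ := by
    ext <;> rfl
  have hinv : ContDiffAt ℝ ∞ (fun n ↦ (Φ n).inverse) L.n₀ := by
    refine ContDiffAt.comp (g := ContinuousLinearMap.inverse) L.n₀ ?_ hΦ
    rw [he₀]
    exact contDiffAt_map_inverse _
  have hopen : ∀ᶠ n in 𝓝 L.n₀, (Φ n).IsInvertible := by
    have hopen : ∀ᶠ A in 𝓝 (Φ L.n₀), A.IsInvertible := by
      rw [he₀]
      exact e₀.nhds
    exact hΦ.continuousAt.eventually hopen
  -- If J e = dψ(x) + J dψ(w) with `w` vertical, then e − dψ(w) = −J dψ(x), and J of a tangent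
  -- vector of the level set is orthogonal to the orbit. So the second component of the splitting of
  -- `J e` gives the vertical part of `e`.
  refine ⟨fun n ↦ fderiv ℝ L.ψ n ∘L (B n ∘L (K.subtypeL ∘L (ContinuousLinearMap.snd ℝ X K ∘L
    ((Φ n).inverse ∘L L.J (L.ψ n))))), ?_, ?_, ?_⟩
  · exact L.contDiffAt_fderiv_ψ.clm_comp (hB.clm_comp (contDiffAt_const.clm_comp
      (contDiffAt_const.clm_comp (hinv.clm_comp hJψ))))
  · filter_upwards [hBK] with n hk e using ⟨_, hk _, rfl⟩
  · filter_upwards [hopen, hBK, L.orthogonal, L.continuousAt_ψ.eventually L.J_sq,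
      L.continuousAt_ψ.eventually L.J_isometry, L.continuousAt_ψ.eventually L.g_symm]
      with n hn hk ho hJ hi hs e w hw
    have h1 := hn.self_apply_inverse (L.J (L.ψ n) e)
    set x := (Φ n).inverse (L.J (L.ψ n) e) with hx
    rw [Φ_apply] at h1
    have h2 : e - fderiv ℝ L.ψ n (B n x.2) = - L.J (L.ψ n) (fderiv ℝ L.ψ n x.1) := by
      have := congrArg (L.J (L.ψ n)) h1
      rw [map_add, hJ, hJ] at this
      rw [sub_eq_iff_eq_add, ← neg_inj, ← this]
      abel
    change L.g (L.ψ n) (e - fderiv ℝ L.ψ n (B n x.2)) (fderiv ℝ L.ψ n w) = 0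
    rw [h2, map_neg, neg_apply, L.metric_J_left hJ hi, ho _ _ hw]
    simp

end LocalKahlerQuotient

namespace LocalKahlerQuotient

variable {X E Q : Type*} [NormedAddCommGroup X] [NormedSpace ℝ X]
    [NormedAddCommGroup E] [NormedSpace ℝ E] [NormedAddCommGroup Q] [NormedSpace ℝ Q]
    (L : LocalKahlerQuotient X E Q)

/-! #### Linear algebra at the base point -/

/-- The vectors at the base point which are orthogonal to the tangent space of the orbit. -/
def Hor (v : X) : Prop := ∀ w, fderiv ℝ L.p L.n₀ w = 0 →
  L.g (L.ψ L.n₀) (fderiv ℝ L.ψ L.n₀ v) (fderiv ℝ L.ψ L.n₀ w) = 0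

lemma g_comm (v w : E) : L.g (L.ψ L.n₀) v w = L.g (L.ψ L.n₀) w v := L.g_symm.self_of_nhds v w

lemma J_J (v : E) : L.J (L.ψ L.n₀) (L.J (L.ψ L.n₀) v) = -v := L.J_sq.self_of_nhds v

lemma g_J_J (v w : E) : L.g (L.ψ L.n₀) (L.J (L.ψ L.n₀) v) (L.J (L.ψ L.n₀) w) =
    L.g (L.ψ L.n₀) v w := L.J_isometry.self_of_nhds v w

lemma g_J_left (v w : E) : L.g (L.ψ L.n₀) (L.J (L.ψ L.n₀) v) w =
    - L.g (L.ψ L.n₀) v (L.J (L.ψ L.n₀) w) :=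
  L.metric_J_left L.J_J L.g_J_J v w

lemma g_tangent_J (v w : X) (hw : fderiv ℝ L.p L.n₀ w = 0) :
    L.g (L.ψ L.n₀) (fderiv ℝ L.ψ L.n₀ v) (L.J (L.ψ L.n₀) (fderiv ℝ L.ψ L.n₀ w)) = 0 :=
  L.orthogonal.self_of_nhds v w hw

/-- Positivity is the only nondegeneracy that a weak metric offers. It suffices to make the bare
function `Γ` symmetric and bilinear. -/
lemma ext_of_g {v w : E} (h : ∀ u, L.g (L.ψ L.n₀) v u = L.g (L.ψ L.n₀) w u) : v = w := by
  rw [← sub_eq_zero]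
  apply L.eq_zero_of_metric_self
  rw [map_sub (L.g (L.ψ L.n₀)), sub_apply, h, sub_self]

lemma Γ_comm (u v : E) : L.Γ u v = L.Γ v u := by
  apply L.ext_of_g
  intro w
  rw [L.Γ_spec, L.Γ_spec, christoffel_comm L.g_symm (L.g_smooth.differentiableAt (by simp))]

lemma Γ_add_left (u u' v : E) : L.Γ (u + u') v = L.Γ u v + L.Γ u' v := by
  apply L.ext_of_g
  intro w
  simp only [map_add, add_apply, L.Γ_spec, christoffel]
  ring

lemma Γ_smul_left (r : ℝ) (u v : E) : L.Γ (r • u) v = r • L.Γ u v := by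
  apply L.ext_of_g
  intro w
  simp only [map_smul, smul_apply, L.Γ_spec, christoffel, smul_eq_mul]
  ring

/-- The covariant derivative at the base point of the vector field `∂_k ψ` in the direction `j`. -/
def D (j k : X) : E := secondForm L.Γ L.ψ L.n₀ j k

lemma ψ_contDiffAt₂ : ContDiffAt ℝ 2 L.ψ L.n₀ := L.ψ_smooth.of_le (by norm_cast)

lemma D_comm (j k : X) : L.D j k = L.D k j := by
  unfold D secondForm
  rw [L.Γ_comm, dirDeriv₂_comm L.ψ_contDiffAt₂]

lemma D_add_left (i j k : X) : L.D (i + j) k = L.D i k + L.D j k := by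
  simp only [D, secondForm, dirDeriv₂_eq L.ψ_contDiffAt₂, map_add, add_apply, L.Γ_add_left]
  abel

lemma D_smul_left (r : ℝ) (j k : X) : L.D (r • j) k = r • L.D j k := by
  simp only [D, secondForm, dirDeriv₂_eq L.ψ_contDiffAt₂, map_smul, smul_apply, L.Γ_smul_left,
    smul_add]

lemma exists_hor (q : Q) : ∃ v, L.Hor v ∧ fderiv ℝ L.p L.n₀ v = q := by
  obtain ⟨s, hs⟩ := L.rightInverse
  obtain ⟨w, hw, h⟩ := L.elliptic (fderiv ℝ L.ψ L.n₀ (s q))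
  refine ⟨s q - w, fun w' hw' ↦ ?_, ?_⟩
  · rw [map_sub]
    exact h w' hw'
  · rw [map_sub, hs, hw, sub_zero]

/-! ### Orthogonal decomposition at the base point and the splitting of the pulled-back metric. -/

namespace IsVertProj

variable {L} {P : X → E →L[ℝ] E} (hP : L.IsVertProj P)

include hP

/-- Two candidates for the orthogonal projection differ by a vertical vector that is orthogonal to
all vertical vectors, in particular to itself. -/
lemma apply_eq {e : E} {w : X} (hw : fderiv ℝ L.p L.n₀ w = 0)
    (h : ∀ w', fderiv ℝ L.p L.n₀ w' = 0 →
      L.g (L.ψ L.n₀) (e - fderiv ℝ L.ψ L.n₀ w) (fderiv ℝ L.ψ L.n₀ w') = 0) :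
    P L.n₀ e = fderiv ℝ L.ψ L.n₀ w := by
  obtain ⟨w', hw', h'⟩ := hP.mem.self_of_nhds e
  have h1 := h (w' - w) (by rw [map_sub, hw, hw', sub_zero])
  have h2 := hP.orthogonal.self_of_nhds e (w' - w) (by rw [map_sub, hw, hw', sub_zero])
  rw [← sub_eq_zero]
  apply L.eq_zero_of_metric_self
  rw [h'] at h2 ⊢
  simp only [map_sub, sub_apply] at h1 h2 ⊢
  linarith

lemma apply_hor {v : X} (hv : L.Hor v) : P L.n₀ (fderiv ℝ L.ψ L.n₀ v) = 0 := by
  rw [hP.apply_eq (w := 0) (by simp)]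
  · simp
  · intro w hw
    simpa using hv w hw

lemma apply_vert {w : X} (hw : fderiv ℝ L.p L.n₀ w = 0) :
    P L.n₀ (fderiv ℝ L.ψ L.n₀ w) = fderiv ℝ L.ψ L.n₀ w :=
  hP.apply_eq hw (by simp)

lemma g_apply_vert (e : E) {w : X} (hw : fderiv ℝ L.p L.n₀ w = 0) :
    L.g (L.ψ L.n₀) (P L.n₀ e) (fderiv ℝ L.ψ L.n₀ w) =
      L.g (L.ψ L.n₀) e (fderiv ℝ L.ψ L.n₀ w) := by
  have := hP.orthogonal.self_of_nhds e w hw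
  rw [map_sub, sub_apply] at this
  linarith

lemma g_apply_apply (e e' : E) :
    L.g (L.ψ L.n₀) (P L.n₀ e) (P L.n₀ e') = L.g (L.ψ L.n₀) e (P L.n₀ e') := by
  obtain ⟨w, hw, h⟩ := hP.mem.self_of_nhds e'
  rw [h, hP.g_apply_vert e hw]

lemma g_apply_left (e e' : E) :
    L.g (L.ψ L.n₀) (P L.n₀ e) e' = L.g (L.ψ L.n₀) (P L.n₀ e) (P L.n₀ e') := by
  rw [L.g_comm _ e', L.g_comm _ (P L.n₀ e'), hP.g_apply_apply]

/-- Orbits are isotropic: they lie in the level set, whose tangent vectors are orthogonal to J of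
the vertical space. -/
lemma g_apply_J_apply (e e' : E) :
    L.g (L.ψ L.n₀) (P L.n₀ e) (L.J (L.ψ L.n₀) (P L.n₀ e')) = 0 := by
  obtain ⟨w, hw, h⟩ := hP.mem.self_of_nhds e
  obtain ⟨w', hw', h'⟩ := hP.mem.self_of_nhds e'
  rw [h, h', L.g_tangent_J _ _ hw']

lemma apply_J_apply (e : E) : P L.n₀ (L.J (L.ψ L.n₀) (P L.n₀ e)) = 0 := by
  apply L.eq_zero_of_metric_self
  rw [hP.g_apply_apply, L.g_comm, hP.g_apply_J_apply]

lemma apply_apply (e : E) : P L.n₀ (P L.n₀ e) = P L.n₀ e := by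
  obtain ⟨w, hw, h⟩ := hP.mem.self_of_nhds e
  rw [h, hP.apply_vert hw]

/-- The component orthogonal to the tangent space of the orbit and to its image under the complex
structure is horizontal. -/
lemma exists_hor_part (e : E) : ∃ v, L.Hor v ∧
    fderiv ℝ L.ψ L.n₀ v = e - P L.n₀ e + L.J (L.ψ L.n₀) (P L.n₀ (L.J (L.ψ L.n₀) e)) := by
  obtain ⟨v, hv⟩ := L.tangent
    (e - P L.n₀ e + L.J (L.ψ L.n₀) (P L.n₀ (L.J (L.ψ L.n₀) e))) (by
      intro w hw
      have h1 := hP.g_apply_J_apply e (fderiv ℝ L.ψ L.n₀ w)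
      rw [hP.apply_vert hw] at h1
      have h2 := hP.g_apply_vert (L.J (L.ψ L.n₀) e) hw
      rw [L.g_J_left] at h2
      simp only [map_add, map_sub, add_apply, sub_apply, h1, L.g_J_J, h2]
      ring)
  refine ⟨v, fun w hw ↦ ?_, hv⟩
  rw [hv]
  have h1 := hP.g_apply_J_apply (L.J (L.ψ L.n₀) e) (fderiv ℝ L.ψ L.n₀ w)
  rw [hP.apply_vert hw] at h1
  simp only [map_add, map_sub, add_apply, sub_apply, hP.g_apply_vert _ hw, L.g_J_left, h1]
  ring

/-- Pythagoras for the sum of the horizontal space, the vertical space and its image under J. The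
projection onto the last one is −JPJ, and J being isometric lets its contribution be measured by `P
(J e)`. -/
lemma g_eq_sum (e e' : E) {v v' : X}
    (hv : fderiv ℝ L.ψ L.n₀ v = e - P L.n₀ e + L.J (L.ψ L.n₀) (P L.n₀ (L.J (L.ψ L.n₀) e)))
    (hv' : fderiv ℝ L.ψ L.n₀ v' = e' - P L.n₀ e' + L.J (L.ψ L.n₀) (P L.n₀ (L.J (L.ψ L.n₀) e'))) :
    L.g (L.ψ L.n₀) e e' = L.g (L.ψ L.n₀) (fderiv ℝ L.ψ L.n₀ v) (fderiv ℝ L.ψ L.n₀ v') +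
      L.g (L.ψ L.n₀) (P L.n₀ e) (P L.n₀ e') +
      L.g (L.ψ L.n₀) (P L.n₀ (L.J (L.ψ L.n₀) e)) (P L.n₀ (L.J (L.ψ L.n₀) e')) := by
  have h1 : L.g (L.ψ L.n₀) e (P L.n₀ e') = _ := (hP.g_apply_apply e e').symm
  have h2 : L.g (L.ψ L.n₀) (P L.n₀ e) e' = _ := hP.g_apply_left e e'
  have h3 : L.g (L.ψ L.n₀) e (L.J (L.ψ L.n₀) (P L.n₀ (L.J (L.ψ L.n₀) e'))) =
      - L.g (L.ψ L.n₀) (P L.n₀ (L.J (L.ψ L.n₀) e)) (P L.n₀ (L.J (L.ψ L.n₀) e')) := by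
    rw [hP.g_apply_apply, L.g_J_left, neg_neg]
  have h4 : L.g (L.ψ L.n₀) (P L.n₀ (L.J (L.ψ L.n₀) e)) (L.J (L.ψ L.n₀) e') = _ :=
    hP.g_apply_left _ _
  have h5 := hP.g_apply_J_apply e (L.J (L.ψ L.n₀) e')
  have h6 := hP.g_apply_J_apply (L.J (L.ψ L.n₀) e) e'
  rw [hv, hv']
  simp only [map_add, map_sub, add_apply, sub_apply, h1, h2, h3, L.g_J_J, h4, h5, h6, L.g_J_left]
  ring

/-- The vertical part of the differential of the inclusion of the level set. -/
def _root_.LocalKahlerQuotient.vertPart (L : LocalKahlerQuotient X E Q) (P : X → E →L[ℝ] E)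
    (n : X) : X →L[ℝ] E := P n ∘L fderiv ℝ L.ψ n

/-- The derivative at the base point in the direction `j` of the vertical part of `∂_k ψ`. -/
def _root_.LocalKahlerQuotient.tau (L : LocalKahlerQuotient X E Q) (P : X → E →L[ℝ] E)
    (j k : X) : E := fderiv ℝ (fun n ↦ L.vertPart P n k) L.n₀ j

lemma contDiffAt_vertPart : ContDiffAt ℝ ∞ (L.vertPart P) L.n₀ :=
  hP.smooth.clm_comp L.contDiffAt_fderiv_ψ

lemma contDiffAt_vertPart₂ : ContDiffAt ℝ 2 (L.vertPart P) L.n₀ :=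
  hP.contDiffAt_vertPart.of_le (by norm_cast)

lemma differentiableAt_vertPart (k : X) :
    DifferentiableAt ℝ (fun n ↦ L.vertPart P n k) L.n₀ :=
  (hP.contDiffAt_vertPart.differentiableAt (by simp)).clm_apply (by fun_prop)

lemma vertPart_hor {k : X} (hk : L.Hor k) : L.vertPart P L.n₀ k = 0 := hP.apply_hor hk

/-- Differentiate P ∘ P = P on the field `∂_k ψ`. The derivative of the outer projection is applied
to the vertical part of `∂_k ψ`, which is zero at the base point because `k` is horizontal. -/
lemma apply_tau (j : X) {k : X} (hk : L.Hor k) : P L.n₀ (L.tau P j k) = L.tau P j k := by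
  have e : (fun n ↦ P n (L.vertPart P n k)) =ᶠ[𝓝 L.n₀] fun n ↦ L.vertPart P n k := by
    filter_upwards [hP.mem, hP.orthogonal, L.continuousAt_ψ.eventually L.g_pos] with n hm ho hp
    obtain ⟨w, hw, h⟩ := hm (fderiv ℝ L.ψ n k)
    change P n (P n (fderiv ℝ L.ψ n k)) = P n (fderiv ℝ L.ψ n k)
    rw [h]
    obtain ⟨w', hw', h'⟩ := hm (fderiv ℝ L.ψ n w)
    have h1 := ho (fderiv ℝ L.ψ n w) (w - w') (by rw [map_sub, hw, hw', sub_zero])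
    rw [h', map_sub (fderiv ℝ L.ψ n)] at h1
    by_contra hne
    rw [h', eq_comm, ← sub_eq_zero] at hne
    exact (hp _ hne).ne' h1
  have h : fderiv ℝ (fun n ↦ P n (L.vertPart P n k)) L.n₀ j =
      fderiv ℝ (fun n ↦ L.vertPart P n k) L.n₀ j := by rw [e.fderiv_eq]
  rw [fderiv_clm_apply (hP.smooth.differentiableAt (by simp)) (hP.differentiableAt_vertPart k)] at h
  simpa [hP.vertPart_hor hk, tau] using h

/-- Subtracting its vertical part makes a tangent vector of the level set horizontal without
changing its image under `dp`, and `dp` is isometric on horizontal vectors. The mixed terms vanish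
by orthogonality. -/
lemma pulledForm_split (u v : X) : pulledForm L.g L.ψ (fderiv ℝ L.ψ) u v =ᶠ[𝓝 L.n₀]
    fun n ↦ pulledForm L.gQ L.p (fderiv ℝ L.p) u v n + pulledForm L.g L.ψ (L.vertPart P) u v n := by
  filter_upwards [hP.mem, hP.orthogonal, L.riemannian,
    L.continuousAt_ψ.eventually L.g_symm] with n hm ho hr hs
  obtain ⟨w, hw, h⟩ := hm (fderiv ℝ L.ψ n u)
  obtain ⟨w', hw', h'⟩ := hm (fderiv ℝ L.ψ n v)
  have h1 := hr (u - w) (v - w')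
    (by intro a ha; rw [map_sub, ← h]; exact ho _ a ha)
    (by intro a ha; rw [map_sub, ← h']; exact ho _ a ha)
  have h2 := ho (fderiv ℝ L.ψ n u) w' hw'
  have h3 := ho (fderiv ℝ L.ψ n v) w hw
  rw [map_sub (fderiv ℝ L.p n), map_sub (fderiv ℝ L.p n), hw, hw', sub_zero, sub_zero] at h1
  have h4 := hs (fderiv ℝ L.ψ n v) (fderiv ℝ L.ψ n w)
  have h5 := hs (fderiv ℝ L.ψ n w') (fderiv ℝ L.ψ n w)
  simp only [pulledForm, vertPart, ContinuousLinearMap.comp_apply]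
  rw [h1, h, h']
  rw [h] at h2
  rw [h'] at h3
  simp only [map_sub, sub_apply] at h2 h3 ⊢
  linarith

end IsVertProj

end LocalKahlerQuotient

/-! ### Comparison of connections and curvatures of the total space and the quotient. -/

namespace LocalKahlerQuotient

variable {X E Q : Type*} [NormedAddCommGroup X] [NormedSpace ℝ X]
    [NormedAddCommGroup E] [NormedSpace ℝ E] [NormedAddCommGroup Q] [NormedSpace ℝ Q]
    {L : LocalKahlerQuotient X E Q}

namespace IsVertProj

variable {P : X → E →L[ℝ] E} (hP : L.IsVertProj P)

include hP

lemma fderiv_pulledForm_vertPart (u v k : X) :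
    fderiv ℝ (pulledForm L.g L.ψ (L.vertPart P) u v) L.n₀ k =
      fderiv ℝ L.g (L.ψ L.n₀) (fderiv ℝ L.ψ L.n₀ k) (L.vertPart P L.n₀ u) (L.vertPart P L.n₀ v)
        + L.g (L.ψ L.n₀) (L.tau P k u) (L.vertPart P L.n₀ v)
        + L.g (L.ψ L.n₀) (L.vertPart P L.n₀ u) (L.tau P k v) :=
  fderiv_pulledForm (L.g_smooth.differentiableAt (by simp)) (L.ψ_smooth.differentiableAt (by simp))
    (hP.contDiffAt_vertPart.differentiableAt (by simp)) u v k

/-- A product of two factors that vanish at the base point has as second derivative only the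
products of their first derivatives; derivatives of the metric do not enter. -/
lemma dirDeriv₂_pulledForm_vertPart {c d : X} (hc : L.Hor c) (hd : L.Hor d) (a b : X) :
    dirDeriv₂ (pulledForm L.g L.ψ (L.vertPart P) c d) L.n₀ a b =
      L.g (L.ψ L.n₀) (L.tau P b c) (L.tau P a d) + L.g (L.ψ L.n₀) (L.tau P a c) (L.tau P b d) := by
  have hg : ContDiffAt ℝ 2 (fun n ↦ L.g (L.ψ n)) L.n₀ :=
    ContDiffAt.comp (g := L.g) L.n₀ (L.g_smooth.of_le (by norm_cast)) L.ψ_contDiffAt₂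
  have := dirDeriv₂_bilinear hg (hP.contDiffAt_vertPart₂.clm_apply (contDiffAt_const (c := c)))
    (hP.contDiffAt_vertPart₂.clm_apply (contDiffAt_const (c := d))) a b
  unfold pulledForm
  rw [this, hP.vertPart_hor hc, hP.vertPart_hor hd]
  simp [tau]

lemma fderiv_pulledForm_split (u v k : X) :
    fderiv ℝ (pulledForm L.g L.ψ (fderiv ℝ L.ψ) u v) L.n₀ k =
      fderiv ℝ (pulledForm L.gQ L.p (fderiv ℝ L.p) u v) L.n₀ k
        + fderiv ℝ (pulledForm L.g L.ψ (L.vertPart P) u v) L.n₀ k := by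
  rw [(hP.pulledForm_split u v).fderiv_eq, fderiv_fun_add]
  · rfl
  · exact (contDiffAt_pulledForm (L.gQ_smooth.of_le (by norm_cast))
      (L.p_smooth.of_le (by norm_cast)) (L.contDiffAt_fderiv_p.of_le (by norm_cast)) u
      v).differentiableAt (by norm_num)
  · exact (contDiffAt_pulledForm (L.g_smooth.of_le (by norm_cast))
      L.ψ_contDiffAt₂ hP.contDiffAt_vertPart₂ u v).differentiableAt (by norm_num)

lemma dirDeriv₂_pulledForm_split (u v a b : X) :
    dirDeriv₂ (pulledForm L.g L.ψ (fderiv ℝ L.ψ) u v) L.n₀ a b =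
      dirDeriv₂ (pulledForm L.gQ L.p (fderiv ℝ L.p) u v) L.n₀ a b
        + dirDeriv₂ (pulledForm L.g L.ψ (L.vertPart P) u v) L.n₀ a b := by
  rw [dirDeriv₂_congr (hP.pulledForm_split u v), dirDeriv₂_add]
  · exact contDiffAt_pulledForm (L.gQ_smooth.of_le (by norm_cast))
      (L.p_smooth.of_le (by norm_cast)) (L.contDiffAt_fderiv_p.of_le (by norm_cast)) u v
  · exact contDiffAt_pulledForm (L.g_smooth.of_le (by norm_cast))
      L.ψ_contDiffAt₂ hP.contDiffAt_vertPart₂ u v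

/-- The comparison of the Levi-Civita connections of the total space and the quotient. -/
lemma g_D_eq {j k : X} (hj : L.Hor j) (hk : L.Hor k) (l : X) :
    L.g (L.ψ L.n₀) (L.D j k) (fderiv ℝ L.ψ L.n₀ l) =
      L.gQ (L.p L.n₀) (secondForm L.ΓQ L.p L.n₀ j k) (fderiv ℝ L.p L.n₀ l) +
      (L.g (L.ψ L.n₀) (L.tau P j k) (L.vertPart P L.n₀ l) +
        L.g (L.ψ L.n₀) (L.tau P k j) (L.vertPart P L.n₀ l)) / 2 := by
  have h1 := pulledForm_christoffel L.g_symm (L.g_smooth.differentiableAt (by simp))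
    L.ψ_contDiffAt₂ j k l
  have h2 := pulledForm_christoffel L.gQ_symm (L.gQ_smooth.differentiableAt (by simp))
    (L.p_smooth.of_le (by norm_cast)) j k l
  rw [← L.Γ_spec] at h1
  rw [← L.ΓQ_spec] at h2
  rw [hP.fderiv_pulledForm_split, hP.fderiv_pulledForm_split, hP.fderiv_pulledForm_split] at h1
  -- The vertical parts of `j` and `k` vanish at the base point, so only the derivatives `tau`
  -- paired with the vertical part of `l` survive.
  simp only [hP.fderiv_pulledForm_vertPart, hP.vertPart_hor hj, hP.vertPart_hor hk, map_zero,
    zero_apply, add_zero, zero_add] at h1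
  simp only [D, secondForm, map_add, add_apply]
  linarith

/-- For vertical `l` the quotient term in `g_D_eq` disappears. Both sides are vertical, so testing
against vertical vectors is enough. -/
lemma two_smul_apply_D {j k : X} (hj : L.Hor j) (hk : L.Hor k) :
    P L.n₀ (L.D j k) = (1 / 2 : ℝ) • (L.tau P j k + L.tau P k j) := by
  have key : ∀ w, fderiv ℝ L.p L.n₀ w = 0 →
      L.g (L.ψ L.n₀) (P L.n₀ (L.D j k) - (1 / 2 : ℝ) • (L.tau P j k + L.tau P k j))
        (fderiv ℝ L.ψ L.n₀ w) = 0 := by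
    intro w hw
    have := hP.g_D_eq hj hk w
    have hv : L.vertPart P L.n₀ w = fderiv ℝ L.ψ L.n₀ w := hP.apply_vert hw
    rw [hw, map_zero, zero_add, hv] at this
    simp only [map_sub, sub_apply, map_smul, smul_apply, map_add, add_apply,
      hP.g_apply_vert _ hw, this, smul_eq_mul]
    ring
  have hmem : P L.n₀ (P L.n₀ (L.D j k) - (1 / 2 : ℝ) • (L.tau P j k + L.tau P k j)) =
      P L.n₀ (L.D j k) - (1 / 2 : ℝ) • (L.tau P j k + L.tau P k j) := by
    simp only [map_sub, map_smul, map_add, hP.apply_apply, hP.apply_tau _ hk, hP.apply_tau _ hj]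
  rw [← sub_eq_zero]
  apply L.eq_zero_of_metric_self
  obtain ⟨w, hw, h⟩ := hP.mem.self_of_nhds
    (P L.n₀ (L.D j k) - (1 / 2 : ℝ) • (L.tau P j k + L.tau P k j))
  have := key w hw
  rwa [← h, hmem] at this

/-- The O'Neill tensor at the base point. -/
def _root_.LocalKahlerQuotient.A (L : LocalKahlerQuotient X E Q) (P : X → E →L[ℝ] E)
    (j k : X) : E := P L.n₀ (L.D j k) - L.tau P j k

/-- The complex structure applied to the second fundamental form of the level set, on horizontal
vectors. -/
def _root_.LocalKahlerQuotient.B (L : LocalKahlerQuotient X E Q) (P : X → E →L[ℝ] E)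
    (j k : X) : E := P L.n₀ (L.J (L.ψ L.n₀) (L.D j k))

/-- Subtracting `tau` from its own symmetrization leaves the skew part. This is why the O'Neill
tensor is skew on horizontal vectors. -/
lemma A_eq {j k : X} (hj : L.Hor j) (hk : L.Hor k) :
    L.A P j k = (1 / 2 : ℝ) • (L.tau P k j - L.tau P j k) := by
  rw [A, hP.two_smul_apply_D hj hk]
  module

lemma A_swap {j k : X} (hj : L.Hor j) (hk : L.Hor k) : L.A P j k = - L.A P k j := by
  rw [hP.A_eq hj hk, hP.A_eq hk hj]
  module

omit hP in
lemma _root_.LocalKahlerQuotient.B_comm (L : LocalKahlerQuotient X E Q) (P : X → E →L[ℝ] E)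
    (j k : X) : L.B P j k = L.B P k j := by
  rw [B, L.D_comm]
  rfl

omit hP in
lemma _root_.LocalKahlerQuotient.B_add_left (L : LocalKahlerQuotient X E Q) (P : X → E →L[ℝ] E)
    (i j k : X) : L.B P (i + j) k = L.B P i k + L.B P j k := by
  simp [B, L.D_add_left]

omit hP in
lemma _root_.LocalKahlerQuotient.B_smul_left (L : LocalKahlerQuotient X E Q) (P : X → E →L[ℝ] E)
    (r : ℝ) (j k : X) : L.B P (r • j) k = r • L.B P j k := by
  simp [B, L.D_smul_left]

/-- The horizontal part of the covariant derivative upstairs projects to the covariant second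
derivative of `p`. It suffices to pair with horizontal lifts `l`, for which the `tau` terms of
`g_D_eq` vanish. -/
lemma gQ_secondForm {j k v : X} (hj : L.Hor j) (hk : L.Hor k) (hv : L.Hor v)
    (h : fderiv ℝ L.ψ L.n₀ v = L.D j k - P L.n₀ (L.D j k)
      + L.J (L.ψ L.n₀) (P L.n₀ (L.J (L.ψ L.n₀) (L.D j k)))) :
    secondForm L.ΓQ L.p L.n₀ j k = fderiv ℝ L.p L.n₀ v := by
  rw [← sub_eq_zero]
  by_contra hne
  refine (L.gQ_pos _ hne).ne' ?_
  -- Lifting the difference itself turns its squared length downstairs into a pairing that `g_D_eq`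
  -- and the isometry of `dp` can evaluate.
  obtain ⟨l, hl, hl'⟩ := L.exists_hor (secondForm L.ΓQ L.p L.n₀ j k - fderiv ℝ L.p L.n₀ v)
  nth_rw 2 [← hl']
  have h1 := hP.g_D_eq hj hk l
  rw [hP.vertPart_hor hl] at h1
  have h2 := L.riemannian.self_of_nhds v l hv hl
  have h3 : L.g (L.ψ L.n₀) (L.D j k) (fderiv ℝ L.ψ L.n₀ l) =
      L.g (L.ψ L.n₀) (fderiv ℝ L.ψ L.n₀ v) (fderiv ℝ L.ψ L.n₀ l) := by
    obtain ⟨w, hw, hw'⟩ := hP.mem.self_of_nhds (L.J (L.ψ L.n₀) (L.D j k))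
    have h4 := L.g_tangent_J l w hw
    have h5 := hP.g_apply_left (L.D j k) (fderiv ℝ L.ψ L.n₀ l)
    rw [hP.apply_hor hl, map_zero] at h5
    rw [h, hw']
    simp only [map_add, map_sub, add_apply, sub_apply, h5]
    rw [L.g_comm (L.J _ _), h4]
    ring
  simp only [map_sub, sub_apply, map_zero] at h1 ⊢
  linarith

/-- The comparison of the curvatures of the total space and the quotient. -/
theorem riemannForm_sub {i j : X} (hi : L.Hor i) (hj : L.Hor j) :
    riemannForm L.gQ L.ΓQ (L.p L.n₀) (fderiv ℝ L.p L.n₀ i) (fderiv ℝ L.p L.n₀ j)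
        (fderiv ℝ L.p L.n₀ j) (fderiv ℝ L.p L.n₀ i) -
      riemannForm L.g L.Γ (L.ψ L.n₀) (fderiv ℝ L.ψ L.n₀ i) (fderiv ℝ L.ψ L.n₀ j)
        (fderiv ℝ L.ψ L.n₀ j) (fderiv ℝ L.ψ L.n₀ i) =
    3 * L.g (L.ψ L.n₀) (L.A P i j) (L.A P i j) + L.g (L.ψ L.n₀) (L.B P i i) (L.B P j j)
      - L.g (L.ψ L.n₀) (L.B P i j) (L.B P i j) := by
  have h1 := pulledForm_riemannForm L.g_symm (L.g_smooth.of_le (by norm_cast))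
    (L.ψ_smooth.of_le (by norm_cast)) L.Γ_spec i j j i
  have h2 := pulledForm_riemannForm L.gQ_symm (L.gQ_smooth.of_le (by norm_cast))
    (L.p_smooth.of_le (by norm_cast)) L.ΓQ_spec i j j i
  -- The second derivatives of the metric induced by `ψ` become those of the metric induced by `p`,
  -- which `h2` evaluates, plus products of `tau`.
  simp only [hP.dirDeriv₂_pulledForm_split] at h1
  rw [hP.dirDeriv₂_pulledForm_vertPart hj hi, hP.dirDeriv₂_pulledForm_vertPart hj hj,
    hP.dirDeriv₂_pulledForm_vertPart hi hi, hP.dirDeriv₂_pulledForm_vertPart hi hj] at h1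
  change _ = _ + L.g (L.ψ L.n₀) (L.D j j) (L.D i i) - L.g (L.ψ L.n₀) (L.D i j) (L.D j i) at h1
  obtain ⟨vii, hvii, eii⟩ := hP.exists_hor_part (L.D i i)
  obtain ⟨vjj, hvjj, ejj⟩ := hP.exists_hor_part (L.D j j)
  obtain ⟨vij, hvij, eij⟩ := hP.exists_hor_part (L.D i j)
  have eji := eij
  rw [L.D_comm i j] at eji
  rw [hP.gQ_secondForm hi hi hvii eii, hP.gQ_secondForm hj hj hvjj ejj,
    hP.gQ_secondForm hi hj hvij eij, hP.gQ_secondForm hj hi hvij eji,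
    L.riemannian.self_of_nhds _ _ hvjj hvii, L.riemannian.self_of_nhds _ _ hvij hvij] at h2
  -- Of the three orthogonal components of `D`, the horizontal ones cancel against the `secondForm`
  -- terms of `p`, the vertical ones combine with the `tau` products to 3|A|², and the J-vertical
  -- ones remain as `B`.
  rw [L.D_comm j i, hP.g_eq_sum _ _ ejj eii, hP.g_eq_sum _ _ eij eij] at h1
  rw [hP.two_smul_apply_D hi hi, hP.two_smul_apply_D hj hj, hP.two_smul_apply_D hi hj] at h1
  rw [hP.A_eq hi hj]
  unfold B
  have c1 := L.g_comm (P L.n₀ (L.J (L.ψ L.n₀) (L.D i i))) (P L.n₀ (L.J (L.ψ L.n₀) (L.D j j)))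
  have c2 := L.g_comm (L.tau P i i) (L.tau P j j)
  have c3 := L.g_comm (L.tau P i j) (L.tau P j i)
  simp only [map_sub, sub_apply, map_smul, smul_apply, map_add, add_apply, smul_eq_mul] at h1 ⊢
  linarith

/-- The derivative along the level set of a horizontal field which vanishes at the base point has
no vertical component. -/
lemma g_fderiv_eq_zero {Y : X → E} (hY : DifferentiableAt ℝ Y L.n₀) (hY0 : Y L.n₀ = 0)
    (hh : ∀ᶠ n in 𝓝 L.n₀, ∀ w, fderiv ℝ L.p n w = 0 → L.g (L.ψ n) (Y n) (fderiv ℝ L.ψ n w) = 0)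
    (j : X) {w : X} (hw : fderiv ℝ L.p L.n₀ w = 0) :
    L.g (L.ψ L.n₀) (fderiv ℝ Y L.n₀ j) (fderiv ℝ L.ψ L.n₀ w) = 0 := by
  -- The vector `w` is extended by the vertical field `vertPart`, to which `Y` is orthogonal
  -- throughout. In the derivative of this identity only the term with dY is left, as `Y` vanishes
  -- at the base point.
  have e : (fun n ↦ L.g (L.ψ n) (Y n) (L.vertPart P n w)) =ᶠ[𝓝 L.n₀] fun _ ↦ (0 : ℝ) := by
    filter_upwards [hP.mem, hh] with n hm hn
    obtain ⟨w', hw', h⟩ := hm (fderiv ℝ L.ψ n w)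
    change L.g (L.ψ n) (Y n) (P n (fderiv ℝ L.ψ n w)) = 0
    rw [h, hn w' hw']
  have hg : DifferentiableAt ℝ (fun n ↦ L.g (L.ψ n)) L.n₀ :=
    DifferentiableAt.comp (g := L.g) L.n₀ (L.g_smooth.differentiableAt (by simp))
      (L.ψ_smooth.differentiableAt (by simp))
  have h := fderiv_bilinear_apply hg hY (hP.differentiableAt_vertPart w) j
  rw [e.fderiv_eq, hY0] at h
  have hv : L.vertPart P L.n₀ w = fderiv ℝ L.ψ L.n₀ w := hP.apply_vert hw
  rw [hv] at h
  simpa using h.symm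

end IsVertProj

end LocalKahlerQuotient

/-! ### Frames of the tangent bundle given by charts -/

section Frame

variable {E : Type*} [NormedAddCommGroup E] [NormedSpace ℝ E]
  {M : Type*} [TopologicalSpace M] [ChartedSpace E M] [IsManifold 𝓘(ℝ, E) ∞ M]

/-- The frame of the tangent bundle given by the preferred chart at `m`. -/
def chartFrame (m x : M) : E →L[ℝ] TangentSpace 𝓘(ℝ, E) x :=
  (trivializationAt E (TangentSpace 𝓘(ℝ, E)) m).symmL ℝ x

/-- The coordinates of a vector in the frame of the preferred chart at `m`. -/
def chartCoord (m x : M) : TangentSpace 𝓘(ℝ, E) x →L[ℝ] E :=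
  (trivializationAt E (TangentSpace 𝓘(ℝ, E)) m).continuousLinearMapAt ℝ x

lemma chartFrame_eq_mfderiv {m x : M} (hx : x ∈ (extChartAt 𝓘(ℝ, E) m).source) (u : E) :
    (chartFrame m x u : TangentSpace 𝓘(ℝ, E) x) =
      (mfderiv 𝓘(ℝ, E) 𝓘(ℝ, E) (extChartAt 𝓘(ℝ, E) m).symm
        (extChartAt 𝓘(ℝ, E) m x) : E →L[ℝ] E) u := by
  rw [extChartAt_source] at hx
  have h := TangentBundle.symmL_trivializationAt (I := 𝓘(ℝ, E)) hx
  simp only [modelWithCornersSelf_coe, Set.range_id, mfderivWithin_univ] at h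
  exact DFunLike.congr_fun h u

lemma chartCoord_eq_mfderiv {m x : M} (hx : x ∈ (extChartAt 𝓘(ℝ, E) m).source) :
    chartCoord m x = mfderiv 𝓘(ℝ, E) 𝓘(ℝ, E) (extChartAt 𝓘(ℝ, E) m) x := by
  rw [extChartAt_source] at hx
  rw [chartCoord, TangentBundle.continuousLinearMapAt_trivializationAt hx]

lemma mem_baseSet_of_mem_source {m x : M} (hx : x ∈ (extChartAt 𝓘(ℝ, E) m).source) :
    x ∈ (trivializationAt E (TangentSpace 𝓘(ℝ, E)) m).baseSet := by
  simpa using hx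

lemma chartFrame_chartCoord {m x : M} (hx : x ∈ (extChartAt 𝓘(ℝ, E) m).source)
    (v : TangentSpace 𝓘(ℝ, E) x) : chartFrame m x (chartCoord m x v) = v :=
  Trivialization.symmL_continuousLinearMapAt _ (mem_baseSet_of_mem_source hx) v

lemma chartCoord_chartFrame {m x : M} (hx : x ∈ (extChartAt 𝓘(ℝ, E) m).source)
    (v : E) : chartCoord m x (chartFrame m x v) = v :=
  Trivialization.continuousLinearMapAt_symmL _ (mem_baseSet_of_mem_source hx) v

/-- Tangent vectors at `m` are by construction elements of `E` read in the preferred chart at `m`.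
This identity underlies all later passages between tangent vectors at the centre and their
coordinates. -/
lemma chartCoord_self (m : M) (v : TangentSpace 𝓘(ℝ, E) m) : chartCoord m m v = v := by
  rw [chartCoord_eq_mfderiv (mem_extChartAt_source m), mfderiv_extChartAt_self]
  rfl

lemma chartFrame_self (m : M) (v : E) : chartFrame (E := E) m m v = v := by
  have h := chartFrame_chartCoord (E := E) (m := m) (mem_extChartAt_source (I := 𝓘(ℝ, E)) m)
    (show TangentSpace 𝓘(ℝ, E) m from v)
  have h2 := chartCoord_self (E := E) m v
  exact (congrArg (chartFrame (E := E) m m) h2).symm.trans h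

/-- Links the extensions used to define the curvature to the coordinate frame, whose brackets and
covariant derivatives are computable. -/
lemma extend_eq_chartFrame {m x : M} (hx : x ∈ (extChartAt 𝓘(ℝ, E) m).source)
    (v : TangentSpace 𝓘(ℝ, E) m) :
    FiberBundle.extend E v x = chartFrame (E := E) m x v := by
  have : (trivializationAt E (TangentSpace 𝓘(ℝ, E)) m ⟨m, v⟩).2 = v := by
    have h := chartCoord_self (E := E) m v
    rwa [chartCoord, Trivialization.continuousLinearMapAt_apply_of_mem] at h
    exact mem_baseSet_of_mem_source (mem_extChartAt_source m)
  simp only [FiberBundle.extend]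
  rw [this]
  exact (Trivialization.symmL_apply _ (mem_baseSet_of_mem_source hx) v).symm

lemma mvfderiv_chartFrame {F : Type*} [NormedAddCommGroup F] [NormedSpace ℝ F] {f : M → F}
    {m x : M} (hx : x ∈ (extChartAt 𝓘(ℝ, E) m).source)
    (hf : MDifferentiableAt 𝓘(ℝ, E) 𝓘(ℝ, F) f x) (u : E) :
    mvfderiv 𝓘(ℝ, E) f x (chartFrame m x u) =
      fderiv ℝ (f ∘ (extChartAt 𝓘(ℝ, E) m).symm) (extChartAt 𝓘(ℝ, E) m x) u := by
  have hx' := (extChartAt 𝓘(ℝ, E) m).map_source hx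
  have hs : MDifferentiableAt 𝓘(ℝ, E) 𝓘(ℝ, E) (extChartAt 𝓘(ℝ, E) m).symm
      (extChartAt 𝓘(ℝ, E) m x) := by
    have := mdifferentiableWithinAt_extChartAt_symm hx'
    rwa [modelWithCornersSelf_coe, Set.range_id, mdifferentiableWithinAt_univ] at this
  have hf' : MDifferentiableAt 𝓘(ℝ, E) 𝓘(ℝ, F) f ((extChartAt 𝓘(ℝ, E) m).symm
      (extChartAt 𝓘(ℝ, E) m x)) := by rwa [(extChartAt 𝓘(ℝ, E) m).left_inv hx]
  have h1 := mfderiv_comp_apply (extChartAt 𝓘(ℝ, E) m x) hf' hs u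
  rw [mfderiv_eq_fderiv] at h1
  refine Eq.trans ?_ h1.symm
  have h2 := chartFrame_eq_mfderiv hx u
  have h3 : ∀ z (_ : z = x) (w : E), (mfderiv 𝓘(ℝ, E) 𝓘(ℝ, F) f x : E →L[ℝ] F) w =
    (mfderiv 𝓘(ℝ, E) 𝓘(ℝ, F) f z : E →L[ℝ] F) w := by rintro z rfl w; rfl
  exact (congrArg (mvfderiv 𝓘(ℝ, E) f x) h2).trans
    (h3 _ ((extChartAt 𝓘(ℝ, E) m).left_inv hx) _)

lemma eventually_mem_source (m : M) : ∀ᶠ y in 𝓝 (extChartAt 𝓘(ℝ, E) m m),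
    (extChartAt 𝓘(ℝ, E) m).symm y ∈ (extChartAt 𝓘(ℝ, E) m).source ∧
      extChartAt 𝓘(ℝ, E) m ((extChartAt 𝓘(ℝ, E) m).symm y) = y := by
  filter_upwards [extChartAt_target_mem_nhds (I := 𝓘(ℝ, E)) m] with y hy
  exact ⟨(extChartAt 𝓘(ℝ, E) m).map_target hy, (extChartAt 𝓘(ℝ, E) m).right_inv hy⟩

lemma tendsto_chart_symm (m : M) : Filter.Tendsto (extChartAt 𝓘(ℝ, E) m).symm
    (𝓝 (extChartAt 𝓘(ℝ, E) m m)) (𝓝 m) := by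
  have := continuousAt_extChartAt_symm (I := 𝓘(ℝ, E)) m
  rwa [ContinuousAt, extChartAt_to_inv] at this

lemma contDiffAt_comp_chart_symm {F : Type*} [NormedAddCommGroup F] [NormedSpace ℝ F] {f : M → F}
    {m : M} (hf : ContMDiffAt 𝓘(ℝ, E) 𝓘(ℝ, F) ∞ f m) :
    ContDiffAt ℝ ∞ (f ∘ (extChartAt 𝓘(ℝ, E) m).symm) (extChartAt 𝓘(ℝ, E) m m) := by
  rw [← contMDiffAt_iff_contDiffAt]
  have hs : ContMDiffAt 𝓘(ℝ, E) 𝓘(ℝ, E) ∞ (extChartAt 𝓘(ℝ, E) m).symm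
      (extChartAt 𝓘(ℝ, E) m m) :=
    (contMDiffOn_extChartAt_symm m).contMDiffAt (extChartAt_target_mem_nhds m)
  exact ContMDiffAt.comp_of_eq hf hs (extChartAt_to_inv m)

lemma differentiableAt_comp_chart_symm {F : Type*} [NormedAddCommGroup F] [NormedSpace ℝ F]
    {f : M → F} {m : M} (hf : MDifferentiableAt 𝓘(ℝ, E) 𝓘(ℝ, F) f m) :
    DifferentiableAt ℝ (f ∘ (extChartAt 𝓘(ℝ, E) m).symm) (extChartAt 𝓘(ℝ, E) m m) := by
  rw [← mdifferentiableAt_iff_differentiableAt]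
  have hs : ContMDiffAt 𝓘(ℝ, E) 𝓘(ℝ, E) ∞ (extChartAt 𝓘(ℝ, E) m).symm
      (extChartAt 𝓘(ℝ, E) m m) :=
    (contMDiffOn_extChartAt_symm m).contMDiffAt (extChartAt_target_mem_nhds m)
  exact MDifferentiableAt.comp_of_eq _ hf (hs.mdifferentiableAt (by simp)) (extChartAt_to_inv m)

lemma contMDiffAt_section_iff_chartCoord {m x : M} (hx : x ∈ (extChartAt 𝓘(ℝ, E) m).source)
    {n : ℕ∞} (Y : Π x : M, TangentSpace 𝓘(ℝ, E) x) :
    CMDiffAt n (T% Y) x ↔ CMDiffAt n (fun x ↦ chartCoord (E := E) m x (Y x)) x := by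
  have hb := mem_baseSet_of_mem_source hx
  have : ContMDiffVectorBundle n E (TangentSpace 𝓘(ℝ, E) : M → Type _) 𝓘(ℝ, E) :=
    .of_le (n := ∞) (by exact_mod_cast le_top)
  rw [(trivializationAt E (TangentSpace 𝓘(ℝ, E)) m).contMDiffAt_section_iff hb]
  refine Filter.EventuallyEq.contMDiffAt_iff ?_
  filter_upwards [(trivializationAt E (TangentSpace 𝓘(ℝ, E)) m).open_baseSet.mem_nhds hb] with y hy
  exact (Trivialization.continuousLinearMapAt_apply_of_mem ℝ _ hy _).symm

lemma mdifferentiableAt_section_iff_chartCoord {m x : M}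
    (hx : x ∈ (extChartAt 𝓘(ℝ, E) m).source) (Y : Π x : M, TangentSpace 𝓘(ℝ, E) x) :
    MDiffAt (T% Y) x ↔ MDiffAt (fun x ↦ chartCoord (E := E) m x (Y x)) x := by
  have hb := mem_baseSet_of_mem_source hx
  rw [(trivializationAt E (TangentSpace 𝓘(ℝ, E)) m).mdifferentiableAt_section_iff 𝓘(ℝ, E) _ hb]
  refine Filter.EventuallyEq.mdifferentiableAt_iff ?_
  filter_upwards [(trivializationAt E (TangentSpace 𝓘(ℝ, E)) m).open_baseSet.mem_nhds hb] with y hy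
  exact (Trivialization.continuousLinearMapAt_apply_of_mem ℝ _ hy _).symm

lemma contMDiffAt_chartFrame {m x : M} (hx : x ∈ (extChartAt 𝓘(ℝ, E) m).source)
    {n : ℕ∞} {f : M → E} (hf : CMDiffAt n f x) :
    CMDiffAt n (T% (fun x : M ↦ chartFrame m x (f x))) x := by
  rw [contMDiffAt_section_iff_chartCoord hx]
  refine hf.congr_of_eventuallyEq ?_
  filter_upwards [(isOpen_extChartAt_source m).mem_nhds hx] with y hy
  exact chartCoord_chartFrame hy _

lemma mdifferentiableAt_chartFrame {m x : M} (hx : x ∈ (extChartAt 𝓘(ℝ, E) m).source) (v : E) :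
    MDiffAt (T% (fun x : M ↦ chartFrame m x v)) x :=
  (contMDiffAt_chartFrame (n := 1) hx contMDiffAt_const).mdifferentiableAt (by simp)

/-- Frame fields are pull-backs of constant fields by the chart, and pull-back commutes with the
bracket. -/
lemma mlieBracket_chartFrame {m x : M} [CompleteSpace E]
    (hx : x ∈ (extChartAt 𝓘(ℝ, E) m).source) (v w : E) :
    VectorField.mlieBracket 𝓘(ℝ, E) (fun x : M ↦ chartFrame m x v)
      (fun x : M ↦ chartFrame m x w) x = 0 := by
  let C : E → Π y : E, TangentSpace 𝓘(ℝ, E) y := fun v _ ↦ v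
  have key : ∀ v : E, (fun x : M ↦ chartFrame m x v) =ᶠ[𝓝 x]
      VectorField.mpullback 𝓘(ℝ, E) 𝓘(ℝ, E) (extChartAt 𝓘(ℝ, E) m) (C v) := by
    intro v
    filter_upwards [(isOpen_extChartAt_source m).mem_nhds hx] with y hy
    have h1 : (mfderiv 𝓘(ℝ, E) 𝓘(ℝ, E) (extChartAt 𝓘(ℝ, E) m) y) (chartFrame m y v) = v := by
      have := chartCoord_chartFrame hy v
      rwa [chartCoord_eq_mfderiv hy] at this
    have h2 := isInvertible_mfderiv_extChartAt hy
    exact ((congrArg _ h1).symm.trans (h2.inverse_apply_self (chartFrame m y v))).symm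
  have hc : ∀ v : E, MDiffAt (T% (C v)) (extChartAt 𝓘(ℝ, E) m x) := by
    intro v
    have : ContMDiffAt 𝓘(ℝ, E) 𝓘(ℝ, E).tangent 1 (T% (C v)) (extChartAt 𝓘(ℝ, E) m x) := by
      rw [contMDiffAt_vectorSpace_iff_contDiffAt]
      exact contDiffAt_const
    exact this.mdifferentiableAt (by simp)
  have hcd : ContMDiffAt 𝓘(ℝ, E) 𝓘(ℝ, E) ∞ (extChartAt 𝓘(ℝ, E) m) x :=
    contMDiffAt_extChartAt' (by simpa using hx)
  have h2' : minSmoothness ℝ 2 ≤ (∞ : WithTop ℕ∞) := by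
    rw [minSmoothness_of_isRCLikeNormedField]
    exact WithTop.coe_le_coe.2 (le_top : (2 : ℕ∞) ≤ ⊤)
  have : IsManifold 𝓘(ℝ, E) (minSmoothness ℝ 2) M := .of_le h2'
  have h1 := VectorField.mpullback_mlieBracket (n := ∞) (hc v) (hc w) hcd h2'
  have h2 : VectorField.mlieBracket 𝓘(ℝ, E) (C v) (C w) = 0 := by
    rw [← VectorField.mlieBracketWithin_univ, VectorField.mlieBracketWithin_eq_lieBracketWithin,
      VectorField.lieBracketWithin_univ]
    ext y
    have : ∀ v : E, fderiv ℝ (C v) y = 0 := fun v ↦ fderiv_const_apply _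
    exact (congrArg₂ (· - ·) (DFunLike.congr_fun (this w) (C v y))
      (DFunLike.congr_fun (this v) (C w y))).trans (sub_zero _)
  have h3 := Filter.EventuallyEq.mlieBracket_vectorField_eq (I := 𝓘(ℝ, E)) (key v) (key w)
  refine h3.trans (h1.symm.trans ?_)
  rw [VectorField.mpullback_apply, h2]
  exact map_zero _

end Frame

/-! ### The Levi-Civita connection and the curvature in charts -/

namespace WeakRiemannianStructure

variable {E : Type*} [NormedAddCommGroup E] [NormedSpace ℝ E] [CompleteSpace E]
  {M : Type*} [TopologicalSpace M] [ChartedSpace E M] [IsManifold 𝓘(ℝ, E) ∞ M]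
  (S : WeakRiemannianStructure E M)

/-- The metric at `x` in the frame of the preferred chart at `m`. -/
def frameMetric (m x : M) : E →L[ℝ] E →L[ℝ] ℝ :=
  ContinuousLinearMap.bilinearComp (E := E) (F := E) (E' := E) (F' := E) (G := ℝ)
    (S.metric x) (chartFrame m x) (chartFrame m x)

/-- The metric in the preferred chart at `m`. -/
def chartMetric (m : M) (y : E) : E →L[ℝ] E →L[ℝ] ℝ :=
  S.frameMetric m ((extChartAt 𝓘(ℝ, E) m).symm y)

/-- The Christoffel symbols of the second kind in the preferred chart at `m`, at the point `m`. -/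
def chartChristoffel (m : M) (u v : E) : E :=
  S.cov (FiberBundle.extend E (show TangentSpace 𝓘(ℝ, E) m from v)) m u

lemma frameMetric_apply (m x : M) (v w : E) :
    S.frameMetric m x v w = S.metric x (chartFrame m x v) (chartFrame m x w) := rfl

lemma contMDiffAt_frameMetric (m : M) : CMDiffAt ∞ (S.frameMetric m) m := by
  have h := ((contMDiffAt_hom_bundle (n := ∞) (x₀ := m) _).1 S.metric_smooth.contMDiffAt).2
  refine h.congr_of_eventuallyEq ?_
  filter_upwards [extChartAt_source_mem_nhds (I := 𝓘(ℝ, E)) m] with x hx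
  have hb := mem_baseSet_of_mem_source hx
  ext v w
  rw [inCoordinates_apply_eq₂ hb hb (Set.mem_univ _)]
  rw [frameMetric_apply, chartFrame, Trivialization.symmL_apply _ hb,
    Trivialization.symmL_apply _ hb]
  simp

lemma contDiffAt_chartMetric (m : M) :
    ContDiffAt ℝ ∞ (S.chartMetric m) (extChartAt 𝓘(ℝ, E) m m) :=
  contDiffAt_comp_chart_symm (S.contMDiffAt_frameMetric m)

lemma chartMetric_self (m : M) (v w : E) :
    S.chartMetric m (extChartAt 𝓘(ℝ, E) m m) v w = S.metric m v w := by
  rw [chartMetric, extChartAt_to_inv, frameMetric_apply]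
  exact congrArg₂ (fun a b : TangentSpace 𝓘(ℝ, E) m ↦ S.metric m a b)
    (chartFrame_self m v) (chartFrame_self m w)

lemma chartMetric_symm (m : M) (y v w : E) : S.chartMetric m y v w = S.chartMetric m y w v :=
  S.metric_symm ((extChartAt 𝓘(ℝ, E) m).symm y) (chartFrame m _ v) (chartFrame m _ w)

lemma symmNear_chartMetric (m : M) : SymmNear (S.chartMetric m) (extChartAt 𝓘(ℝ, E) m m) :=
  .of_forall fun y v w ↦ S.chartMetric_symm m y v w

lemma chartMetric_pos (m : M) : ∀ᶠ y in 𝓝 (extChartAt 𝓘(ℝ, E) m m),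
    ∀ v, v ≠ 0 → 0 < S.chartMetric m y v v := by
  filter_upwards [eventually_mem_source m] with y hy v hv
  refine S.metric_pos _ _ fun h ↦ hv ?_
  have := chartCoord_chartFrame hy.1 v
  exact this.symm.trans ((congrArg _ h).trans (map_zero _))

lemma mdifferentiableAt_metric {Y Z : Π x : M, TangentSpace 𝓘(ℝ, E) x} {x : M}
    (hY : MDiffAt (T% Y) x) (hZ : MDiffAt (T% Z) x) :
    MDiffAt (fun y ↦ S.metric y (Y y) (Z y)) x := by
  have h : MDifferentiableAt 𝓘(ℝ, E) (𝓘(ℝ, E).prod 𝓘(ℝ, ℝ))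
      (fun y : M ↦ TotalSpace.mk' ℝ (E := Bundle.Trivial M ℝ) y (S.metric y (Y y) (Z y))) x := by
    apply MDifferentiableAt.clm_bundle_apply₂ (F₁ := E) (F₂ := E)
    · exact S.metric_smooth.mdifferentiableAt (by simp)
    · exact hY
    · exact hZ
  exact ((mdifferentiableAt_totalSpace _ _).1 h).2

lemma ext_of_metric {x : M} {v w : TangentSpace 𝓘(ℝ, E) x}
    (h : ∀ z, S.metric x v z = S.metric x w z) : v = w := by
  by_contra hne
  have h1 := S.metric_pos x (v - w) (sub_ne_zero.2 hne)
  have h2 := h (v - w)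
  simp only [map_sub, sub_apply] at h1 h2
  linarith

lemma cov_congr {Y Z : Π x : M, TangentSpace 𝓘(ℝ, E) x} {x : M} (hZ : MDiffAt (T% Z) x)
    (h : ∀ᶠ y in 𝓝 x, Y y = Z y) : S.cov Y x = S.cov Z x := by
  have hY : MDiffAt (T% Y) x := hZ.congr_of_eventuallyEq (by
    filter_upwards [h] with y hy
    rw [hy])
  exact (S.cov.isCovariantDerivativeOn (s := Set.univ)).congr_of_eventuallyEq hY hZ
    Filter.univ_mem h

lemma mvfderiv_metric_chartFrame (m : M) : ∀ᶠ x in 𝓝 m, ∀ u v w : E,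
    mvfderiv 𝓘(ℝ, E) (fun y ↦ S.metric y (chartFrame m y v) (chartFrame m y w)) x
      (chartFrame m x u) = fderiv ℝ (S.chartMetric m) (extChartAt 𝓘(ℝ, E) m x) u v w := by
  have h1 : ∀ᶠ y in 𝓝 (extChartAt 𝓘(ℝ, E) m m), DifferentiableAt ℝ (S.chartMetric m) y := by
    have := (S.contDiffAt_chartMetric m).of_le (m := 1) (by simp)
    filter_upwards [this.eventually (by simp)] with y hy
    exact hy.differentiableAt (by simp)
  filter_upwards [extChartAt_source_mem_nhds (I := 𝓘(ℝ, E)) m,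
    (continuousAt_extChartAt m).eventually h1] with x hx hd u v w
  rw [mvfderiv_chartFrame hx (S.mdifferentiableAt_metric (mdifferentiableAt_chartFrame hx v)
    (mdifferentiableAt_chartFrame hx w)), ← fderiv_apply₂ hd]
  rfl

/-- Koszul's formula for commuting frame fields: metric compatibility in three index positions and
vanishing torsion. It holds at all points near `m`, which allows differentiating it once more. -/
lemma metric_cov_chartFrame (m : M) : ∀ᶠ x in 𝓝 m, ∀ u v w : E,
    S.metric x (S.cov (fun y ↦ chartFrame m y v) x (chartFrame m x u)) (chartFrame m x w) =
      christoffel (S.chartMetric m) (extChartAt 𝓘(ℝ, E) m x) u v w := by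
  filter_upwards [extChartAt_source_mem_nhds (I := 𝓘(ℝ, E)) m,
    S.mvfderiv_metric_chartFrame m] with x hx h u v w
  have hd := fun v : E ↦ mdifferentiableAt_chartFrame hx v
  have hm := fun u v w : E ↦
    (S.cov_metric _ _ x (chartFrame m x u) (hd v) (hd w)).symm.trans (h u v w)
  have ht : ∀ u v : E, S.cov (fun y ↦ chartFrame m y v) x (chartFrame m x u) =
      S.cov (fun y ↦ chartFrame m y u) x (chartFrame m x v) := fun u v ↦
    sub_eq_zero.1 ((S.cov_torsion _ _ x (hd u) (hd v)).trans (mlieBracket_chartFrame hx u v))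
  have h1 := hm u v w
  have h2 := hm v u w
  have h3 := hm w u v
  rw [S.metric_symm x (chartFrame m x v)] at h1
  rw [S.metric_symm x (chartFrame m x u)] at h2 h3
  rw [ht w u, ht w v] at h3
  rw [ht v u] at h2
  unfold christoffel
  linarith

lemma chartChristoffel_eq (m : M) (u v : E) :
    S.chartChristoffel m u v = S.cov (fun y ↦ chartFrame m y v) m u := by
  have hx := mem_extChartAt_source (I := 𝓘(ℝ, E)) m
  refine DFunLike.congr_fun (S.cov_congr (mdifferentiableAt_chartFrame hx v) ?_) u
  filter_upwards [extChartAt_source_mem_nhds (I := 𝓘(ℝ, E)) m] with y hy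
  exact extend_eq_chartFrame hy _

lemma chartChristoffel_spec (m : M) (u v w : E) :
    S.chartMetric m (extChartAt 𝓘(ℝ, E) m m) (S.chartChristoffel m u v) w =
      christoffel (S.chartMetric m) (extChartAt 𝓘(ℝ, E) m m) u v w := by
  rw [chartMetric_self, chartChristoffel_eq, ← (S.metric_cov_chartFrame m).self_of_nhds u v w]
  exact congrArg₂ (fun a b : TangentSpace 𝓘(ℝ, E) m ↦
    S.metric m (S.cov (fun y ↦ chartFrame m y v) m a) b)
    (chartFrame_self m u).symm (chartFrame_self m w).symm

end WeakRiemannianStructure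

lemma differentiableAt_fderiv_apply {X F : Type*} [NormedAddCommGroup X] [NormedSpace ℝ X]
    [NormedAddCommGroup F] [NormedSpace ℝ F] {f : X → F} {x : X} (hf : ContDiffAt ℝ 2 f x) (k : X) :
    DifferentiableAt ℝ (fun y ↦ fderiv ℝ f y k) x :=
  ((hf.fderiv_right (m := 1) (by norm_num)).differentiableAt (by simp)).clm_apply (by fun_prop)

lemma fderiv_christoffel {E : Type*} [NormedAddCommGroup E] [NormedSpace ℝ E]
    {g : E → E →L[ℝ] E →L[ℝ] ℝ} {x : E} (hg : ContDiffAt ℝ 2 g x) (u v w z : E) :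
    fderiv ℝ (fun y ↦ christoffel g y v w z) x u =
      (dirDeriv₂ g x u v w z + dirDeriv₂ g x u w v z - dirDeriv₂ g x u z v w) / 2 := by
  have hk := fun k : E ↦ differentiableAt_fderiv_apply hg k
  have hkk : ∀ k a b : E, DifferentiableAt ℝ (fun y ↦ fderiv ℝ g y k a b) x := fun k a b ↦
    ((hk k).clm_apply (by fun_prop)).clm_apply (by fun_prop)
  have hval : ∀ k a b : E, fderiv ℝ (fun y ↦ fderiv ℝ g y k a b) x u = dirDeriv₂ g x u k a b :=
    fun k a b ↦ fderiv_apply₂ (hk k) u a b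
  have hsum : HasFDerivAt (fun y ↦ christoffel g y v w z) ((2⁻¹ : ℝ) •
      (fderiv ℝ (fun y ↦ fderiv ℝ g y v w z) x + fderiv ℝ (fun y ↦ fderiv ℝ g y w v z) x -
        fderiv ℝ (fun y ↦ fderiv ℝ g y z v w) x)) x := by
    have h := (((hkk v w z).hasFDerivAt.add (hkk w v z).hasFDerivAt).sub
      (hkk z v w).hasFDerivAt).const_smul (2⁻¹ : ℝ)
    refine h.congr_of_eventuallyEq (.of_forall fun y ↦ ?_)
    simp [christoffel, div_eq_inv_mul]
  rw [hsum.fderiv, ← hval, ← hval, ← hval]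
  simp [div_eq_inv_mul]

lemma riemannForm_eq_sub {E : Type*} [NormedAddCommGroup E] [NormedSpace ℝ E]
    {g : E → E →L[ℝ] E →L[ℝ] ℝ} {x : E} (hg : ContDiffAt ℝ 2 g x) (Γ : E → E → E) (u v w z : E) :
    riemannForm g Γ x u v w z =
      ((dirDeriv₂ g x u v w z + dirDeriv₂ g x u w v z - dirDeriv₂ g x u z v w) / 2
        - g x (Γ v w) (Γ u z)) -
      ((dirDeriv₂ g x v u w z + dirDeriv₂ g x v w u z - dirDeriv₂ g x v z u w) / 2
        - g x (Γ u w) (Γ v z)) := by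
  rw [riemannForm, dirDeriv₂_comm hg u v]
  ring

/-! ### Coordinate formulas for covariant derivatives and curvature. -/

namespace WeakRiemannianStructure

variable {E : Type*} [NormedAddCommGroup E] [NormedSpace ℝ E] [CompleteSpace E]
  {M : Type*} [TopologicalSpace M] [ChartedSpace E M] [IsManifold 𝓘(ℝ, E) ∞ M]
  (S : WeakRiemannianStructure E M)

/-- The coordinate expression of a vector field in the preferred chart at `m`. -/
def _root_.chartField (m : M) (Y : Π x : M, TangentSpace 𝓘(ℝ, E) x) (y : E) : E :=
  chartCoord (E := E) m ((extChartAt 𝓘(ℝ, E) m).symm y) (Y ((extChartAt 𝓘(ℝ, E) m).symm y))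

lemma _root_.chartField_self (m : M) (Y : Π x : M, TangentSpace 𝓘(ℝ, E) x) :
    chartField m Y (extChartAt 𝓘(ℝ, E) m m) = Y m := by
  rw [chartField, extChartAt_to_inv]
  exact chartCoord_self m _

lemma _root_.differentiableAt_chartField {m : M} {Y : Π x : M, TangentSpace 𝓘(ℝ, E) x}
    (hY : MDiffAt (T% Y) m) : DifferentiableAt ℝ (chartField m Y) (extChartAt 𝓘(ℝ, E) m m) :=
  differentiableAt_comp_chart_symm
    ((mdifferentiableAt_section_iff_chartCoord (mem_extChartAt_source m) Y).1 hY)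

/-- No basis of `E` is available for expanding `Y` by the Leibniz rule. Instead the metric products
of `Y` with constant frame fields are differentiated, and metric compatibility together with
positivity determines the covariant derivative. -/
lemma cov_eq_fderiv_chartField {m : M} {Y : Π x : M, TangentSpace 𝓘(ℝ, E) x}
    (hY : MDiffAt (T% Y) m) (u : E) :
    S.cov Y m u = fderiv ℝ (chartField m Y) (extChartAt 𝓘(ℝ, E) m m) u +
      S.chartChristoffel m u (Y m) := by
  have hx := mem_extChartAt_source (I := 𝓘(ℝ, E)) m
  have hs := fun v ↦ chartFrame_self (E := E) m v
  have hg := (S.contDiffAt_chartMetric m).differentiableAt (by simp)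
  have hd := fun v : E ↦ mdifferentiableAt_chartFrame (E := E) hx v
  obtain ⟨y₀, hy₀⟩ : ∃ y₀ : E, y₀ = Y m := ⟨_, rfl⟩
  rw [← hy₀]
  refine S.ext_of_metric fun (z : E) ↦ ?_
  have h1 : mvfderiv 𝓘(ℝ, E) (fun y ↦ S.metric y (Y y) (chartFrame (E := E) m y z)) m u =
      fderiv ℝ (S.chartMetric m) (extChartAt 𝓘(ℝ, E) m m) u y₀ z +
        S.chartMetric m (extChartAt 𝓘(ℝ, E) m m)
          (fderiv ℝ (chartField m Y) (extChartAt 𝓘(ℝ, E) m m) u) z := by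
    have h := mvfderiv_chartFrame (E := E) hx (S.mdifferentiableAt_metric hY (hd z)) u
    have h2 := fderiv_bilinear_apply hg (differentiableAt_chartField hY)
      (differentiableAt_const (z : E)) u
    rw [fderiv_const_apply, zero_apply, map_zero, add_zero,
      (chartField_self m Y).trans hy₀.symm] at h2
    refine (congrArg _ (hs u).symm).trans (h.trans (Eq.trans ?_ h2))
    congr 1
    refine Filter.EventuallyEq.fderiv_eq ?_
    filter_upwards [eventually_mem_source m] with y hy
    exact congrArg (fun a ↦ S.metric _ a (chartFrame m _ z)) (chartFrame_chartCoord hy.1 _).symm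
  have h2 := S.cov_metric Y _ m u hY (hd z)
  rw [h1] at h2
  have h5 : fderiv ℝ (S.chartMetric m) (extChartAt 𝓘(ℝ, E) m m) u y₀ z =
      S.chartMetric m (extChartAt 𝓘(ℝ, E) m m) (S.chartChristoffel m u y₀) z +
        S.chartMetric m (extChartAt 𝓘(ℝ, E) m m) y₀ (S.chartChristoffel m u z) := by
    have hsy := (S.symmNear_chartMetric m).fderiv_symm hg
    rw [S.chartMetric_symm _ _ y₀, S.chartChristoffel_spec, S.chartChristoffel_spec]
    unfold christoffel
    rw [hsy u z y₀, hsy z u y₀, hsy y₀ u z]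
    ring
  simp only [chartMetric_self] at h2 h5
  have h6 : S.metric m (Y m) (S.cov (fun y ↦ chartFrame (E := E) m y z) m u) =
      S.metric m y₀ (S.chartChristoffel m u z) := by
    rw [hy₀]
    exact congrArg _ (S.chartChristoffel_eq m u z).symm
  have h8 : S.metric m (S.cov Y m u) ((chartFrame (E := E) m m) z) = S.metric m (S.cov Y m u) z :=
    congrArg _ (hs z)
  have h9 : S.metric m (fderiv ℝ (chartField m Y) (extChartAt 𝓘(ℝ, E) m m) u +
      S.chartChristoffel m u y₀ : E) z =
    S.metric m (fderiv ℝ (chartField m Y) (extChartAt 𝓘(ℝ, E) m m) u : E) z +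
      S.metric m (S.chartChristoffel m u y₀) z :=
    congrArg (fun f : TangentSpace 𝓘(ℝ, E) m →L[ℝ] ℝ ↦ f z) (map_add (S.metric m) _ _)
  linarith

lemma mdifferentiableAt_cov_chartFrame (m : M) (v w : E) :
    MDiffAt (T% (fun y ↦ S.cov (fun y ↦ chartFrame m y w) y (chartFrame m y v))) m := by
  have hx := mem_extChartAt_source (I := 𝓘(ℝ, E)) m
  have ho := isOpen_extChartAt_source (I := 𝓘(ℝ, E)) m
  have h := (S.cov_smooth _ ho).contMDiff (σ := fun y ↦ chartFrame m y w)
    (fun y hy ↦ (contMDiffAt_chartFrame hy (n := ⊤) contMDiffAt_const).contMDiffWithinAt)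
  have h' := ((h m hx).contMDiffAt (ho.mem_nhds hx)).mdifferentiableAt (by simp)
  exact MDifferentiableAt.clm_bundle_apply h' (mdifferentiableAt_chartFrame hx v)

/-- Move the outer derivative off the inner one by metric compatibility: u⟨∇_v W, Z⟩ is a derivative
of Christoffel symbols of the first kind, and ⟨∇_v W, ∇_u Z⟩ needs the second kind at `m` only. -/
lemma metric_cov_cov_chartFrame (m : M) (u v w z : E) :
    S.metric m (S.cov (fun y ↦ S.cov (fun y ↦ chartFrame (E := E) m y w) y
        (chartFrame (E := E) m y v)) m u) z =
      (dirDeriv₂ (S.chartMetric m) (extChartAt 𝓘(ℝ, E) m m) u v w z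
        + dirDeriv₂ (S.chartMetric m) (extChartAt 𝓘(ℝ, E) m m) u w v z
        - dirDeriv₂ (S.chartMetric m) (extChartAt 𝓘(ℝ, E) m m) u z v w) / 2
      - S.chartMetric m (extChartAt 𝓘(ℝ, E) m m)
        (S.chartChristoffel m v w) (S.chartChristoffel m u z) := by
  have hx := mem_extChartAt_source (I := 𝓘(ℝ, E)) m
  have hs := fun v ↦ chartFrame_self (E := E) m v
  have hd := fun v : E ↦ mdifferentiableAt_chartFrame (E := E) hx v
  have h1 := S.cov_metric _ _ m u (S.mdifferentiableAt_cov_chartFrame m v w) (hd z)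
  have h2 := mvfderiv_chartFrame (E := E) hx
    (S.mdifferentiableAt_metric (S.mdifferentiableAt_cov_chartFrame m v w) (hd z)) u
  have h3 : fderiv ℝ ((fun y ↦ S.metric y (S.cov (fun y ↦ chartFrame (E := E) m y w) y
        (chartFrame (E := E) m y v)) (chartFrame (E := E) m y z)) ∘ (extChartAt 𝓘(ℝ, E) m).symm)
          (extChartAt 𝓘(ℝ, E) m m) =
      fderiv ℝ (fun y ↦ christoffel (S.chartMetric m) y v w z) (extChartAt 𝓘(ℝ, E) m m) := by
    refine Filter.EventuallyEq.fderiv_eq ?_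
    filter_upwards [(tendsto_chart_symm m).eventually (S.metric_cov_chartFrame m),
      eventually_mem_source m] with y hy hy'
    have := hy v w z
    rwa [hy'.2] at this
  rw [h3, fderiv_christoffel ((S.contDiffAt_chartMetric m).of_le
    (WithTop.coe_le_coe.2 (le_top : (2 : ℕ∞) ≤ ⊤)))] at h2
  have h4 := (congrArg (mvfderiv 𝓘(ℝ, E) (fun y ↦ S.metric y (S.cov
    (fun y ↦ chartFrame (E := E) m y w) y (chartFrame (E := E) m y v))
      (chartFrame (E := E) m y z)) m) (hs u)).symm.trans h2
  have h5 : S.cov (fun y ↦ chartFrame (E := E) m y w) m (chartFrame (E := E) m m v) =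
      S.chartChristoffel m v w :=
    (congrArg (S.cov (fun y ↦ chartFrame (E := E) m y w) m) (hs v)).trans
      (S.chartChristoffel_eq m v w).symm
  have h6 : S.metric m (S.cov (fun y ↦ chartFrame (E := E) m y w) m (chartFrame (E := E) m m v))
      (S.cov (fun y ↦ chartFrame (E := E) m y z) m u) =
      S.metric m (S.chartChristoffel m v w) (S.chartChristoffel m u z) :=
    congrArg₂ (fun a b : TangentSpace 𝓘(ℝ, E) m ↦ S.metric m a b) h5
      (S.chartChristoffel_eq m u z).symm
  have h7 : S.metric m (S.cov (fun y ↦ S.cov (fun y ↦ chartFrame (E := E) m y w) y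
        (chartFrame (E := E) m y v)) m u) (chartFrame (E := E) m m z) =
      S.metric m (S.cov (fun y ↦ S.cov (fun y ↦ chartFrame (E := E) m y w) y
        (chartFrame (E := E) m y v)) m u) z := congrArg _ (hs z)
  rw [chartMetric_self]
  linarith

lemma metric_curvature (m : M) (u v w z : TangentSpace 𝓘(ℝ, E) m) :
    S.metric m (S.curvature u v w) z =
      riemannForm (S.chartMetric m) (S.chartChristoffel m) (extChartAt 𝓘(ℝ, E) m m) u v w z := by
  have hx := mem_extChartAt_source (I := 𝓘(ℝ, E)) m
  have hev : ∀ v : TangentSpace 𝓘(ℝ, E) m, ∀ᶠ y in 𝓝 m,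
      FiberBundle.extend E v y = chartFrame (E := E) m y v := fun v ↦ by
    filter_upwards [extChartAt_source_mem_nhds (I := 𝓘(ℝ, E)) m] with y hy
    exact extend_eq_chartFrame hy _
  have hcov : ∀ v : TangentSpace 𝓘(ℝ, E) m,
      S.cov (fun y ↦ S.cov (FiberBundle.extend E w) y (FiberBundle.extend E v y)) m =
        S.cov (fun y ↦ S.cov (fun y ↦ chartFrame (E := E) m y w) y
          (chartFrame (E := E) m y v)) m := by
    intro v
    refine S.cov_congr (S.mdifferentiableAt_cov_chartFrame m v w) ?_
    filter_upwards [hev v, (hev w).eventually_nhds,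
      extChartAt_source_mem_nhds (I := 𝓘(ℝ, E)) m] with y hv hw hy
    rw [hv, S.cov_congr (mdifferentiableAt_chartFrame (E := E) hy w) hw]
  have hbr : VectorField.mlieBracket 𝓘(ℝ, E) (FiberBundle.extend E u) (FiberBundle.extend E v) m =
      0 :=
    (Filter.EventuallyEq.mlieBracket_vectorField_eq (I := 𝓘(ℝ, E)) (hev u) (hev v)).trans
      (mlieBracket_chartFrame hx u v)
  have hcurv : S.metric m (S.curvature u v w) z =
      S.metric m (S.cov (fun y ↦ S.cov (fun y ↦ chartFrame (E := E) m y w) y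
          (chartFrame (E := E) m y v)) m u) z -
      S.metric m (S.cov (fun y ↦ S.cov (fun y ↦ chartFrame (E := E) m y w) y
          (chartFrame (E := E) m y u)) m v) z := by
    simp only [curvature]
    rw [hcov v, hcov u, hbr]
    simp
  exact hcurv.trans ((congrArg₂ (· - ·) (S.metric_cov_cov_chartFrame m u v w z)
    (S.metric_cov_cov_chartFrame m v u w z)).trans (riemannForm_eq_sub
      ((S.contDiffAt_chartMetric m).of_le (WithTop.coe_le_coe.2 (le_top : (2 : ℕ∞) ≤ ⊤)))
      _ u v w z).symm)

end WeakRiemannianStructure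

/-! ### Algebraic symmetries of the Riemann tensor. -/

section RiemannForm

variable {E : Type*} [NormedAddCommGroup E] [NormedSpace ℝ E]
  {g : E → E →L[ℝ] E →L[ℝ] ℝ} {x : E} {Γ : E → E → E}

lemma riemannForm_swap_left (u v w z : E) :
    riemannForm g Γ x u v w z = - riemannForm g Γ x v u w z := by
  unfold riemannForm
  ring

lemma riemannForm_swap_right (hs : ∀ u v, g x u v = g x v u) (u v w z : E) :
    riemannForm g Γ x u v w z = - riemannForm g Γ x u v z w := by
  unfold riemannForm
  rw [hs (Γ v z), hs (Γ u z)]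
  ring

lemma dirDeriv₂_comb_left {X F : Type*} [NormedAddCommGroup X] [NormedSpace ℝ X]
    [NormedAddCommGroup F] [NormedSpace ℝ F] (f : X → F) (n : X) (a b : ℝ) (i j k : X) :
    dirDeriv₂ f n (a • i + b • j) k = a • dirDeriv₂ f n i k + b • dirDeriv₂ f n j k := by
  simp [dirDeriv₂]

lemma christoffel_comb_left (a b : ℝ) (u v w z : E) :
    christoffel g x (a • u + b • v) w z = a * christoffel g x u w z + b * christoffel g x v w z := by
  simp only [christoffel, map_add, map_smul, add_apply, smul_apply, smul_eq_mul]
  ring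

/-- `Γ` is not assumed linear; after moving the symbol that contains the combined vector into the
first slot, `hΓ` replaces it by the manifestly linear first kind. -/
lemma riemannForm_comb_left (hs : SymmNear g x)
    (hΓ : ∀ u v w, g x (Γ u v) w = christoffel g x u v w) (a b : ℝ) (u u' v w z : E) :
    riemannForm g Γ x (a • u + b • u') v w z =
      a * riemannForm g Γ x u v w z + b * riemannForm g Γ x u' v w z := by
  unfold riemannForm
  rw [hs.self_of_nhds (Γ v w) (Γ (a • u + b • u') z), hs.self_of_nhds (Γ v w) (Γ u z),
    hs.self_of_nhds (Γ v w) (Γ u' z)]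
  simp only [hΓ, christoffel_comb_left, dirDeriv₂_comb_left, map_add, map_smul, add_apply,
    smul_apply, smul_eq_mul]
  ring

lemma riemannForm_pair_symm (hg : ContDiffAt ℝ 2 g x) (hs : SymmNear g x)
    (hΓ : ∀ u v w, g x (Γ u v) w = christoffel g x u v w)
    (hpos : ∀ v, v ≠ 0 → 0 < g x v v) (u v w z : E) :
    riemannForm g Γ x u v w z = riemannForm g Γ x w z u v := by
  have hcomm : ∀ u v, Γ u v = Γ v u := by
    intro u v
    by_contra hne
    have h1 := hpos _ (sub_ne_zero.2 hne)
    have h2 : g x (Γ u v) (Γ u v - Γ v u) = g x (Γ v u) (Γ u v - Γ v u) := by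
      rw [hΓ, hΓ, christoffel_comm hs (hg.differentiableAt (by simp))]
    simp only [map_sub, sub_apply] at h1 h2
    linarith
  have hd := fun i k v w ↦ hs.dirDeriv₂_symm hg i k v w
  unfold riemannForm
  rw [dirDeriv₂_comm hg w u, dirDeriv₂_comm hg w v, dirDeriv₂_comm hg z u, dirDeriv₂_comm hg z v,
    hd _ _ z v, hd _ _ z u, hd _ _ w v, hd _ _ w u, hcomm z u, hcomm w v, hcomm w u, hcomm z v,
    hs.self_of_nhds (Γ u z) (Γ v w)]
  ring

/-- Skewness in either pair of arguments produces one determinant factor for each pair; pair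
symmetry reduces the second factor to the first. -/
lemma riemannForm_rotate (hg : ContDiffAt ℝ 2 g x) (hs : SymmNear g x)
    (hΓ : ∀ u v w, g x (Γ u v) w = christoffel g x u v w)
    (hpos : ∀ v, v ≠ 0 → 0 < g x v v) (a b c d : ℝ) (u v : E) :
    riemannForm g Γ x (a • u + b • v) (c • u + d • v) (c • u + d • v) (a • u + b • v) =
      (a * d - b * c) ^ 2 * riemannForm g Γ x u v v u := by
  have hleft : ∀ w z, riemannForm g Γ x (a • u + b • v) (c • u + d • v) w z =
      (a * d - b * c) * riemannForm g Γ x u v w z := by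
    intro w z
    have h0 : ∀ u, riemannForm g Γ x u u w z = 0 := fun u ↦ by
      have := riemannForm_swap_left (g := g) (Γ := Γ) (x := x) u u w z
      linarith
    have hc : ∀ u', riemannForm g Γ x u' (c • u + d • v) w z =
        c * riemannForm g Γ x u' u w z + d * riemannForm g Γ x u' v w z := fun u' ↦ by
      rw [riemannForm_swap_left, riemannForm_comb_left hs hΓ, riemannForm_swap_left u',
        riemannForm_swap_left u' v]
      ring
    rw [riemannForm_comb_left hs hΓ, hc, hc, h0, h0, riemannForm_swap_left v u]
    ring
  rw [hleft, riemannForm_pair_symm hg hs hΓ hpos, riemannForm_swap_left, hleft]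
  rw [riemannForm_swap_right hs.self_of_nhds u v v u]
  ring

end RiemannForm

/-! ### Sectional curvature and orthonormal bases of planes. -/

namespace WeakRiemannianStructure

variable {E : Type*} [NormedAddCommGroup E] [NormedSpace ℝ E] [CompleteSpace E]
  {M : Type*} [TopologicalSpace M] [ChartedSpace E M] [IsManifold 𝓘(ℝ, E) ∞ M]
  (S : WeakRiemannianStructure E M)

/-- The definition picks an arbitrary orthonormal basis. Any two are related by an orthogonal
matrix, whose squared determinant is 1. -/
lemma sectionalCurvature_eq {m : M} {P : Submodule ℝ (TangentSpace 𝓘(ℝ, E) m)}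
    {u v : TangentSpace 𝓘(ℝ, E) m} (h : S.IsOrthonormalBasisOf P (u, v)) :
    S.sectionalCurvature P =
      riemannForm (S.chartMetric m) (S.chartChristoffel m) (extChartAt 𝓘(ℝ, E) m m) u v v u := by
  have hex : ∃ b, S.IsOrthonormalBasisOf P b := ⟨_, h⟩
  rw [sectionalCurvature, dif_pos hex, metric_curvature]
  obtain ⟨h1, h2, h3, h4⟩ := hex.choose_spec
  obtain ⟨g1, g2, g3, g4⟩ := h
  have hm : ∀ w ∈ P, ∃ a b : ℝ, a • u + b • v = w := fun w hw ↦ by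
    rw [← g4] at hw
    exact Submodule.mem_span_pair.1 hw
  obtain ⟨a, b, hab⟩ := hm hex.choose.1 (h4.le (Submodule.subset_span (.inl rfl)))
  obtain ⟨c, d, hcd⟩ := hm hex.choose.2 (h4.le (Submodule.subset_span (.inr rfl)))
  have g3' : S.metric m v u = 0 := by rw [S.metric_symm]; exact g3
  rw [← hab] at h1 h3
  rw [← hcd] at h2 h3
  dsimp only at g1 g2 g3
  simp only [map_add, map_smul, add_apply, smul_apply, smul_eq_mul, g1, g2, g3, g3'] at h1 h2 h3
  have hdet : (a * d - b * c) ^ 2 = 1 := by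
    have : (a * d - b * c) ^ 2 = (a * a + b * b) * (c * c + d * d) - (a * c + b * d) ^ 2 := by ring
    rw [this]
    have e1 : a * a + b * b = 1 := by linarith
    have e2 : c * c + d * d = 1 := by linarith
    have e3 : a * c + b * d = 0 := by linarith
    rw [e1, e2, e3]
    norm_num
  have hrot := riemannForm_rotate ((S.contDiffAt_chartMetric m).of_le
    (WithTop.coe_le_coe.2 (le_top : (2 : ℕ∞) ≤ ⊤))) (S.symmNear_chartMetric m)
    (S.chartChristoffel_spec m) (S.chartMetric_pos m).self_of_nhds a b c d u v
  rw [hdet, one_mul] at hrot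
  refine Eq.trans ?_ hrot
  exact congrArg₂ (fun p q : E ↦ riemannForm (S.chartMetric m) (S.chartChristoffel m)
    (extChartAt 𝓘(ℝ, E) m m) p q q p) hab.symm hcd.symm

lemma linearIndependent_of_orthonormal {m : M} {u v : TangentSpace 𝓘(ℝ, E) m}
    (hu : S.metric m u u = 1) (hv : S.metric m v v = 1) (huv : S.metric m u v = 0) :
    LinearIndependent ℝ ![u, v] := by
  have hvu : S.metric m v u = 0 := by rw [S.metric_symm]; exact huv
  rw [LinearIndependent.pair_iff]
  intro a b h
  have h1 := congrArg (S.metric m u) h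
  have h2 := congrArg (S.metric m v) h
  simp only [map_add, map_smul, smul_eq_mul, map_zero, hu, hv, huv, hvu] at h1 h2
  constructor <;> linarith

lemma finrank_span_of_orthonormal {m : M} {u v : TangentSpace 𝓘(ℝ, E) m}
    (hu : S.metric m u u = 1) (hv : S.metric m v v = 1) (huv : S.metric m u v = 0) :
    Module.finrank ℝ (Submodule.span ℝ {u, v}) = 2 := by
  have h := finrank_span_eq_card (S.linearIndependent_of_orthonormal hu hv huv)
  rwa [Matrix.range_cons, Matrix.range_cons, Matrix.range_empty, Set.union_empty,
    Set.singleton_union, Fintype.card_fin] at h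

lemma exists_normalize {m : M} {u : TangentSpace 𝓘(ℝ, E) m} (hu : u ≠ 0) :
    ∃ r : ℝ, S.metric m (r • u) (r • u) = 1 := by
  have h := S.metric_pos m u hu
  refine ⟨(√(S.metric m u u))⁻¹, ?_⟩
  simp only [map_smul, smul_apply, smul_eq_mul]
  rw [← mul_assoc, ← mul_inv, Real.mul_self_sqrt h.le, inv_mul_cancel₀ h.ne']

lemma exists_isOrthonormalBasisOf {m : M} {P : Submodule ℝ (TangentSpace 𝓘(ℝ, E) m)}
    (hP : Module.finrank ℝ P = 2) : ∃ u v, S.IsOrthonormalBasisOf P (u, v) := by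
  have : FiniteDimensional ℝ P := .of_finrank_eq_succ hP
  have hne : P ≠ ⊥ := by
    rintro rfl
    rw [finrank_bot] at hP
    omega
  obtain ⟨e, heP, he⟩ := P.exists_mem_ne_zero_of_ne_bot hne
  obtain ⟨r, hr⟩ := S.exists_normalize he
  set u := r • e with hu
  have huP : u ∈ P := P.smul_mem _ heP
  obtain ⟨f, hfP, hf⟩ : ∃ f ∈ P, f ∉ Submodule.span ℝ {u} := by
    by_contra! h
    have h1 := Submodule.finrank_mono (show P ≤ Submodule.span ℝ {u} from h)
    have hu0 : u ≠ 0 := fun h0 ↦ by simp [h0] at hr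
    have h2 := finrank_span_singleton (K := ℝ) hu0
    omega
  have hw : f - S.metric m u f • u ≠ 0 := fun h ↦
    hf (Submodule.mem_span_singleton.2 ⟨_, (sub_eq_zero.1 h).symm⟩)
  obtain ⟨s, hs⟩ := S.exists_normalize hw
  set v := s • (f - S.metric m u f • u) with hv
  have hvP : v ∈ P := P.smul_mem _ (P.sub_mem hfP (P.smul_mem _ huP))
  have huv : S.metric m u v = 0 := by
    rw [hv]
    simp only [map_smul, map_sub, hr, smul_eq_mul]
    ring
  refine ⟨u, v, hr, hs, huv, Submodule.eq_of_le_of_finrank_eq ?_ ?_⟩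
  · rw [Submodule.span_le]
    rintro x (rfl | rfl)
    exacts [huP, hvP]
  · rw [hP]
    exact S.finrank_span_of_orthonormal hr hs huv

end WeakRiemannianStructure

/-! ### Maps between manifolds in charts -/

section ChartMap

variable {E : Type*} [NormedAddCommGroup E] [NormedSpace ℝ E]
  {M : Type*} [TopologicalSpace M] [ChartedSpace E M] [IsManifold 𝓘(ℝ, E) ∞ M]
  {F : Type*} [NormedAddCommGroup F] [NormedSpace ℝ F]
  {N : Type*} [TopologicalSpace N] [ChartedSpace F N] [IsManifold 𝓘(ℝ, F) ∞ N]

/-- The map `f` in the preferred charts at `m` and `f m`. -/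
def chartMap (f : M → N) (m : M) (y : E) : F :=
  extChartAt 𝓘(ℝ, F) (f m) (f ((extChartAt 𝓘(ℝ, E) m).symm y))

lemma chartMap_self (f : M → N) (m : M) :
    chartMap (E := E) (F := F) f m (extChartAt 𝓘(ℝ, E) m m) = extChartAt 𝓘(ℝ, F) (f m) (f m) := by
  rw [chartMap, extChartAt_to_inv]

lemma contDiffAt_chartMap {f : M → N} {m : M} (hf : CMDiffAt ∞ f m) :
    ContDiffAt ℝ ∞ (chartMap (E := E) (F := F) f m) (extChartAt 𝓘(ℝ, E) m m) :=
  contDiffAt_comp_chart_symm (f := fun x ↦ extChartAt 𝓘(ℝ, F) (f m) (f x))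
    (contMDiffAt_extChartAt.comp m hf)

lemma fderiv_chartMap {f : M → N} {m x : M} (hx : x ∈ (extChartAt 𝓘(ℝ, E) m).source)
    (hfx : f x ∈ (extChartAt 𝓘(ℝ, F) (f m)).source) (hf : MDiffAt f x) (u : E) :
    fderiv ℝ (chartMap (E := E) (F := F) f m) (extChartAt 𝓘(ℝ, E) m x) u =
      chartCoord (E := F) (f m) (f x) (mfderiv 𝓘(ℝ, E) 𝓘(ℝ, F) f x (chartFrame m x u)) := by
  have h1 : MDifferentiableAt 𝓘(ℝ, F) 𝓘(ℝ, F) (extChartAt 𝓘(ℝ, F) (f m)) (f x) :=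
    mdifferentiableAt_extChartAt (by simpa using hfx)
  have h2 := mvfderiv_chartFrame hx (h1.comp x hf) u
  have h3 := mfderiv_comp_apply x h1 hf (chartFrame m x u)
  refine Eq.trans h2.symm (Eq.trans h3 ?_)
  exact (DFunLike.congr_fun (chartCoord_eq_mfderiv hfx) _).symm

lemma chartFrame_fderiv_chartMap {f : M → N} {m x : M} (hx : x ∈ (extChartAt 𝓘(ℝ, E) m).source)
    (hfx : f x ∈ (extChartAt 𝓘(ℝ, F) (f m)).source) (hf : MDiffAt f x) (u : E) :
    chartFrame (f m) (f x)
      (fderiv ℝ (chartMap (E := E) (F := F) f m) (extChartAt 𝓘(ℝ, E) m x) u) =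
      mfderiv 𝓘(ℝ, E) 𝓘(ℝ, F) f x (chartFrame m x u) := by
  rw [fderiv_chartMap hx hfx hf, chartFrame_chartCoord hfx]

lemma fderiv_chartMap_self {f : M → N} {m : M} (hf : MDiffAt f m) (u : E) :
    fderiv ℝ (chartMap (E := E) (F := F) f m) (extChartAt 𝓘(ℝ, E) m m) u =
      mfderiv 𝓘(ℝ, E) 𝓘(ℝ, F) f m u := by
  rw [fderiv_chartMap (mem_extChartAt_source m) (mem_extChartAt_source (f m)) hf]
  refine (chartCoord_self _ _).trans ?_
  exact congrArg (mfderiv 𝓘(ℝ, E) 𝓘(ℝ, F) f m) (chartFrame_self m u)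

end ChartMap

/-! ### Local inverses of immersions and submersions -/

section LocalInverse

variable {E : Type*} [NormedAddCommGroup E] [NormedSpace ℝ E]
  {M : Type*} [TopologicalSpace M] [ChartedSpace E M]
  {F : Type*} [NormedAddCommGroup F] [NormedSpace ℝ F]
  {N : Type*} [TopologicalSpace N] [ChartedSpace F N]

lemma contMDiffAt_extend_symm {e : OpenPartialHomeomorph M E}
    (he : e ∈ IsManifold.maximalAtlas 𝓘(ℝ, E) ∞ M) {y : E} (hy : y ∈ e.target) :
    ContMDiffAt 𝓘(ℝ, E) 𝓘(ℝ, E) ∞ (e.extend 𝓘(ℝ, E)).symm y := by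
  have h := _root_.contMDiffOn_extend_symm he
  simp only [modelWithCornersSelf_coe, Set.image_id] at h
  exact (h y hy).contMDiffAt (e.open_target.mem_nhds hy)

/-- In adapted charts the map is u ↦ (u, 0), undone by the first projection. The inverse yields
injective differentials and serves to extend fields from the level set to `M`. -/
lemma Manifold.IsImmersionAt.exists_leftInverse {f : N → M} {x : N}
    (h : Manifold.IsImmersionAt 𝓘(ℝ, F) 𝓘(ℝ, E) ∞ f x) :
    ∃ r : M → N, CMDiffAt ∞ r (f x) ∧ r (f x) = x ∧ ∀ᶠ y in 𝓝 x, r (f y) = y := by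
  have hw : ∀ u ∈ h.domChart.target, h.codChart (f (h.domChart.symm u)) = h.equiv (u, 0) :=
    fun u hu ↦ h.writtenInCharts (show u ∈ (h.domChart.extend 𝓘(ℝ, F)).target by simpa using hu)
  have hx := h.mem_domChart_source
  have hr : ∀ y ∈ h.domChart.source, (h.equiv.symm (h.codChart (f y))).1 = h.domChart y := by
    intro y hy
    have h1 := hw _ (h.domChart.map_source hy)
    rw [h.domChart.left_inv hy] at h1
    rw [h1, ContinuousLinearEquiv.symm_apply_apply]
  have hinv : ∀ y ∈ h.domChart.source,
      h.domChart.symm (h.equiv.symm (h.codChart (f y))).1 = y := by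
    intro y hy
    rw [hr y hy, h.domChart.left_inv hy]
  have h1 : CMDiffAt ∞ h.codChart (f x) :=
    h.codChart.contMDiffAt_extend h.codChart_mem_maximalAtlas h.mem_codChart_source
  have h2 : CMDiffAt ∞ (fun y ↦ (h.equiv.symm (h.codChart y)).1) (f x) := by
    have : ContDiff ℝ ∞ (fun z ↦ (h.equiv.symm z).1) := by fun_prop
    exact this.contMDiff.contMDiffAt.comp (f x) h1
  refine ⟨fun y ↦ h.domChart.symm (h.equiv.symm (h.codChart y)).1, ?_, hinv x hx, ?_⟩
  · exact ContMDiffAt.comp_of_eq (contMDiffAt_extend_symm h.domChart_mem_maximalAtlas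
      (h.domChart.map_source hx)) h2 (hr x hx)
  · filter_upwards [h.domChart.open_source.mem_nhds hx] with y hy
    exact hinv y hy

lemma Manifold.IsSubmersionAt.exists_rightInverse {f : N → M} {x : N}
    (h : Manifold.IsSubmersionAt 𝓘(ℝ, F) 𝓘(ℝ, E) ∞ f x) :
    ∃ s : M → N, CMDiffAt ∞ s (f x) ∧ s (f x) = x ∧ ∀ᶠ y in 𝓝 (f x), f (s y) = y := by
  have hw : ∀ u ∈ h.domChart.target, h.codChart (f (h.domChart.symm u)) = (h.equiv u).1 := by
    intro u hu
    exact h.writtenInCharts (show u ∈ (h.domChart.extend 𝓘(ℝ, F)).target by simpa using hu)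
  have hx := h.mem_domChart_source
  have h0 : (h.equiv (h.domChart x)).1 = h.codChart (f x) := by
    rw [← hw _ (h.domChart.map_source hx), h.domChart.left_inv hx]
  let t : M → F := fun y ↦ h.equiv.symm (h.codChart y, (h.equiv (h.domChart x)).2)
  have ht0 : t (f x) = h.domChart x := by
    simp only [t]
    rw [← h0]
    simp
  have h1 : CMDiffAt ∞ h.codChart (f x) :=
    h.codChart.contMDiffAt_extend h.codChart_mem_maximalAtlas h.mem_codChart_source
  have h2 : CMDiffAt ∞ t (f x) := by
    have : ContDiff ℝ ∞ (fun z ↦ h.equiv.symm (z, (h.equiv (h.domChart x)).2)) := by fun_prop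
    exact this.contMDiff.contMDiffAt.comp (f x) h1
  refine ⟨fun y ↦ h.domChart.symm (t y), ?_, ?_, ?_⟩
  · exact ContMDiffAt.comp_of_eq (contMDiffAt_extend_symm h.domChart_mem_maximalAtlas
      (h.domChart.map_source hx)) h2 ht0
  · exact (congrArg _ ht0).trans (h.domChart.left_inv hx)
  · have h3 : ∀ᶠ y in 𝓝 (f x), t y ∈ h.domChart.target :=
      h2.continuousAt.eventually (by
        rw [ht0]; exact h.domChart.open_target.mem_nhds (h.domChart.map_source hx))
    filter_upwards [h3, h.codChart.open_source.mem_nhds h.mem_codChart_source] with y hy hy'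
    refine h.codChart.injOn (h.source_subset_preimage_source (h.domChart.map_target hy)) hy' ?_
    rw [hw _ hy]
    simp [t]

end LocalInverse

/-! ### The complex structure in charts -/

namespace WeakKahlerStructure

variable {E : Type*} [NormedAddCommGroup E] [NormedSpace ℝ E] [CompleteSpace E]
  {M : Type*} [TopologicalSpace M] [ChartedSpace E M] [IsManifold 𝓘(ℝ, E) ∞ M]
  (S : WeakKahlerStructure E M)

/-- The complex structure at `x` in the frame of the preferred chart at `m`. -/
def frameJ (m x : M) : E →L[ℝ] E := chartCoord m x ∘L S.J x ∘L chartFrame m x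

/-- The complex structure in the preferred chart at `m`. -/
def chartJ (m : M) (y : E) : E →L[ℝ] E := S.frameJ m ((extChartAt 𝓘(ℝ, E) m).symm y)

lemma contMDiffAt_frameJ (m : M) : CMDiffAt ∞ (S.frameJ m) m := by
  have h := ((contMDiffAt_hom_bundle (n := ∞) (x₀ := m) _).1 S.J_smooth.contMDiffAt).2
  refine h.congr_of_eventuallyEq ?_
  filter_upwards [extChartAt_source_mem_nhds (I := 𝓘(ℝ, E)) m] with x hx
  rfl

lemma contDiffAt_chartJ (m : M) : ContDiffAt ℝ ∞ (S.chartJ m) (extChartAt 𝓘(ℝ, E) m m) :=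
  contDiffAt_comp_chart_symm (S.contMDiffAt_frameJ m)

lemma chartFrame_frameJ {m x : M} (hx : x ∈ (extChartAt 𝓘(ℝ, E) m).source) (v : E) :
    chartFrame m x (S.frameJ m x v) = S.J x (chartFrame m x v) :=
  chartFrame_chartCoord hx _

lemma chartJ_self (m : M) (v : E) : S.chartJ m (extChartAt 𝓘(ℝ, E) m m) v = S.J m v := by
  rw [chartJ, extChartAt_to_inv]
  exact (chartCoord_self m _).trans (congrArg (S.J m) (chartFrame_self m v))

lemma chartJ_chartJ (m : M) : ∀ᶠ y in 𝓝 (extChartAt 𝓘(ℝ, E) m m), ∀ v,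
    S.chartJ m y (S.chartJ m y v) = -v := by
  filter_upwards [eventually_mem_source m] with y hy v
  have h1 := S.chartFrame_frameJ hy.1 v
  have h2 : S.frameJ m _ (S.frameJ m _ v) = chartCoord (E := E) m _
    (S.J _ (S.J _ (chartFrame m _ v))) := congrArg (fun w ↦ chartCoord (E := E) m _ (S.J _ w)) h1
  refine h2.trans ?_
  rw [S.J_sq, map_neg, chartCoord_chartFrame hy.1]

lemma chartJ_isometry (m : M) : ∀ᶠ y in 𝓝 (extChartAt 𝓘(ℝ, E) m m), ∀ v w,
    S.chartMetric m y (S.chartJ m y v) (S.chartJ m y w) = S.chartMetric m y v w := by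
  filter_upwards [eventually_mem_source m] with y hy v w
  exact (congrArg₂ (fun a b ↦ S.metric _ a b) (S.chartFrame_frameJ hy.1 v)
    (S.chartFrame_frameJ hy.1 w)).trans (S.J_isometry _ _ _)

end WeakKahlerStructure

/-! ### The tangent spaces of the level set and of the orbits -/

section Reduction

variable {E : Type*} [NormedAddCommGroup E] [NormedSpace ℝ E] [CompleteSpace E]
  {M : Type*} [TopologicalSpace M] [ChartedSpace E M] [IsManifold 𝓘(ℝ, E) ∞ M]
  {EG : Type*} [NormedAddCommGroup EG] [NormedSpace ℝ EG] [CompleteSpace EG]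
  {G : Type*} [TopologicalSpace G] [ChartedSpace EG G] [Group G] [LieGroup 𝓘(ℝ, EG) ∞ G]
  [MulAction G M] [ContMDiffSMul 𝓘(ℝ, EG) 𝓘(ℝ, E) ∞ G M]
  {S : WeakKahlerStructure E M} {μ : M → (EG →L[ℝ] ℝ)} {c : EG →L[ℝ] ℝ}
  {EN : Type*} [NormedAddCommGroup EN] [NormedSpace ℝ EN]
  [ChartedSpace EN (LevelSet μ c)] [IsManifold 𝓘(ℝ, EN) ∞ (LevelSet μ c)]
  {EQ : Type*} [NormedAddCommGroup EQ] [NormedSpace ℝ EQ] [CompleteSpace EQ]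
  [ChartedSpace EQ (KahlerQuotient G μ c)] [IsManifold 𝓘(ℝ, EQ) ∞ (KahlerQuotient G μ c)]
  {T : WeakRiemannianStructure EQ (KahlerQuotient G μ c)}

/-- The weak Riemannian structure `T` is the one of the Kähler quotient of `S` at an elliptic
level of the moment map `μ`. -/
structure IsKahlerReduction (S : WeakKahlerStructure E M) (G : Type*) [TopologicalSpace G]
    [ChartedSpace EG G] [Group G] [LieGroup 𝓘(ℝ, EG) ∞ G]
    [MulAction G M] [ContMDiffSMul 𝓘(ℝ, EG) 𝓘(ℝ, E) ∞ G M] (μ : M → (EG →L[ℝ] ℝ))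
    (c : EG →L[ℝ] ℝ) (EN : Type*) [NormedAddCommGroup EN] [NormedSpace ℝ EN]
    [ChartedSpace EN (LevelSet μ c)]
    [ChartedSpace EQ (KahlerQuotient G μ c)] [IsManifold 𝓘(ℝ, EQ) ∞ (KahlerQuotient G μ c)]
    (T : WeakRiemannianStructure EQ (KahlerQuotient G μ c)) : Prop where
  moment : S.IsMomentMap G μ
  fixed : ∀ a : G, coadjointAction a c = c
  level : IsLevelSubmanifold E EN μ c
  elliptic : ∀ m : LevelSet μ c, S.IsEllipticAt (EG := EG) G (m : M)
  quotient : S.IsKahlerQuotientStructure G μ c EN T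

namespace IsKahlerReduction

lemma immersionAt (h : IsKahlerReduction S G μ c EN T) (n : LevelSet μ c) :
    Manifold.IsImmersionAt 𝓘(ℝ, EN) 𝓘(ℝ, E) ∞ (Subtype.val : LevelSet μ c → M) n :=
  h.level.embedding.isImmersion.isImmersionAt n

lemma submersionAt (h : IsKahlerReduction S G μ c EN T) (n : LevelSet μ c) :
    Manifold.IsSubmersionAt 𝓘(ℝ, EN) 𝓘(ℝ, EQ) ∞ (quotientProj G μ c) n :=
  h.quotient.submersion.isSubmersionAt n

lemma contMDiffAt_val (h : IsKahlerReduction S G μ c EN T) (n : LevelSet μ c) :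
    ContMDiffAt 𝓘(ℝ, EN) 𝓘(ℝ, E) ∞ (Subtype.val : LevelSet μ c → M) n :=
  (h.immersionAt n).contMDiffAt

lemma contMDiffAt_proj (h : IsKahlerReduction S G μ c EN T) (n : LevelSet μ c) :
    ContMDiffAt 𝓘(ℝ, EN) 𝓘(ℝ, EQ) ∞ (quotientProj G μ c) n :=
  (h.submersionAt n).isSubmersionAtOfComplement_complement.contMDiffAt

/-- The moment map equation identifies the kernel of `dμ` with the orthogonal complement of Jǧ. -/
lemma exists_inclDeriv_iff (h : IsKahlerReduction S G μ c EN T) (n : LevelSet μ c)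
    (e : TangentSpace 𝓘(ℝ, E) (n : M)) :
    (∃ v, inclDeriv (EN := EN) μ c n v = e) ↔
      ∀ ρ : EG, S.metric n e (S.J n (fundamental G (n : M) ρ)) = 0 := by
  have h1 : (∃ v, inclDeriv (EN := EN) μ c n v = e) ↔ mvfderiv 𝓘(ℝ, E) μ (n : M) e = 0 := by
    have := SetLike.ext_iff.1 (h.level.tangent n) e
    exact this
  rw [h1]
  constructor
  · intro h0 ρ
    rw [← h.moment.moment, h0, zero_apply]
  · intro h0
    ext ρ
    rw [h.moment.moment, h0, zero_apply]

lemma metric_inclDeriv_J_fundamental (h : IsKahlerReduction S G μ c EN T) (n : LevelSet μ c)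
    (v : TangentSpace 𝓘(ℝ, EN) n) (ρ : EG) :
    S.metric n (inclDeriv μ c n v) (S.J n (fundamental G (n : M) ρ)) = 0 :=
  (h.exists_inclDeriv_iff n _).1 ⟨v, rfl⟩ ρ

/-- Equality of Λ on `e` and on a fundamental vector means that their difference is orthogonal to
the orbit: ellipticity is exactly the existence of orthogonal projections onto ǧ. -/
lemma exists_fundamental (h : IsKahlerReduction S G μ c EN T) (n : LevelSet μ c)
    (e : TangentSpace 𝓘(ℝ, E) (n : M)) :
    ∃ ρ : EG, ∀ ρ' : EG, S.metric n (e - fundamental G (n : M) ρ) (fundamental G (n : M) ρ') = 0 := by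
  have h1 : S.Lam (EG := EG) G (n : M) e ∈ LinearMap.range (S.Lam (EG := EG) G (n : M)) := ⟨e, rfl⟩
  rw [h.elliptic n] at h1
  obtain ⟨_, ⟨ρ, rfl⟩, hρ⟩ := h1
  refine ⟨ρ, fun ρ' ↦ ?_⟩
  have h2 := DFunLike.congr_fun hρ ρ'
  rw [map_sub, sub_apply, sub_eq_zero]
  exact h2.symm

lemma exists_inclDeriv_eq_fundamental (h : IsKahlerReduction S G μ c EN T) (n : LevelSet μ c)
    (ρ : EG) : ∃ w, WeakKahlerStructure.projDeriv (EN := EN) (EQ := EQ) G μ c n w = 0 ∧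
      inclDeriv (E := E) (EN := EN) μ c n w = fundamental G (n : M) ρ := by
  have hmem : ∀ a : G, μ (a • (n : M)) = c := fun a ↦ by
    rw [h.moment.equivariant, n.2, h.fixed]
  let o : G → LevelSet μ c := fun a ↦ ⟨a • (n : M), hmem a⟩
  have ho1 : o 1 = n := Subtype.ext (one_smul G (n : M))
  have hact : ContMDiff 𝓘(ℝ, EG) 𝓘(ℝ, E) ∞ (fun a : G ↦ a • (n : M)) :=
    contMDiff_id.smul contMDiff_const
  have ho : ContMDiffAt 𝓘(ℝ, EG) 𝓘(ℝ, EN) ∞ o 1 := by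
    -- The orbit stays in the level set because `c` is coadjoint-fixed; smoothness as a map into it
    -- follows from smoothness into `M`, the inclusion being an immersion.
    rw [ContMDiffAt.iff_comp_isImmersionAt (h.immersionAt (o 1))]
    exact ⟨(hact.continuous.subtype_mk hmem).continuousAt, hact.contMDiffAt⟩
  have hod : MDifferentiableAt 𝓘(ℝ, EG) 𝓘(ℝ, EN) o 1 := ho.mdifferentiableAt (by simp)
  have hconst : quotientProj G μ c ∘ o = fun _ ↦ quotientProj G μ c n := by
    funext a
    exact Quotient.sound ⟨a, rfl⟩
  refine ⟨(mfderiv 𝓘(ℝ, EG) 𝓘(ℝ, EN) o 1 : EG →L[ℝ] EN) ρ, ?_, ?_⟩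
  · have h1 := mfderiv_comp_of_eq ((h.contMDiffAt_proj n).mdifferentiableAt (by simp)) hod ho1
    rw [hconst, mfderiv_const] at h1
    have h2 := mfderiv_congr_point (I := 𝓘(ℝ, EN)) (I' := 𝓘(ℝ, EQ)) (f := quotientProj G μ c) ho1
    exact (DFunLike.congr_fun h2 _).symm.trans (DFunLike.congr_fun h1 ρ).symm
  · have h1 := mfderiv_comp_of_eq ((h.contMDiffAt_val n).mdifferentiableAt (by simp)) hod ho1
    have h2 := mfderiv_congr_point (I := 𝓘(ℝ, EN)) (I' := 𝓘(ℝ, E))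
      (f := (Subtype.val : LevelSet μ c → M)) ho1
    exact (DFunLike.congr_fun h2 _).symm.trans (DFunLike.congr_fun h1 ρ).symm

lemma inclDeriv_mem_horizontal (h : IsKahlerReduction S G μ c EN T) {n : LevelSet μ c}
    {v : TangentSpace 𝓘(ℝ, EN) n}
    (hv : ∀ ρ : EG, S.metric n (inclDeriv μ c n v) (fundamental G (n : M) ρ) = 0) :
    inclDeriv μ c n v ∈ S.horizontal (EG := EG) G (n : M) :=
  fun ρ ↦ ⟨hv ρ, h.metric_inclDeriv_J_fundamental n v ρ⟩

/-- After removal of its orthogonal projection to the orbit, a vector killed by the projection is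
horizontal and still projects to zero; by isometry on horizontal vectors it vanishes. Hence the
kernel of the projection is no larger than ǧ. -/
lemma exists_fundamental_eq_inclDeriv (h : IsKahlerReduction S G μ c EN T) (n : LevelSet μ c)
    {w : TangentSpace 𝓘(ℝ, EN) n} (hw : WeakKahlerStructure.projDeriv (EQ := EQ) G μ c n w = 0) :
    ∃ ρ : EG, fundamental G (n : M) ρ = inclDeriv (E := E) μ c n w := by
  obtain ⟨ρ, hρ⟩ := h.exists_fundamental n (inclDeriv μ c n w)
  obtain ⟨w', hw', hi⟩ := h.exists_inclDeriv_eq_fundamental n ρ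
  have hsub : inclDeriv (E := E) μ c n (w - w') =
      inclDeriv μ c n w - fundamental G (n : M) ρ := by rw [map_sub, hi]
  have hhor : inclDeriv (E := E) μ c n (w - w') ∈ S.horizontal (EG := EG) G (n : M) :=
    h.inclDeriv_mem_horizontal fun ρ' ↦ by rw [hsub]; exact hρ ρ'
  have hm := h.quotient.metric n _ _ hhor hhor
  rw [map_sub, hw, hw', sub_zero, map_zero, hsub] at hm
  refine ⟨ρ, ?_⟩
  by_contra hne
  have hpos := S.metric_pos (n : M) _ (sub_ne_zero.2 (Ne.symm hne))
  rw [← hm] at hpos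
  simp at hpos

end IsKahlerReduction

end Reduction

section ChartMap

variable {E : Type*} [NormedAddCommGroup E] [NormedSpace ℝ E] [CompleteSpace E]
  {M : Type*} [TopologicalSpace M] [ChartedSpace E M] [IsManifold 𝓘(ℝ, E) ∞ M]
  {F : Type*} [NormedAddCommGroup F] [NormedSpace ℝ F]
  {N : Type*} [TopologicalSpace N] [ChartedSpace F N]

lemma WeakRiemannianStructure.chartMetric_chartMap (S : WeakRiemannianStructure E M) {f : N → M}
    {m : N} {y : F}
    (h : f ((extChartAt 𝓘(ℝ, F) m).symm y) ∈ (extChartAt 𝓘(ℝ, E) (f m)).source) :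
    S.chartMetric (f m) (chartMap f m y) =
      S.frameMetric (f m) (f ((extChartAt 𝓘(ℝ, F) m).symm y)) := by
  rw [chartMetric, chartMap, (extChartAt 𝓘(ℝ, E) (f m)).left_inv h]

lemma WeakKahlerStructure.chartJ_chartMap (S : WeakKahlerStructure E M) {f : N → M}
    {m : N} {y : F}
    (h : f ((extChartAt 𝓘(ℝ, F) m).symm y) ∈ (extChartAt 𝓘(ℝ, E) (f m)).source) :
    S.chartJ (f m) (chartMap f m y) =
      S.frameJ (f m) (f ((extChartAt 𝓘(ℝ, F) m).symm y)) := by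
  rw [chartJ, chartMap, (extChartAt 𝓘(ℝ, E) (f m)).left_inv h]

end ChartMap

/-! ### Verification that the reduction satisfies the chart axioms. -/

namespace IsKahlerReduction

variable {E : Type*} [NormedAddCommGroup E] [NormedSpace ℝ E] [CompleteSpace E]
  {M : Type*} [TopologicalSpace M] [ChartedSpace E M] [IsManifold 𝓘(ℝ, E) ∞ M]
  {EG : Type*} [NormedAddCommGroup EG] [NormedSpace ℝ EG] [CompleteSpace EG]
  {G : Type*} [TopologicalSpace G] [ChartedSpace EG G] [Group G] [LieGroup 𝓘(ℝ, EG) ∞ G]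
  [MulAction G M] [ContMDiffSMul 𝓘(ℝ, EG) 𝓘(ℝ, E) ∞ G M]
  {S : WeakKahlerStructure E M} {μ : M → (EG →L[ℝ] ℝ)} {c : EG →L[ℝ] ℝ}
  {EN : Type*} [NormedAddCommGroup EN] [NormedSpace ℝ EN]
  [ChartedSpace EN (LevelSet μ c)] [IsManifold 𝓘(ℝ, EN) ∞ (LevelSet μ c)]
  {EQ : Type*} [NormedAddCommGroup EQ] [NormedSpace ℝ EQ] [CompleteSpace EQ]
  [ChartedSpace EQ (KahlerQuotient G μ c)] [IsManifold 𝓘(ℝ, EQ) ∞ (KahlerQuotient G μ c)]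
  {T : WeakRiemannianStructure EQ (KahlerQuotient G μ c)}

lemma eventually_mem_sources (h : IsKahlerReduction S G μ c EN T) (m : LevelSet μ c) :
    ∀ᶠ y in 𝓝 (extChartAt 𝓘(ℝ, EN) m m), ∃ x : LevelSet μ c,
      (extChartAt 𝓘(ℝ, EN) m).symm y = x ∧ extChartAt 𝓘(ℝ, EN) m x = y ∧
      x ∈ (extChartAt 𝓘(ℝ, EN) m).source ∧ (x : M) ∈ (extChartAt 𝓘(ℝ, E) (m : M)).source ∧
      quotientProj G μ c x ∈ (extChartAt 𝓘(ℝ, EQ) (quotientProj G μ c m)).source := by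
  filter_upwards [eventually_mem_source m,
    (tendsto_chart_symm m).eventually ((h.contMDiffAt_val m).continuousAt.eventually
      (extChartAt_source_mem_nhds (I := 𝓘(ℝ, E)) (m : M))),
    (tendsto_chart_symm m).eventually ((h.contMDiffAt_proj m).continuousAt.eventually
      (extChartAt_source_mem_nhds (I := 𝓘(ℝ, EQ)) (quotientProj G μ c m)))] with y h1 h2 h3
  exact ⟨_, rfl, h1.2, h1.1, h2, h3⟩

lemma chartFrame_fderiv_incl (h : IsKahlerReduction S G μ c EN T) {m x : LevelSet μ c}
    (hx : x ∈ (extChartAt 𝓘(ℝ, EN) m).source)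
    (hx' : (x : M) ∈ (extChartAt 𝓘(ℝ, E) (m : M)).source) (u : EN) :
    chartFrame (m : M) (x : M) (fderiv ℝ (chartMap (E := EN) (F := E)
      (Subtype.val : LevelSet μ c → M) m) (extChartAt 𝓘(ℝ, EN) m x) u) =
      inclDeriv μ c x (chartFrame m x u) :=
  chartFrame_fderiv_chartMap hx hx' ((h.contMDiffAt_val x).mdifferentiableAt (by simp)) u

lemma chartFrame_fderiv_proj (h : IsKahlerReduction S G μ c EN T) {m x : LevelSet μ c}
    (hx : x ∈ (extChartAt 𝓘(ℝ, EN) m).source)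
    (hx' : quotientProj G μ c x ∈ (extChartAt 𝓘(ℝ, EQ) (quotientProj G μ c m)).source) (u : EN) :
    chartFrame (quotientProj G μ c m) (quotientProj G μ c x)
      (fderiv ℝ (chartMap (E := EN) (F := EQ) (quotientProj G μ c) m)
        (extChartAt 𝓘(ℝ, EN) m x) u) =
      WeakKahlerStructure.projDeriv (EQ := EQ) G μ c x (chartFrame m x u) :=
  chartFrame_fderiv_chartMap hx hx' ((h.contMDiffAt_proj x).mdifferentiableAt (by simp)) u

lemma fderiv_proj_eq_zero_iff (h : IsKahlerReduction S G μ c EN T) {m x : LevelSet μ c}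
    (hx : x ∈ (extChartAt 𝓘(ℝ, EN) m).source)
    (hx' : quotientProj G μ c x ∈ (extChartAt 𝓘(ℝ, EQ) (quotientProj G μ c m)).source) (u : EN) :
    fderiv ℝ (chartMap (E := EN) (F := EQ) (quotientProj G μ c) m)
      (extChartAt 𝓘(ℝ, EN) m x) u = 0 ↔
      WeakKahlerStructure.projDeriv (EQ := EQ) G μ c x (chartFrame m x u) = 0 := by
  rw [← h.chartFrame_fderiv_proj hx hx']
  constructor
  · intro h0
    rw [h0, map_zero]
  · intro h0
    exact (chartCoord_chartFrame hx' _).symm.trans ((congrArg _ h0).trans (map_zero _))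

lemma fderiv_incl_self (h : IsKahlerReduction S G μ c EN T) (m : LevelSet μ c) (u : EN) :
    fderiv ℝ (chartMap (E := EN) (F := E) (Subtype.val : LevelSet μ c → M) m)
      (extChartAt 𝓘(ℝ, EN) m m) u = inclDeriv (E := E) μ c m u :=
  fderiv_chartMap_self ((h.contMDiffAt_val m).mdifferentiableAt (by simp)) u

lemma fderiv_proj_self (h : IsKahlerReduction S G μ c EN T) (m : LevelSet μ c) (u : EN) :
    fderiv ℝ (chartMap (E := EN) (F := EQ) (quotientProj G μ c) m)
      (extChartAt 𝓘(ℝ, EN) m m) u = WeakKahlerStructure.projDeriv (EQ := EQ) G μ c m u :=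
  fderiv_chartMap_self ((h.contMDiffAt_proj m).mdifferentiableAt (by simp)) u

lemma inclDeriv_injective (h : IsKahlerReduction S G μ c EN T) (m : LevelSet μ c) :
    Function.Injective (inclDeriv (E := E) (EN := EN) μ c m) := by
  obtain ⟨r, hr, hr0, hrev⟩ := (h.immersionAt m).exists_leftInverse
  have h1 := mfderiv_comp m (hr.mdifferentiableAt (by simp))
    ((h.contMDiffAt_val m).mdifferentiableAt (by simp))
  have h2 : mfderiv 𝓘(ℝ, EN) 𝓘(ℝ, EN) (r ∘ (Subtype.val : LevelSet μ c → M)) m =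
      (mfderiv 𝓘(ℝ, EN) 𝓘(ℝ, EN) id m : EN →L[ℝ] EN) := Filter.EventuallyEq.mfderiv_eq hrev
  rw [mfderiv_id] at h2
  have h3 : Function.LeftInverse (mfderiv 𝓘(ℝ, E) 𝓘(ℝ, EN) r (m : M))
      (inclDeriv (E := E) (EN := EN) μ c m) := fun v ↦
    (DFunLike.congr_fun h1 v).symm.trans (DFunLike.congr_fun h2 v)
  exact h3.injective

lemma exists_rightInverse_projDeriv (h : IsKahlerReduction S G μ c EN T) (m : LevelSet μ c) :
    ∃ s : EQ →L[ℝ] EN, ∀ q, WeakKahlerStructure.projDeriv (EQ := EQ) G μ c m (s q) = q := by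
  obtain ⟨r, hr, hr0, hrev⟩ := (h.submersionAt m).exists_rightInverse
  have h1 := mfderiv_comp_of_eq ((h.contMDiffAt_proj m).mdifferentiableAt (by simp))
    (hr.mdifferentiableAt (by simp)) hr0
  have h2 : mfderiv 𝓘(ℝ, EQ) 𝓘(ℝ, EQ) (quotientProj G μ c ∘ r) (quotientProj G μ c m) =
      (mfderiv 𝓘(ℝ, EQ) 𝓘(ℝ, EQ) id (quotientProj G μ c m) : EQ →L[ℝ] EQ) :=
    Filter.EventuallyEq.mfderiv_eq hrev
  rw [mfderiv_id] at h2
  have h3 := mfderiv_congr_point (I := 𝓘(ℝ, EN)) (I' := 𝓘(ℝ, EQ)) (f := quotientProj G μ c) hr0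
  exact ⟨mfderiv 𝓘(ℝ, EQ) 𝓘(ℝ, EN) r (quotientProj G μ c m), fun q ↦
    (DFunLike.congr_fun h3 _).symm.trans
      ((DFunLike.congr_fun h1 q).symm.trans (DFunLike.congr_fun h2 q))⟩

lemma orthogonal_chart (h : IsKahlerReduction S G μ c EN T) (m : LevelSet μ c) :
    ∀ᶠ n in 𝓝 (extChartAt 𝓘(ℝ, EN) m m), ∀ v w,
      fderiv ℝ (chartMap (E := EN) (F := EQ) (quotientProj G μ c) m) n w = 0 →
      S.chartMetric (m : M) (chartMap (Subtype.val : LevelSet μ c → M) m n)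
        (fderiv ℝ (chartMap (Subtype.val : LevelSet μ c → M) m) n v)
        (S.chartJ (m : M) (chartMap (Subtype.val : LevelSet μ c → M) m n)
          (fderiv ℝ (chartMap (Subtype.val : LevelSet μ c → M) m) n w)) = 0 := by
  filter_upwards [h.eventually_mem_sources m]
  rintro _ ⟨x, hxy, rfl, hx, hxM, hxQ⟩ v w hw
  obtain ⟨ρ, hρ⟩ := h.exists_fundamental_eq_inclDeriv x ((h.fderiv_proj_eq_zero_iff hx hxQ w).1 hw)
  have hc := S.chartMetric_chartMap (f := (Subtype.val : LevelSet μ c → M)) (m := m)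
    (y := extChartAt 𝓘(ℝ, EN) m x) (by rwa [hxy])
  have hJ := S.chartJ_chartMap (f := (Subtype.val : LevelSet μ c → M)) (m := m)
    (y := extChartAt 𝓘(ℝ, EN) m x) (by rwa [hxy])
  rw [hxy] at hc hJ
  rw [hc, hJ]
  refine (congrArg₂ (fun a b ↦ S.metric (x : M) a b) (h.chartFrame_fderiv_incl hx hxM v)
    ((S.chartFrame_frameJ hxM _).trans (congrArg _ (h.chartFrame_fderiv_incl hx hxM w)))).trans ?_
  rw [← hρ]
  exact h.metric_inclDeriv_J_fundamental x _ ρ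

lemma mem_horizontal_chart (h : IsKahlerReduction S G μ c EN T) {m x : LevelSet μ c}
    (hx : x ∈ (extChartAt 𝓘(ℝ, EN) m).source)
    (hxM : (x : M) ∈ (extChartAt 𝓘(ℝ, E) (m : M)).source)
    (hxQ : quotientProj G μ c x ∈ (extChartAt 𝓘(ℝ, EQ) (quotientProj G μ c m)).source) {e : E}
    (he : ∀ w, fderiv ℝ (chartMap (E := EN) (F := EQ) (quotientProj G μ c) m)
        (extChartAt 𝓘(ℝ, EN) m x) w = 0 →
      S.frameMetric (m : M) (x : M) e (fderiv ℝ (chartMap (Subtype.val : LevelSet μ c → M) m)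
        (extChartAt 𝓘(ℝ, EN) m x) w) = 0) (ρ : EG) :
    S.metric (x : M) (chartFrame (m : M) (x : M) e) (fundamental G (x : M) ρ) = 0 := by
  obtain ⟨w, hw, hi⟩ := h.exists_inclDeriv_eq_fundamental x ρ
  have hw' := chartFrame_chartCoord (E := EN) hx w
  have h1 := he (chartCoord (E := EN) m x w) ((h.fderiv_proj_eq_zero_iff hx hxQ _).2 (by
    rw [hw', hw]))
  refine (congrArg (S.metric (x : M) (chartFrame (m : M) (x : M) e)) ?_).trans h1
  exact hi.symm.trans ((congrArg (inclDeriv μ c x) hw').symm.trans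
    (h.chartFrame_fderiv_incl hx hxM _).symm)

lemma riemannian_chart (h : IsKahlerReduction S G μ c EN T) (m : LevelSet μ c) :
    ∀ᶠ n in 𝓝 (extChartAt 𝓘(ℝ, EN) m m), ∀ v v',
      (∀ w, fderiv ℝ (chartMap (E := EN) (F := EQ) (quotientProj G μ c) m) n w = 0 →
        S.chartMetric (m : M) (chartMap (Subtype.val : LevelSet μ c → M) m n)
          (fderiv ℝ (chartMap (Subtype.val : LevelSet μ c → M) m) n v)
          (fderiv ℝ (chartMap (Subtype.val : LevelSet μ c → M) m) n w) = 0) →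
      (∀ w, fderiv ℝ (chartMap (E := EN) (F := EQ) (quotientProj G μ c) m) n w = 0 →
        S.chartMetric (m : M) (chartMap (Subtype.val : LevelSet μ c → M) m n)
          (fderiv ℝ (chartMap (Subtype.val : LevelSet μ c → M) m) n v')
          (fderiv ℝ (chartMap (Subtype.val : LevelSet μ c → M) m) n w) = 0) →
      T.chartMetric (quotientProj G μ c m) (chartMap (quotientProj G μ c) m n)
          (fderiv ℝ (chartMap (quotientProj G μ c) m) n v)
          (fderiv ℝ (chartMap (quotientProj G μ c) m) n v') =
        S.chartMetric (m : M) (chartMap (Subtype.val : LevelSet μ c → M) m n)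
          (fderiv ℝ (chartMap (Subtype.val : LevelSet μ c → M) m) n v)
          (fderiv ℝ (chartMap (Subtype.val : LevelSet μ c → M) m) n v') := by
  filter_upwards [h.eventually_mem_sources m]
  rintro _ ⟨x, hxy, rfl, hx, hxM, hxQ⟩ v v' hv hv'
  have hc := S.chartMetric_chartMap (f := (Subtype.val : LevelSet μ c → M)) (m := m)
    (y := extChartAt 𝓘(ℝ, EN) m x) (by rwa [hxy])
  have hcQ := T.chartMetric_chartMap (f := quotientProj G μ c) (m := m)
    (y := extChartAt 𝓘(ℝ, EN) m x) (by rwa [hxy])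
  rw [hxy] at hc hcQ
  rw [hc] at hv hv' ⊢
  rw [hcQ]
  have hh : ∀ v : EN, (∀ w, fderiv ℝ (chartMap (E := EN) (F := EQ) (quotientProj G μ c) m)
        (extChartAt 𝓘(ℝ, EN) m x) w = 0 →
      S.frameMetric (m : M) (x : M) (fderiv ℝ (chartMap (Subtype.val : LevelSet μ c → M) m)
        (extChartAt 𝓘(ℝ, EN) m x) v) (fderiv ℝ (chartMap (Subtype.val : LevelSet μ c → M) m)
        (extChartAt 𝓘(ℝ, EN) m x) w) = 0) →
      inclDeriv μ c x (chartFrame m x v) ∈ S.horizontal (EG := EG) G (x : M) := by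
    intro v hv
    refine h.inclDeriv_mem_horizontal fun ρ ↦ ?_
    rw [← h.chartFrame_fderiv_incl hx hxM]
    exact h.mem_horizontal_chart hx hxM hxQ hv ρ
  have hm := h.quotient.metric x _ _ (hh v hv) (hh v' hv')
  rw [← h.chartFrame_fderiv_incl hx hxM, ← h.chartFrame_fderiv_incl hx hxM,
    ← h.chartFrame_fderiv_proj hx hxQ, ← h.chartFrame_fderiv_proj hx hxQ] at hm
  exact hm

/-- The Kähler quotient in the preferred charts at `m`. -/
def toLocal (h : IsKahlerReduction S G μ c EN T) (m : LevelSet μ c) :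
    LocalKahlerQuotient EN E EQ where
  g := S.chartMetric (m : M)
  J := S.chartJ (m : M)
  gQ := T.chartMetric (quotientProj G μ c m)
  ψ := chartMap (Subtype.val : LevelSet μ c → M) m
  p := chartMap (quotientProj G μ c) m
  n₀ := extChartAt 𝓘(ℝ, EN) m m
  Γ := S.chartChristoffel (m : M)
  ΓQ := T.chartChristoffel (quotientProj G μ c m)
  g_smooth := by rw [chartMap_self]; exact S.contDiffAt_chartMetric _
  J_smooth := by rw [chartMap_self]; exact S.contDiffAt_chartJ _
  gQ_smooth := by rw [chartMap_self]; exact T.contDiffAt_chartMetric _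
  ψ_smooth := contDiffAt_chartMap (h.contMDiffAt_val m)
  p_smooth := contDiffAt_chartMap (h.contMDiffAt_proj m)
  g_symm := by rw [chartMap_self]; exact S.symmNear_chartMetric _
  gQ_symm := by rw [chartMap_self]; exact T.symmNear_chartMetric _
  g_pos := by rw [chartMap_self]; exact S.chartMetric_pos _
  gQ_pos := by rw [chartMap_self]; exact (T.chartMetric_pos _).self_of_nhds
  J_sq := by rw [chartMap_self]; exact S.chartJ_chartJ _
  J_isometry := by rw [chartMap_self]; exact S.chartJ_isometry _
  orthogonal := h.orthogonal_chart m
  riemannian := h.riemannian_chart m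
  injective := fun v w hvw ↦ h.inclDeriv_injective m
    ((h.fderiv_incl_self m v).symm.trans (hvw.trans (h.fderiv_incl_self m w)))
  rightInverse := by
    obtain ⟨s, hs⟩ := h.exists_rightInverse_projDeriv m
    exact ⟨s, fun q ↦ (h.fderiv_proj_self m (s q)).trans (hs q)⟩
  elliptic := by
    intro (e : TangentSpace 𝓘(ℝ, E) (m : M))
    obtain ⟨ρ, hρ⟩ := h.exists_fundamental m e
    obtain ⟨w, hw, hi⟩ := h.exists_inclDeriv_eq_fundamental m ρ
    refine ⟨w, (h.fderiv_proj_self m w).trans hw, fun w' hw' ↦ ?_⟩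
    obtain ⟨ρ', hρ'⟩ := h.exists_fundamental_eq_inclDeriv m
      ((h.fderiv_proj_self m w').symm.trans hw')
    rw [chartMap_self, S.chartMetric_self]
    refine Eq.trans ?_ (hρ ρ')
    have h1 := (h.fderiv_incl_self m w).trans hi
    have h2 := (h.fderiv_incl_self m w').trans hρ'.symm
    exact congrArg₂ (fun a b : TangentSpace 𝓘(ℝ, E) (m : M) ↦ S.metric (m : M) (e - a) b) h1 h2
  tangent := by
    intro e he
    obtain ⟨v, hv⟩ := (h.exists_inclDeriv_iff m e).2 fun ρ ↦ by
      obtain ⟨w, hw, hi⟩ := h.exists_inclDeriv_eq_fundamental m ρ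
      have h1 := he w ((h.fderiv_proj_self m w).trans hw)
      rw [chartMap_self, S.chartMetric_self, S.chartJ_self] at h1
      refine Eq.trans ?_ h1
      have h2 := (h.fderiv_incl_self m w).trans hi
      exact congrArg (fun b : TangentSpace 𝓘(ℝ, E) (m : M) ↦ S.metric (m : M) e (S.J m b)) h2.symm
    exact ⟨v, (h.fderiv_incl_self m v).trans hv⟩
  Γ_spec := by
    intro u v w
    rw [chartMap_self]
    exact S.chartChristoffel_spec _ u v w
  ΓQ_spec := by
    intro u v w
    rw [chartMap_self]
    exact T.chartChristoffel_spec _ u v w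

end IsKahlerReduction

/-! ### The O'Neill tensor in charts -/

namespace IsKahlerReduction

variable {E : Type*} [NormedAddCommGroup E] [NormedSpace ℝ E] [CompleteSpace E]
  {M : Type*} [TopologicalSpace M] [ChartedSpace E M] [IsManifold 𝓘(ℝ, E) ∞ M]
  {EG : Type*} [NormedAddCommGroup EG] [NormedSpace ℝ EG] [CompleteSpace EG]
  {G : Type*} [TopologicalSpace G] [ChartedSpace EG G] [Group G] [LieGroup 𝓘(ℝ, EG) ∞ G]
  [MulAction G M] [ContMDiffSMul 𝓘(ℝ, EG) 𝓘(ℝ, E) ∞ G M]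
  {S : WeakKahlerStructure E M} {μ : M → (EG →L[ℝ] ℝ)} {c : EG →L[ℝ] ℝ}
  {EN : Type*} [NormedAddCommGroup EN] [NormedSpace ℝ EN]
  [ChartedSpace EN (LevelSet μ c)] [IsManifold 𝓘(ℝ, EN) ∞ (LevelSet μ c)]
  {EQ : Type*} [NormedAddCommGroup EQ] [NormedSpace ℝ EQ] [CompleteSpace EQ]
  [ChartedSpace EQ (KahlerQuotient G μ c)] [IsManifold 𝓘(ℝ, EQ) ∞ (KahlerQuotient G μ c)]
  {T : WeakRiemannianStructure EQ (KahlerQuotient G μ c)}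
  (h : IsKahlerReduction S G μ c EN T) (m : LevelSet μ c)

lemma toLocal_ψ : (h.toLocal m).ψ (h.toLocal m).n₀ = extChartAt 𝓘(ℝ, E) (m : M) m :=
  chartMap_self _ _

lemma toLocal_p : (h.toLocal m).p (h.toLocal m).n₀ =
    extChartAt 𝓘(ℝ, EQ) (quotientProj G μ c m) (quotientProj G μ c m) :=
  chartMap_self _ _

lemma toLocal_g (v w : E) :
    (h.toLocal m).g ((h.toLocal m).ψ (h.toLocal m).n₀) v w = S.metric (m : M) v w := by
  rw [toLocal_ψ]
  exact S.chartMetric_self _ v w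

lemma toLocal_J (v : E) :
    (h.toLocal m).J ((h.toLocal m).ψ (h.toLocal m).n₀) v = S.J (m : M) v := by
  rw [toLocal_ψ]
  exact S.chartJ_self _ v

lemma fderiv_toLocal_ψ (u : EN) :
    fderiv ℝ (h.toLocal m).ψ (h.toLocal m).n₀ u = inclDeriv (E := E) μ c m u :=
  h.fderiv_incl_self m u

lemma fderiv_toLocal_p (u : EN) : fderiv ℝ (h.toLocal m).p (h.toLocal m).n₀ u =
    WeakKahlerStructure.projDeriv (EQ := EQ) G μ c m u :=
  h.fderiv_proj_self m u

lemma toLocal_g_fundamental {e : E} (he : ∀ w, fderiv ℝ (h.toLocal m).p (h.toLocal m).n₀ w = 0 →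
      (h.toLocal m).g ((h.toLocal m).ψ (h.toLocal m).n₀) e
        (fderiv ℝ (h.toLocal m).ψ (h.toLocal m).n₀ w) = 0) (ρ : EG) :
    S.metric (m : M) e (fundamental G (m : M) ρ) = 0 := by
  obtain ⟨w, hw, hi⟩ := h.exists_inclDeriv_eq_fundamental m ρ
  have h1 := he w ((h.fderiv_toLocal_p m w).trans hw)
  rw [toLocal_g] at h1
  refine Eq.trans ?_ h1
  exact congrArg (fun b : TangentSpace 𝓘(ℝ, E) (m : M) ↦ S.metric (m : M) e b)
    ((h.fderiv_toLocal_ψ m w).trans hi).symm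

lemma toLocal_g_eq_zero {e : E}
    (he : ∀ ρ : EG, S.metric (m : M) e (fundamental G (m : M) ρ) = 0) {w : EN}
    (hw : fderiv ℝ (h.toLocal m).p (h.toLocal m).n₀ w = 0) :
    (h.toLocal m).g ((h.toLocal m).ψ (h.toLocal m).n₀) e
      (fderiv ℝ (h.toLocal m).ψ (h.toLocal m).n₀ w) = 0 := by
  obtain ⟨ρ, hρ⟩ := h.exists_fundamental_eq_inclDeriv m ((h.fderiv_toLocal_p m w).symm.trans hw)
  rw [toLocal_g]
  refine Eq.trans ?_ (he ρ)
  exact congrArg (fun b : TangentSpace 𝓘(ℝ, E) (m : M) ↦ S.metric (m : M) e b)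
    ((h.fderiv_toLocal_ψ m w).trans hρ.symm)

lemma inclDeriv_mem_horizontal_iff {v : EN} :
    inclDeriv μ c m v ∈ S.horizontal (EG := EG) G (m : M) ↔ (h.toLocal m).Hor v := by
  constructor
  · intro hv w hw
    refine h.toLocal_g_eq_zero m (fun ρ ↦ ?_) hw
    refine Eq.trans ?_ (hv ρ).1
    exact congrArg (fun b : TangentSpace 𝓘(ℝ, E) (m : M) ↦ S.metric (m : M) b _)
      (h.fderiv_toLocal_ψ m v)
  · intro hv
    refine h.inclDeriv_mem_horizontal fun ρ ↦ ?_
    refine Eq.trans ?_ (h.toLocal_g_fundamental m hv ρ)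
    exact congrArg (fun b : TangentSpace 𝓘(ℝ, E) (m : M) ↦ S.metric (m : M) b _)
      (h.fderiv_toLocal_ψ m v).symm

lemma exists_hor_of_mem_horizontal {e : TangentSpace 𝓘(ℝ, E) (m : M)}
    (he : e ∈ S.horizontal (EG := EG) G (m : M)) :
    ∃ v, (h.toLocal m).Hor v ∧ inclDeriv μ c m v = e := by
  obtain ⟨v, hv⟩ := (h.exists_inclDeriv_iff m e).2 fun ρ ↦ (he ρ).2
  exact ⟨v, (h.inclDeriv_mem_horizontal_iff m).1 (hv ▸ he), hv⟩

/-- J is skew for the metric and squares to −1, so it interchanges the two orthogonality conditions.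
-/
lemma _root_.WeakKahlerStructure.J_mem_horizontal {S : WeakKahlerStructure E M} {x : M}
    {e : TangentSpace 𝓘(ℝ, E) x} (he : e ∈ S.horizontal (EG := EG) G x) :
    S.J x e ∈ S.horizontal (EG := EG) G x := by
  intro ρ
  constructor
  · have h1 := S.J_isometry x e (S.J x (fundamental G x ρ))
    rw [S.J_sq, map_neg, (he ρ).2] at h1
    linarith
  · rw [S.J_isometry]
    exact (he ρ).1

/-- In directions tangent to the level set only the restriction of `Y` to it matters, so the
derivative can be taken in the chart of the level set. -/
lemma cov_inclDeriv {Y : Π x : M, TangentSpace 𝓘(ℝ, E) x} (hY : MDiffAt (T% Y) (m : M)) (j : EN) :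
    S.cov Y (m : M) (inclDeriv μ c m j) =
      fderiv ℝ (fun n ↦ chartField (m : M) Y ((h.toLocal m).ψ n)) (h.toLocal m).n₀ j +
        (h.toLocal m).Γ (fderiv ℝ (h.toLocal m).ψ (h.toLocal m).n₀ j) (Y m) := by
  have h1 := S.cov_eq_fderiv_chartField hY (fderiv ℝ (h.toLocal m).ψ (h.toLocal m).n₀ j)
  have h2 : fderiv ℝ (fun n ↦ chartField (m : M) Y ((h.toLocal m).ψ n)) (h.toLocal m).n₀ j =
      fderiv ℝ (chartField (m : M) Y) (extChartAt 𝓘(ℝ, E) (m : M) m)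
        (fderiv ℝ (h.toLocal m).ψ (h.toLocal m).n₀ j) := by
    have hd := differentiableAt_chartField hY
    rw [← h.toLocal_ψ] at hd ⊢
    exact fderiv_comp_apply' hd ((h.toLocal m).ψ_smooth.differentiableAt (by simp)) j
  rw [h2]
  exact (congrArg (S.cov Y (m : M)) (h.fderiv_toLocal_ψ m j).symm).trans h1

/-- The horizontal part of the vector field `∂_k ψ`. -/
def horField (P : EN → E →L[ℝ] E) (k : EN) (n : EN) : E :=
  fderiv ℝ (h.toLocal m).ψ n k - (h.toLocal m).vertPart P n k

variable {P : EN → E →L[ℝ] E} (hP : (h.toLocal m).IsVertProj P)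

include hP

lemma contDiffAt_horField (k : EN) :
    ContDiffAt ℝ ∞ (h.horField m P k) (h.toLocal m).n₀ :=
  ((h.toLocal m).contDiffAt_fderiv_ψ.clm_apply contDiffAt_const).sub
    (hP.contDiffAt_vertPart.clm_apply contDiffAt_const)

/-- For horizontal `k` the left side is the covariant derivative of the horizontal part of `∂_k ψ`;
its vertical component is therefore the tensor `A`. -/
lemma fderiv_horField (j k : EN) :
    fderiv ℝ (h.horField m P k) (h.toLocal m).n₀ j +
      (h.toLocal m).Γ (fderiv ℝ (h.toLocal m).ψ (h.toLocal m).n₀ j)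
        (fderiv ℝ (h.toLocal m).ψ (h.toLocal m).n₀ k) =
      (h.toLocal m).D j k - (h.toLocal m).tau P j k := by
  have h1 : DifferentiableAt ℝ (fun n ↦ fderiv ℝ (h.toLocal m).ψ n k) (h.toLocal m).n₀ :=
    differentiableAt_fderiv_apply (h.toLocal m).ψ_contDiffAt₂ k
  have h2 : fderiv ℝ (h.horField m P k) (h.toLocal m).n₀ j =
      dirDeriv₂ (h.toLocal m).ψ (h.toLocal m).n₀ j k - (h.toLocal m).tau P j k := by
    have := (h1.hasFDerivAt.sub (hP.differentiableAt_vertPart k).hasFDerivAt).fderiv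
    exact DFunLike.congr_fun this j
  rw [h2, LocalKahlerQuotient.D, secondForm]
  abel

lemma horField_self {k : EN} (hk : (h.toLocal m).Hor k) :
    h.horField m P k (h.toLocal m).n₀ = fderiv ℝ (h.toLocal m).ψ (h.toLocal m).n₀ k := by
  rw [horField, hP.vertPart_hor hk, sub_zero]

lemma chartFrame_horField_mem (k : EN) : ∀ᶠ n : LevelSet μ c in 𝓝 m,
    chartFrame (m : M) (n : M) (h.horField m P k (extChartAt 𝓘(ℝ, EN) m n)) ∈
      S.horizontal (EG := EG) G (n : M) := by
  have hcont : Filter.Tendsto (extChartAt 𝓘(ℝ, EN) m) (𝓝 m) (𝓝 (h.toLocal m).n₀) :=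
    continuousAt_extChartAt m
  filter_upwards [hcont.eventually hP.mem, hcont.eventually hP.orthogonal,
    extChartAt_source_mem_nhds (I := 𝓘(ℝ, EN)) m,
    (h.contMDiffAt_val m).continuousAt.eventually
      (extChartAt_source_mem_nhds (I := 𝓘(ℝ, E)) (m : M)),
    (h.contMDiffAt_proj m).continuousAt.eventually
      (extChartAt_source_mem_nhds (I := 𝓘(ℝ, EQ)) (quotientProj G μ c m))]
    with n hm ho hn hnM hnQ
  obtain ⟨w, hw, hPw⟩ := hm (fderiv ℝ (h.toLocal m).ψ (extChartAt 𝓘(ℝ, EN) m n) k)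
  have h1 : h.horField m P k (extChartAt 𝓘(ℝ, EN) m n) =
      fderiv ℝ (h.toLocal m).ψ (extChartAt 𝓘(ℝ, EN) m n) (k - w) := by
    rw [map_sub, ← hPw]
    rfl
  have h2 : chartFrame (m : M) (n : M) (h.horField m P k (extChartAt 𝓘(ℝ, EN) m n)) =
      inclDeriv μ c n (chartFrame m n (k - w)) := by
    rw [h1]
    exact h.chartFrame_fderiv_incl hn hnM (k - w)
  rw [h2]
  refine h.inclDeriv_mem_horizontal fun ρ ↦ ?_
  rw [← h2]
  refine h.mem_horizontal_chart hn hnM hnQ (fun w' hw' ↦ ?_) ρ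
  have hc := S.chartMetric_chartMap (f := (Subtype.val : LevelSet μ c → M)) (m := m)
    (y := extChartAt 𝓘(ℝ, EN) m n) (by rwa [(extChartAt 𝓘(ℝ, EN) m).left_inv hn])
  rw [(extChartAt 𝓘(ℝ, EN) m).left_inv hn] at hc
  rw [← hc]
  exact ho (fderiv ℝ (h.toLocal m).ψ (extChartAt 𝓘(ℝ, EN) m n) k) w' hw'

/-- A horizontal vector extends to a vector field which is horizontal along the level set. -/
lemma exists_horizontal_extension {k : EN} (hk : (h.toLocal m).Hor k) :
    ∃ Y : Π x : M, TangentSpace 𝓘(ℝ, E) x,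
      CMDiffAt ∞ (T% Y) (m : M) ∧ Y m = inclDeriv μ c m k ∧
      (∀ᶠ x in 𝓝 (m : M), μ x = μ m → Y x ∈ S.horizontal (EG := EG) G x) ∧
      ∀ j : EN, S.cov Y (m : M) (inclDeriv μ c m j) =
        (h.toLocal m).D j k - (h.toLocal m).tau P j k := by
  obtain ⟨r, hr, hr0, hrev⟩ := (h.immersionAt m).exists_leftInverse
  -- A local left inverse `r` of the inclusion extends the horizontal field from the level set to a
  -- neighbourhood in `M`.
  let F : M → E := fun x ↦ h.horField m P k (extChartAt 𝓘(ℝ, EN) m (r x))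
  have hFs : ContMDiffAt 𝓘(ℝ, E) 𝓘(ℝ, E) ∞ F (m : M) := by
    have h1 : ContMDiffAt 𝓘(ℝ, E) 𝓘(ℝ, EN) ∞ (fun x ↦ extChartAt 𝓘(ℝ, EN) m (r x)) (m : M) :=
      ContMDiffAt.comp_of_eq contMDiffAt_extChartAt hr hr0
    exact ContMDiffAt.comp_of_eq (h.contDiffAt_horField m hP k).contMDiffAt h1
      (congrArg (extChartAt 𝓘(ℝ, EN) m) hr0)
  have hYs := contMDiffAt_chartFrame (E := E) (mem_extChartAt_source (m : M)) (n := ⊤) hFs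
  have hF0 : F m = fderiv ℝ (h.toLocal m).ψ (h.toLocal m).n₀ k :=
    (congrArg (fun n ↦ h.horField m P k (extChartAt 𝓘(ℝ, EN) m n)) hr0).trans
      (h.horField_self m hP hk)
  have hY0 : chartFrame (E := E) (m : M) (m : M) (F m) =
      fderiv ℝ (h.toLocal m).ψ (h.toLocal m).n₀ k := (chartFrame_self _ _).trans hF0
  refine ⟨fun x ↦ chartFrame (E := E) (m : M) x (F x), hYs,
    hY0.trans (h.fderiv_toLocal_ψ m k), ?_, fun j ↦ ?_⟩
  · have h1 := hrev.and (h.chartFrame_horField_mem m hP k)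
    rw [nhds_subtype_eq_comap, Filter.eventually_comap] at h1
    filter_upwards [h1] with x hx hxμ
    have h2 := hx ⟨x, hxμ.trans m.2⟩ rfl
    have h3 : F x = h.horField m P k (extChartAt 𝓘(ℝ, EN) m ⟨x, hxμ.trans m.2⟩) :=
      congrArg (fun n ↦ h.horField m P k (extChartAt 𝓘(ℝ, EN) m n)) h2.1
    rw [h3]
    exact h2.2
  · refine (h.cov_inclDeriv m (hYs.mdifferentiableAt (by simp)) j).trans
      (Eq.trans ?_ (h.fderiv_horField m hP j k))
    congr 1
    · congr 1
      refine Filter.EventuallyEq.fderiv_eq ?_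
      filter_upwards [h.eventually_mem_sources m, (tendsto_chart_symm m).eventually hrev]
      rintro _ ⟨x, hxy, rfl, hx, hxM, hxQ⟩ hrx
      rw [hxy] at hrx
      have h4 : (h.toLocal m).ψ (extChartAt 𝓘(ℝ, EN) m x) = extChartAt 𝓘(ℝ, E) (m : M) x := by
        change extChartAt 𝓘(ℝ, E) (m : M) ((extChartAt 𝓘(ℝ, EN) m).symm
          (extChartAt 𝓘(ℝ, EN) m x)) = _
        rw [hxy]
      rw [h4, chartField, (extChartAt 𝓘(ℝ, E) (m : M)).left_inv hxM]
      refine (chartCoord_chartFrame hxM (F x)).trans ?_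
      exact congrArg (fun n ↦ h.horField m P k (extChartAt 𝓘(ℝ, EN) m n)) hrx
    · exact congrArg _ hY0

/-- The vertical part of the covariant derivative of a horizontal field only depends on the value
of the field. -/
lemma metric_cov_sub_eq_zero {j k : EN} (hk : (h.toLocal m).Hor k)
    {Y : Π x : M, TangentSpace 𝓘(ℝ, E) x} (hY : MDiffAt (T% Y) (m : M))
    (hY0 : Y m = inclDeriv μ c m k)
    (hh : ∀ᶠ x in 𝓝 (m : M), μ x = μ m → Y x ∈ S.horizontal (EG := EG) G x) {e : E}
    (he : S.cov Y (m : M) (inclDeriv μ c m j) = e) {w : EN}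
    (hw : fderiv ℝ (h.toLocal m).p (h.toLocal m).n₀ w = 0) :
    (h.toLocal m).g ((h.toLocal m).ψ (h.toLocal m).n₀)
      (e - ((h.toLocal m).D j k - (h.toLocal m).tau P j k))
      (fderiv ℝ (h.toLocal m).ψ (h.toLocal m).n₀ w) = 0 := by
  let y : EN → E := fun n ↦ chartField (m : M) Y ((h.toLocal m).ψ n)
  have hy : DifferentiableAt ℝ y (h.toLocal m).n₀ := by
    have hd := differentiableAt_chartField hY
    rw [← h.toLocal_ψ] at hd
    exact DifferentiableAt.comp (g := chartField (m : M) Y) _ hd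
      ((h.toLocal m).ψ_smooth.differentiableAt (by simp))
  have hy0 : y (h.toLocal m).n₀ = fderiv ℝ (h.toLocal m).ψ (h.toLocal m).n₀ k := by
    change chartField (m : M) Y ((h.toLocal m).ψ (h.toLocal m).n₀) = _
    rw [toLocal_ψ]
    exact (chartField_self _ _).trans (hY0.trans (h.fderiv_toLocal_ψ m k).symm)
  have hf := (h.contDiffAt_horField m hP k).differentiableAt (by simp)
  -- Along the level set the difference of `Y` and the model field is horizontal, and it vanishes at
  -- the base point; the Christoffel terms of the two agree.
  have hzero := hP.g_fderiv_eq_zero (Y := y - h.horField m P k) (hy.sub hf)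
    (by rw [Pi.sub_apply, hy0, h.horField_self m hP hk, sub_self]) (by
      filter_upwards [h.eventually_mem_sources m, hP.orthogonal,
        (tendsto_chart_symm m).eventually ((h.contMDiffAt_val m).continuousAt.eventually hh)]
      rintro _ ⟨x, hxy, rfl, hx, hxM, hxQ⟩ ho hhx w hw
      rw [Pi.sub_apply, map_sub, sub_apply]
      have h1 : (h.toLocal m).g ((h.toLocal m).ψ (extChartAt 𝓘(ℝ, EN) m x))
          (h.horField m P k (extChartAt 𝓘(ℝ, EN) m x))
          (fderiv ℝ (h.toLocal m).ψ (extChartAt 𝓘(ℝ, EN) m x) w) = 0 := ho _ w hw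
      rw [h1, sub_zero]
      rw [hxy] at hhx
      obtain ⟨ρ, hρ⟩ := h.exists_fundamental_eq_inclDeriv x
        ((h.fderiv_proj_eq_zero_iff hx hxQ w).1 hw)
      have hc := S.chartMetric_chartMap (f := (Subtype.val : LevelSet μ c → M)) (m := m)
        (y := extChartAt 𝓘(ℝ, EN) m x) (by rwa [hxy])
      rw [hxy] at hc
      have h4 : (h.toLocal m).ψ (extChartAt 𝓘(ℝ, EN) m x) = extChartAt 𝓘(ℝ, E) (m : M) x := by
        change extChartAt 𝓘(ℝ, E) (m : M) ((extChartAt 𝓘(ℝ, EN) m).symm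
          (extChartAt 𝓘(ℝ, EN) m x)) = _
        rw [hxy]
      have h5 : y (extChartAt 𝓘(ℝ, EN) m x) = chartCoord (E := E) (m : M) (x : M) (Y x) := by
        change chartField (m : M) Y ((h.toLocal m).ψ (extChartAt 𝓘(ℝ, EN) m x)) = _
        rw [h4, chartField, (extChartAt 𝓘(ℝ, E) (m : M)).left_inv hxM]
      rw [h5]
      refine (congrArg (fun G : E →L[ℝ] E →L[ℝ] ℝ ↦ G _ _) hc).trans ?_
      refine (congrArg₂ (fun a b ↦ S.metric (x : M) a b) (chartFrame_chartCoord hxM (Y x))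
        ((h.chartFrame_fderiv_incl hx hxM w).trans hρ.symm)).trans ?_
      exact (hhx (x.2.trans m.2.symm) ρ).1) j hw
  refine Eq.trans ?_ hzero
  congr 2
  have h6 : fderiv ℝ (y - h.horField m P k) (h.toLocal m).n₀ j =
      fderiv ℝ y (h.toLocal m).n₀ j - fderiv ℝ (h.horField m P k) (h.toLocal m).n₀ j := by
    rw [fderiv_sub hy hf, sub_apply]
  have h7 : e = fderiv ℝ y (h.toLocal m).n₀ j +
      (h.toLocal m).Γ (fderiv ℝ (h.toLocal m).ψ (h.toLocal m).n₀ j)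
        (fderiv ℝ (h.toLocal m).ψ (h.toLocal m).n₀ k) := by
    refine he.symm.trans ((h.cov_inclDeriv m hY j).trans ?_)
    congr 1
    refine congrArg _ ?_
    exact hY0.trans (h.fderiv_toLocal_ψ m k).symm
  rw [h6, h7, ← h.fderiv_horField m hP]
  exact add_sub_add_right_eq_sub _ _ _

end IsKahlerReduction

/-! ### Norm estimates for the symmetric form B. -/

namespace LocalKahlerQuotient

variable {X E Q : Type*} [NormedAddCommGroup X] [NormedSpace ℝ X]
    [NormedAddCommGroup E] [NormedSpace ℝ E] [NormedAddCommGroup Q] [NormedSpace ℝ Q]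
    (L : LocalKahlerQuotient X E Q)

lemma g_nonneg (v : E) : 0 ≤ L.g (L.ψ L.n₀) v v := by
  by_cases hv : v = 0
  · simp [hv]
  · exact (L.g_pos.self_of_nhds v hv).le

lemma g_sq_le (v w : E) : L.g (L.ψ L.n₀) v w ^ 2 ≤
    L.g (L.ψ L.n₀) v v * L.g (L.ψ L.n₀) w w := by
  rcases (L.g_nonneg w).eq_or_lt with h | h
  · rw [L.eq_zero_of_metric_self h.symm]
    simp
  · have h1 := L.g_nonneg (L.g (L.ψ L.n₀) w w • v - L.g (L.ψ L.n₀) v w • w)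
    simp only [map_sub, map_smul, sub_apply, smul_apply, smul_eq_mul, L.g_comm w v] at h1
    refine le_of_mul_le_mul_left ?_ h
    linarith

variable {L}

lemma Hor.add {v w : X} (hv : L.Hor v) (hw : L.Hor w) : L.Hor (v + w) := fun u hu ↦ by
  rw [map_add, map_add, add_apply, hv u hu, hw u hu, add_zero]

lemma Hor.smul {v : X} (r : ℝ) (hv : L.Hor v) : L.Hor (r • v) := fun u hu ↦ by
  rw [map_smul, map_smul, smul_apply, hv u hu, smul_zero]

lemma Hor.neg {v : X} (hv : L.Hor v) : L.Hor (-v) := by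
  simpa using hv.smul (-1)

lemma Hor.sub {v w : X} (hv : L.Hor v) (hw : L.Hor w) : L.Hor (v - w) := by
  rw [sub_eq_add_neg]
  exact hv.add hw.neg

variable (L)

lemma B_smul_right (P : X → E →L[ℝ] E) (r : ℝ) (j k : X) : L.B P j (r • k) = r • L.B P j k := by
  rw [L.B_comm, L.B_smul_left, L.B_comm]

lemma B_add_right (P : X → E →L[ℝ] E) (i j k : X) : L.B P i (j + k) = L.B P i j + L.B P i k := by
  rw [L.B_comm, L.B_add_left, L.B_comm, L.B_comm P k]

lemma exists_unit {v : X} (hv : v ≠ 0) : ∃ r : ℝ, 0 < r ∧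
    L.g (L.ψ L.n₀) (fderiv ℝ L.ψ L.n₀ v) (fderiv ℝ L.ψ L.n₀ v) = r ^ 2 ∧
    L.g (L.ψ L.n₀) (fderiv ℝ L.ψ L.n₀ (r⁻¹ • v)) (fderiv ℝ L.ψ L.n₀ (r⁻¹ • v)) = 1 := by
  have h0 : fderiv ℝ L.ψ L.n₀ v ≠ 0 := fun h ↦ hv (L.injective (by rw [h, map_zero]))
  have h := L.g_pos.self_of_nhds _ h0
  have hs := Real.sqrt_pos.2 h
  refine ⟨_, hs, (Real.sq_sqrt h.le).symm, ?_⟩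
  simp only [map_smul, smul_apply, smul_eq_mul]
  rw [← mul_assoc, ← mul_inv, Real.mul_self_sqrt h.le, inv_mul_cancel₀ h.ne']

lemma g_B_le_of_unit {P : X → E →L[ℝ] E} {C : ℝ}
    (hC : ∀ v, L.Hor v → L.g (L.ψ L.n₀) (fderiv ℝ L.ψ L.n₀ v) (fderiv ℝ L.ψ L.n₀ v) = 1 →
      L.g (L.ψ L.n₀) (L.B P v v) (L.B P v v) ≤ C) {v : X} (hv : L.Hor v) :
    L.g (L.ψ L.n₀) (L.B P v v) (L.B P v v) ≤
      C * L.g (L.ψ L.n₀) (fderiv ℝ L.ψ L.n₀ v) (fderiv ℝ L.ψ L.n₀ v) ^ 2 := by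
  by_cases h0 : v = 0
  · have : L.B P v v = 0 := by
      rw [h0]
      simpa using L.B_smul_left P 0 0 0
    rw [this, h0]
    simp
  · obtain ⟨r, hr, hr2, h1⟩ := L.exists_unit h0
    have h2 := hC _ (hv.smul r⁻¹) h1
    rw [L.B_smul_left, L.B_smul_right] at h2
    simp only [map_smul, smul_apply, smul_eq_mul] at h2
    rw [hr2]
    have h3 : L.g (L.ψ L.n₀) (L.B P v v) (L.B P v v) =
        (r⁻¹ * (r⁻¹ * (r⁻¹ * (r⁻¹ * L.g (L.ψ L.n₀) (L.B P v v) (L.B P v v))))) * (r ^ 2) ^ 2 := by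
      field_simp
    rw [h3]
    exact mul_le_mul_of_nonneg_right h2 (by positivity)

/-- Polarization: 4 B(v,w) = B(v+w,v+w) − B(v−w,v−w). With s, t the squared lengths of v ± w, the
right side has squared length at most C(s+t)², and s + t = 4 by the parallelogram law, so no
constant is lost. -/
lemma g_B_le {P : X → E →L[ℝ] E} {C : ℝ} (hC0 : 0 ≤ C)
    (hC : ∀ v, L.Hor v → L.g (L.ψ L.n₀) (fderiv ℝ L.ψ L.n₀ v) (fderiv ℝ L.ψ L.n₀ v) = 1 →
      L.g (L.ψ L.n₀) (L.B P v v) (L.B P v v) ≤ C) {v w : X} (hv : L.Hor v) (hw : L.Hor w)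
    (hv1 : L.g (L.ψ L.n₀) (fderiv ℝ L.ψ L.n₀ v) (fderiv ℝ L.ψ L.n₀ v) = 1)
    (hw1 : L.g (L.ψ L.n₀) (fderiv ℝ L.ψ L.n₀ w) (fderiv ℝ L.ψ L.n₀ w) = 1) :
    L.g (L.ψ L.n₀) (L.B P v w) (L.B P v w) ≤ C := by
  have h1 := L.g_B_le_of_unit hC (hv.add hw)
  have h2 := L.g_B_le_of_unit hC (hv.sub hw)
  have h3 := L.g_sq_le (L.B P (v + w) (v + w)) (L.B P (v - w) (v - w))
  set s := L.g (L.ψ L.n₀) (fderiv ℝ L.ψ L.n₀ (v + w)) (fderiv ℝ L.ψ L.n₀ (v + w)) with hs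
  set t := L.g (L.ψ L.n₀) (fderiv ℝ L.ψ L.n₀ (v - w)) (fderiv ℝ L.ψ L.n₀ (v - w)) with ht
  have hs0 : 0 ≤ s := L.g_nonneg _
  have ht0 : 0 ≤ t := L.g_nonneg _
  have hst : s + t = 4 := by
    rw [hs, ht]
    simp only [map_add, map_sub, add_apply, sub_apply, hv1, hw1]
    ring
  have hB : L.B P (v + w) (v + w) - L.B P (v - w) (v - w) = (4 : ℝ) • L.B P v w := by
    have hneg : v - w = v + (-1 : ℝ) • w := by module
    rw [hneg]
    simp only [L.B_add_left, L.B_add_right, L.B_smul_left, L.B_smul_right]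
    rw [L.B_comm P w v]
    module
  have h4 : 16 * L.g (L.ψ L.n₀) (L.B P v w) (L.B P v w) =
      L.g (L.ψ L.n₀) (L.B P (v + w) (v + w)) (L.B P (v + w) (v + w))
        - 2 * L.g (L.ψ L.n₀) (L.B P (v + w) (v + w)) (L.B P (v - w) (v - w))
        + L.g (L.ψ L.n₀) (L.B P (v - w) (v - w)) (L.B P (v - w) (v - w)) := by
    have := congrArg (fun e ↦ L.g (L.ψ L.n₀) e e) hB
    simp only [map_sub, map_smul, sub_apply, smul_apply, smul_eq_mul,
      L.g_comm (L.B P (v - w) (v - w)) (L.B P (v + w) (v + w))] at this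
    linarith
  have h5 : |L.g (L.ψ L.n₀) (L.B P (v + w) (v + w)) (L.B P (v - w) (v - w))| ≤ C * (s * t) := by
    refine abs_le_of_sq_le_sq (h3.trans ?_) (by positivity)
    calc _ ≤ (C * s ^ 2) * (C * t ^ 2) := mul_le_mul h1 h2 (L.g_nonneg _) (by positivity)
      _ = (C * (s * t)) ^ 2 := by ring
  have h6 := neg_le_of_abs_le h5
  have h7 : C * (s + t) ^ 2 = 16 * C := by rw [hst]; ring
  nlinarith

end LocalKahlerQuotient

/-! ### Identification of the geometric O'Neill tensor with A, and the Kähler identity. -/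

namespace IsKahlerReduction

variable {E : Type*} [NormedAddCommGroup E] [NormedSpace ℝ E] [CompleteSpace E]
  {M : Type*} [TopologicalSpace M] [ChartedSpace E M] [IsManifold 𝓘(ℝ, E) ∞ M]
  {EG : Type*} [NormedAddCommGroup EG] [NormedSpace ℝ EG] [CompleteSpace EG]
  {G : Type*} [TopologicalSpace G] [ChartedSpace EG G] [Group G] [LieGroup 𝓘(ℝ, EG) ∞ G]
  [MulAction G M] [ContMDiffSMul 𝓘(ℝ, EG) 𝓘(ℝ, E) ∞ G M]
  {S : WeakKahlerStructure E M} {μ : M → (EG →L[ℝ] ℝ)} {c : EG →L[ℝ] ℝ}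
  {EN : Type*} [NormedAddCommGroup EN] [NormedSpace ℝ EN]
  [ChartedSpace EN (LevelSet μ c)] [IsManifold 𝓘(ℝ, EN) ∞ (LevelSet μ c)]
  {EQ : Type*} [NormedAddCommGroup EQ] [NormedSpace ℝ EQ] [CompleteSpace EQ]
  [ChartedSpace EQ (KahlerQuotient G μ c)] [IsManifold 𝓘(ℝ, EQ) ∞ (KahlerQuotient G μ c)]
  {T : WeakRiemannianStructure EQ (KahlerQuotient G μ c)}
  (h : IsKahlerReduction S G μ c EN T) (m : LevelSet μ c)
  {P : EN → E →L[ℝ] E} (hP : (h.toLocal m).IsVertProj P)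

include hP

lemma apply_A (j : EN) {k : EN} (hk : (h.toLocal m).Hor k) :
    P (h.toLocal m).n₀ ((h.toLocal m).A P j k) = (h.toLocal m).A P j k := by
  rw [LocalKahlerQuotient.A, map_sub, hP.apply_apply, hP.apply_tau j hk]

lemma apply_eq_of_g {e e' : E}
    (he : ∀ w, fderiv ℝ (h.toLocal m).p (h.toLocal m).n₀ w = 0 →
      (h.toLocal m).g ((h.toLocal m).ψ (h.toLocal m).n₀) (e - e')
        (fderiv ℝ (h.toLocal m).ψ (h.toLocal m).n₀ w) = 0) :
    P (h.toLocal m).n₀ e = P (h.toLocal m).n₀ e' := by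
  rw [← sub_eq_zero, ← map_sub, hP.apply_eq (w := 0) (map_zero _) (by simpa using he), map_zero]

lemma apply_cov {j k : EN} (hk : (h.toLocal m).Hor k)
    {Y : Π x : M, TangentSpace 𝓘(ℝ, E) x} (hY : MDiffAt (T% Y) (m : M))
    (hY0 : Y m = inclDeriv μ c m k)
    (hh : ∀ᶠ x in 𝓝 (m : M), μ x = μ m → Y x ∈ S.horizontal (EG := EG) G x) {e : E}
    (he : S.cov Y (m : M) (inclDeriv μ c m j) = e) :
    P (h.toLocal m).n₀ e = (h.toLocal m).A P j k := by
  rw [h.apply_eq_of_g m hP fun w hw ↦ h.metric_cov_sub_eq_zero m hP hk hY hY0 hh he hw, map_sub,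
    hP.apply_tau j hk]
  rfl

/-- The O'Neill tensor is the vertical part of the covariant derivative. -/
lemma isONeill_A {j k : EN} (hj : (h.toLocal m).Hor j) (hk : (h.toLocal m).Hor k) :
    S.IsONeill G μ (m : M) (inclDeriv μ c m j) (inclDeriv μ c m k) ((h.toLocal m).A P j k) := by
  obtain ⟨Y, hY, hY0, hh, hcov⟩ := h.exists_horizontal_extension m hP hk
  refine ⟨(h.inclDeriv_mem_horizontal_iff m).2 hj, (h.inclDeriv_mem_horizontal_iff m).2 hk, ?_,
    Y, hY, hY0, hh, ?_⟩
  · obtain ⟨w, hw, hPw⟩ := hP.mem.self_of_nhds ((h.toLocal m).A P j k)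
    rw [h.apply_A m hP j hk] at hPw
    obtain ⟨ρ, hρ⟩ := h.exists_fundamental_eq_inclDeriv m ((h.fderiv_toLocal_p m w).symm.trans hw)
    exact ⟨ρ, hρ.trans ((h.fderiv_toLocal_ψ m w).symm.trans hPw.symm)⟩
  · rintro _ ⟨ρ, rfl⟩
    have h1 := h.toLocal_g_fundamental m (e := (h.toLocal m).D j k - P (h.toLocal m).n₀
      ((h.toLocal m).D j k)) (hP.orthogonal.self_of_nhds _) ρ
    refine Eq.trans ?_ h1
    have h2 : (h.toLocal m).D j k - (h.toLocal m).tau P j k - (h.toLocal m).A P j k =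
        (h.toLocal m).D j k - P (h.toLocal m).n₀ ((h.toLocal m).D j k) := by
      rw [LocalKahlerQuotient.A]
      abel
    refine (congrArg (fun e : TangentSpace 𝓘(ℝ, E) (m : M) ↦
      S.metric (m : M) (HSub.hSub (β := TangentSpace 𝓘(ℝ, E) (m : M)) e
        ((h.toLocal m).A P j k)) _) (hcov j)).trans ?_
    exact congrArg (fun e : TangentSpace 𝓘(ℝ, E) (m : M) ↦ S.metric (m : M) e _) h2

lemma eq_A_of_isONeill {j k : EN} (hk : (h.toLocal m).Hor k)
    {Z : TangentSpace 𝓘(ℝ, E) (m : M)}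
    (hZ : S.IsONeill G μ (m : M) (inclDeriv μ c m j) (inclDeriv μ c m k) Z) :
    Z = (h.toLocal m).A P j k := by
  obtain ⟨-, -, ⟨ρ, hρ⟩, Y, hY, hY0, hh, hcov⟩ := hZ
  obtain ⟨e, he⟩ : ∃ e : E, S.cov Y (m : M) (inclDeriv μ c m j) = e := ⟨_, rfl⟩
  have h1 := h.apply_cov m hP hk (hY.mdifferentiableAt (by simp)) hY0 hh he
  have h2 : P (h.toLocal m).n₀ e = P (h.toLocal m).n₀ Z :=
    h.apply_eq_of_g m hP fun w hw ↦ h.toLocal_g_eq_zero m (fun ρ' ↦ by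
      refine Eq.trans ?_ (hcov _ ⟨ρ', rfl⟩)
      exact congrArg (fun a : TangentSpace 𝓘(ℝ, E) (m : M) ↦ S.metric (m : M) (a - Z) _) he.symm) hw
  obtain ⟨w, hw, hi⟩ := h.exists_inclDeriv_eq_fundamental m ρ
  have h3 : fderiv ℝ (h.toLocal m).ψ (h.toLocal m).n₀ w = Z :=
    (h.fderiv_toLocal_ψ m w).trans (hi.trans hρ)
  rw [← h3, hP.apply_vert ((h.fderiv_toLocal_p m w).trans hw)] at h2
  rw [← h3, ← h2, h1]

/-- If Y is a horizontal extension of the vector `k`, then J Y is one of `k'`, with covariant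
derivative J(D − τ). The term τ is vertical, so P J annihilates it and P J D = `B` is left. -/
lemma A_J {j k k' : EN} (hk : (h.toLocal m).Hor k) (hk' : (h.toLocal m).Hor k')
    (hJ : inclDeriv μ c m k' = S.J (m : M) (inclDeriv μ c m k)) :
    (h.toLocal m).A P j k' = (h.toLocal m).B P j k := by
  obtain ⟨Y, hY, hY0, hh, hcov⟩ := h.exists_horizontal_extension m hP hk
  have hJY : CMDiffAt ∞ (T% (fun x ↦ S.J x (Y x))) (m : M) :=
    ContMDiffAt.clm_bundle_apply S.J_smooth.contMDiffAt hY
  have he : S.cov (fun x ↦ S.J x (Y x)) (m : M) (inclDeriv μ c m j) =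
      (h.toLocal m).J ((h.toLocal m).ψ (h.toLocal m).n₀)
        ((h.toLocal m).D j k - (h.toLocal m).tau P j k) := by
    rw [S.J_parallel _ _ _ (hY.mdifferentiableAt (by simp)), hcov j]
    exact (h.toLocal_J m _).symm
  rw [← h.apply_cov m hP hk' (hJY.mdifferentiableAt (by simp))
    ((congrArg (S.J (m : M)) hY0).trans hJ.symm) (by
      filter_upwards [hh] with x hx hxμ using WeakKahlerStructure.J_mem_horizontal (hx hxμ)) he,
    map_sub, map_sub, ← hP.apply_tau j hk, hP.apply_J_apply, sub_zero]
  rfl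

end IsKahlerReduction

/-! ### Curvature of the quotient -/

namespace IsKahlerReduction

variable {E : Type*} [NormedAddCommGroup E] [NormedSpace ℝ E] [CompleteSpace E]
  {M : Type*} [TopologicalSpace M] [ChartedSpace E M] [IsManifold 𝓘(ℝ, E) ∞ M]
  {EG : Type*} [NormedAddCommGroup EG] [NormedSpace ℝ EG] [CompleteSpace EG]
  {G : Type*} [TopologicalSpace G] [ChartedSpace EG G] [Group G] [LieGroup 𝓘(ℝ, EG) ∞ G]
  [MulAction G M] [ContMDiffSMul 𝓘(ℝ, EG) 𝓘(ℝ, E) ∞ G M]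
  {S : WeakKahlerStructure E M} {μ : M → (EG →L[ℝ] ℝ)} {c : EG →L[ℝ] ℝ}
  {EN : Type*} [NormedAddCommGroup EN] [NormedSpace ℝ EN]
  [ChartedSpace EN (LevelSet μ c)] [IsManifold 𝓘(ℝ, EN) ∞ (LevelSet μ c)]
  {EQ : Type*} [NormedAddCommGroup EQ] [NormedSpace ℝ EQ] [CompleteSpace EQ]
  [ChartedSpace EQ (KahlerQuotient G μ c)] [IsManifold 𝓘(ℝ, EQ) ∞ (KahlerQuotient G μ c)]
  {T : WeakRiemannianStructure EQ (KahlerQuotient G μ c)}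
  (h : IsKahlerReduction S G μ c EN T) (m : LevelSet μ c)

lemma toLocal_g_fderiv (v w : EN) :
    (h.toLocal m).g ((h.toLocal m).ψ (h.toLocal m).n₀)
        (fderiv ℝ (h.toLocal m).ψ (h.toLocal m).n₀ v)
        (fderiv ℝ (h.toLocal m).ψ (h.toLocal m).n₀ w) =
      S.metric (m : M) (inclDeriv μ c m v) (inclDeriv μ c m w) := by
  rw [toLocal_g]
  exact congrArg₂ (fun a b : TangentSpace 𝓘(ℝ, E) (m : M) ↦ S.metric (m : M) a b)
    (h.fderiv_toLocal_ψ m v) (h.fderiv_toLocal_ψ m w)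

lemma metric_projDeriv {v w : EN} (hv : (h.toLocal m).Hor v) (hw : (h.toLocal m).Hor w) :
    T.metric (quotientProj G μ c m) (WeakKahlerStructure.projDeriv (EQ := EQ) G μ c m v)
        (WeakKahlerStructure.projDeriv (EQ := EQ) G μ c m w) =
      S.metric (m : M) (inclDeriv μ c m v) (inclDeriv μ c m w) :=
  h.quotient.metric m v w ((h.inclDeriv_mem_horizontal_iff m).2 hv)
    ((h.inclDeriv_mem_horizontal_iff m).2 hw)

lemma exists_hor_projDeriv (q : TangentSpace 𝓘(ℝ, EQ) (quotientProj G μ c m)) :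
    ∃ v, (h.toLocal m).Hor v ∧ WeakKahlerStructure.projDeriv (EQ := EQ) G μ c m v = q := by
  obtain ⟨v, hv, hq⟩ := (h.toLocal m).exists_hor q
  exact ⟨v, hv, (h.fderiv_toLocal_p m v).symm.trans hq⟩

lemma exists_hor_J {k : EN} (hk : (h.toLocal m).Hor k) :
    ∃ k', (h.toLocal m).Hor k' ∧ inclDeriv μ c m k' = S.J (m : M) (inclDeriv μ c m k) :=
  h.exists_hor_of_mem_horizontal m
    (WeakKahlerStructure.J_mem_horizontal ((h.inclDeriv_mem_horizontal_iff m).2 hk))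

/-- The projection is isometric, hence injective, on horizontal vectors; a horizontal vector
projecting into the plane is the same combination of the lifts as its image is of the basis. -/
lemma horizontalLift_span {i j : EN} (hi : (h.toLocal m).Hor i) (hj : (h.toLocal m).Hor j) :
    S.horizontalLift G μ c EN m (Submodule.span ℝ
        {WeakKahlerStructure.projDeriv (EQ := EQ) G μ c m i,
          WeakKahlerStructure.projDeriv (EQ := EQ) G μ c m j}) =
      Submodule.span ℝ {inclDeriv μ c m i, inclDeriv μ c m j} := by
  apply le_antisymm
  · rintro _ ⟨⟨(v : EN), hv, rfl⟩, hv'⟩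
    obtain ⟨a, b, hab⟩ := Submodule.mem_span_pair.1 (show _ ∈ Submodule.span ℝ _ from hv)
    have hvh : (h.toLocal m).Hor v := (h.inclDeriv_mem_horizontal_iff m).1 hv'
    have hw : (h.toLocal m).Hor (v - (a • i + b • j)) :=
      hvh.sub ((hi.smul a).add (hj.smul b))
    have h0 : WeakKahlerStructure.projDeriv (EN := EN) (EQ := EQ) G μ c m
        (v - (a • i + b • j)) = 0 :=
      ((WeakKahlerStructure.projDeriv (EN := EN) (EQ := EQ) G μ c m).map_sub _ _).trans
        (sub_eq_zero.2 (hab.symm.trans (by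
          exact (((WeakKahlerStructure.projDeriv (EN := EN) (EQ := EQ) G μ c m).map_add _ _).trans
            (congrArg₂ _ ((WeakKahlerStructure.projDeriv (EQ := EQ) G μ c m).map_smul _ _)
              ((WeakKahlerStructure.projDeriv (EQ := EQ) G μ c m).map_smul _ _))).symm)))
    have h1 := h.metric_projDeriv m hw hw
    rw [h0, map_zero] at h1
    have h2 : inclDeriv (E := E) μ c m (v - (a • i + b • j)) = 0 := by
      by_contra hne
      exact (S.metric_pos _ _ hne).ne h1
    refine Submodule.mem_span_pair.2 ⟨a, b, ?_⟩
    have h3 : inclDeriv (E := E) μ c m v - inclDeriv (E := E) μ c m (a • i + b • j) = 0 :=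
      ((inclDeriv (E := E) (EN := EN) μ c m).map_sub _ _).symm.trans h2
    refine Eq.trans ?_ (sub_eq_zero.1 h3).symm
    exact (((inclDeriv (E := E) (EN := EN) μ c m).map_add _ _).trans
      (congrArg₂ _ ((inclDeriv μ c m).map_smul _ _) ((inclDeriv μ c m).map_smul _ _))).symm
  · rw [Submodule.span_le]
    rintro _ (rfl | rfl)
    · exact ⟨⟨i, Submodule.subset_span (.inl rfl), rfl⟩, (h.inclDeriv_mem_horizontal_iff m).2 hi⟩
    · exact ⟨⟨j, Submodule.subset_span (.inr rfl), rfl⟩, (h.inclDeriv_mem_horizontal_iff m).2 hj⟩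

variable {P : EN → E →L[ℝ] E} (hP : (h.toLocal m).IsVertProj P)

include hP

lemma sectionalCurvature_sub {i j : EN} (hi : (h.toLocal m).Hor i) (hj : (h.toLocal m).Hor j)
    {Pl : Submodule ℝ (TangentSpace 𝓘(ℝ, EQ) (quotientProj G μ c m))}
    (hb : T.IsOrthonormalBasisOf Pl (WeakKahlerStructure.projDeriv (EQ := EQ) G μ c m i,
      WeakKahlerStructure.projDeriv (EQ := EQ) G μ c m j)) :
    T.sectionalCurvature Pl - S.sectionalCurvature (S.horizontalLift G μ c EN m Pl) =
      3 * S.metric (m : M) ((h.toLocal m).A P i j) ((h.toLocal m).A P i j) +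
        S.metric (m : M) ((h.toLocal m).B P i i) ((h.toLocal m).B P j j) -
        S.metric (m : M) ((h.toLocal m).B P i j) ((h.toLocal m).B P i j) := by
  have hS : S.IsOrthonormalBasisOf (S.horizontalLift G μ c EN m Pl)
      (inclDeriv μ c m i, inclDeriv μ c m j) := by
    refine ⟨(h.metric_projDeriv m hi hi).symm.trans hb.1,
      (h.metric_projDeriv m hj hj).symm.trans hb.2.1,
      (h.metric_projDeriv m hi hj).symm.trans hb.2.2.1, ?_⟩
    rw [← hb.2.2.2]
    exact (h.horizontalLift_span m hi hj).symm
  have hR := hP.riemannForm_sub hi hj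
  rw [toLocal_g, toLocal_g, toLocal_g, toLocal_p, toLocal_ψ] at hR
  rw [T.sectionalCurvature_eq hb, S.sectionalCurvature_eq hS, ← hR]
  have e1 := h.fderiv_toLocal_p m i
  have e2 := h.fderiv_toLocal_p m j
  have e3 := h.fderiv_toLocal_ψ m i
  have e4 := h.fderiv_toLocal_ψ m j
  rw [e1, e2, e3, e4]
  rfl

lemma length_A_le {j k : EN} (hj : (h.toLocal m).Hor j) (hk : (h.toLocal m).Hor k)
    (hj1 : S.metric (m : M) (inclDeriv μ c m j) (inclDeriv μ c m j) = 1)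
    (hk1 : S.metric (m : M) (inclDeriv μ c m k) (inclDeriv μ c m k) = 1) :
    ENNReal.ofReal (√(S.metric (m : M) ((h.toLocal m).A P j k) ((h.toLocal m).A P j k))) ≤
      S.oneillNorm G μ (m : M) := by
  have hj0 : inclDeriv (E := E) μ c m j ≠ 0 := fun h0 ↦ by
    rw [h0, map_zero] at hj1
    exact zero_ne_one hj1
  have hk0 : inclDeriv (E := E) μ c m k ≠ 0 := fun h0 ↦ by
    rw [h0, map_zero] at hk1
    exact zero_ne_one hk1
  have h1 : S.length (inclDeriv (E := E) μ c m j) = 1 := by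
    rw [WeakRiemannianStructure.length, hj1, Real.sqrt_one]
  have h2 : S.length (inclDeriv (E := E) μ c m k) = 1 := by
    rw [WeakRiemannianStructure.length, hk1, Real.sqrt_one]
  refine le_trans (le_of_eq ?_) (le_iSup_of_le _ (le_iSup_of_le _ (le_iSup_of_le _
    (le_iSup_of_le hj0 (le_iSup_of_le hk0 (le_iSup_of_le (h.isONeill_A m hP hj hk) le_rfl))))))
  rw [h1, h2, mul_one, div_one]
  rfl

lemma length_B_le {j k : EN} (hj : (h.toLocal m).Hor j) (hk : (h.toLocal m).Hor k)
    (hj1 : S.metric (m : M) (inclDeriv μ c m j) (inclDeriv μ c m j) = 1)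
    (hk1 : S.metric (m : M) (inclDeriv μ c m k) (inclDeriv μ c m k) = 1) :
    ENNReal.ofReal (√(S.metric (m : M) ((h.toLocal m).B P j k) ((h.toLocal m).B P j k))) ≤
      S.oneillNorm G μ (m : M) := by
  obtain ⟨k', hk', hJ⟩ := h.exists_hor_J m hk
  rw [← h.A_J m hP hk hk' hJ]
  refine h.length_A_le m hP hj hk' hj1 ?_
  rw [hJ, S.J_isometry, hk1]

end IsKahlerReduction

/-! ### The two curvature estimates. -/

namespace IsKahlerReduction

variable {E : Type*} [NormedAddCommGroup E] [NormedSpace ℝ E] [CompleteSpace E]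
  {M : Type*} [TopologicalSpace M] [ChartedSpace E M] [IsManifold 𝓘(ℝ, E) ∞ M]
  {EG : Type*} [NormedAddCommGroup EG] [NormedSpace ℝ EG] [CompleteSpace EG]
  {G : Type*} [TopologicalSpace G] [ChartedSpace EG G] [Group G] [LieGroup 𝓘(ℝ, EG) ∞ G]
  [MulAction G M] [ContMDiffSMul 𝓘(ℝ, EG) 𝓘(ℝ, E) ∞ G M]
  {S : WeakKahlerStructure E M} {μ : M → (EG →L[ℝ] ℝ)} {c : EG →L[ℝ] ℝ}
  {EN : Type*} [NormedAddCommGroup EN] [NormedSpace ℝ EN]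
  [ChartedSpace EN (LevelSet μ c)] [IsManifold 𝓘(ℝ, EN) ∞ (LevelSet μ c)]
  {EQ : Type*} [NormedAddCommGroup EQ] [NormedSpace ℝ EQ] [CompleteSpace EQ]
  [ChartedSpace EQ (KahlerQuotient G μ c)] [IsManifold 𝓘(ℝ, EQ) ∞ (KahlerQuotient G μ c)]
  {T : WeakRiemannianStructure EQ (KahlerQuotient G μ c)}
  (h : IsKahlerReduction S G μ c EN T) (m : LevelSet μ c)

lemma _root_.WeakRiemannianStructure.metric_nonneg (S : WeakRiemannianStructure E M) (x : M)
    (e : TangentSpace 𝓘(ℝ, E) x) : 0 ≤ S.metric x e e := by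
  by_cases he : e = 0
  · simp [he]
  · exact (S.metric_pos _ e he).le

variable {P : EN → E →L[ℝ] E} (hP : (h.toLocal m).IsVertProj P)

include hP

lemma abs_sectionalCurvature_sub_le
    {Pl : Submodule ℝ (TangentSpace 𝓘(ℝ, EQ) (quotientProj G μ c m))}
    (hPl : Module.finrank ℝ Pl = 2) :
    ENNReal.ofReal
        |T.sectionalCurvature Pl - S.sectionalCurvature (S.horizontalLift G μ c EN m Pl)| ≤
      5 * S.oneillNorm G μ (m : M) ^ 2 := by
  obtain ⟨u, v, hb⟩ := T.exists_isOrthonormalBasisOf hPl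
  obtain ⟨i, hi, rfl⟩ := h.exists_hor_projDeriv m u
  obtain ⟨j, hj, rfl⟩ := h.exists_hor_projDeriv m v
  have hi1 := (h.metric_projDeriv m hi hi).symm.trans hb.1
  have hj1 := (h.metric_projDeriv m hj hj).symm.trans hb.2.1
  rw [h.sectionalCurvature_sub m hP hi hj hb]
  have hA := h.length_A_le m hP hi hj hi1 hj1
  have hii := h.length_B_le m hP hi hi hi1 hi1
  have hjj := h.length_B_le m hP hj hj hj1 hj1
  have hij := h.length_B_le m hP hi hj hi1 hj1
  have hA0 := S.metric_nonneg (m : M) ((h.toLocal m).A P i j)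
  have hij0 := S.metric_nonneg (m : M) ((h.toLocal m).B P i j)
  have hp := S.metric_nonneg (m : M) ((h.toLocal m).B P i i + (h.toLocal m).B P j j)
  have hs := S.metric_nonneg (m : M) ((h.toLocal m).B P i i - (h.toLocal m).B P j j)
  obtain ⟨bi, hbi⟩ : ∃ b : TangentSpace 𝓘(ℝ, E) (m : M), b = (h.toLocal m).B P i i := ⟨_, rfl⟩
  obtain ⟨bj, hbj⟩ : ∃ b : TangentSpace 𝓘(ℝ, E) (m : M), b = (h.toLocal m).B P j j := ⟨_, rfl⟩
  replace hp : 0 ≤ S.metric (m : M) (bi + bj) (bi + bj) := by rw [hbi, hbj]; exact hp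
  replace hs : 0 ≤ S.metric (m : M) (bi - bj) (bi - bj) := by rw [hbi, hbj]; exact hs
  rw [← hbi] at hii ⊢
  rw [← hbj] at hjj ⊢
  have hc := S.metric_symm (m : M) bj bi
  -- Nonnegativity of |bi ± bj|² bounds the mixed term by the mean of |bi|² and |bj|², hence by V².
  simp only [map_add, map_sub, add_apply, sub_apply, hc] at hp hs
  by_cases htop : S.oneillNorm G μ (m : M) = ⊤
  · rw [htop]
    simp
  lift S.oneillNorm G μ (m : M) to NNReal using htop with r
  have key : ∀ {x : ℝ}, ENNReal.ofReal √x ≤ (r : ℝ≥0∞) → x ≤ (r : ℝ) ^ 2 := fun {x} hx ↦ by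
    rw [ENNReal.ofReal_le_coe] at hx
    exact (Real.sqrt_le_left r.2).1 hx
  have h1 := key hA
  have h2 := key hii
  have h3 := key hjj
  have h4 := key hij
  have h5 : (5 * (r : ℝ≥0∞) ^ 2) = ENNReal.ofReal (5 * (r : ℝ) ^ 2) := by
    rw [ENNReal.ofReal_mul (by norm_num), ENNReal.ofReal_pow r.coe_nonneg]
    simp
  rw [h5]
  -- The terms add up to at most 3V² + V² and at least −V² − V², which is within ±5V².
  refine ENNReal.ofReal_le_ofReal (abs_le.2 ⟨?_, ?_⟩) <;> linarith

/-- By symmetry of `B` and `A_J` this is A(Jv, Jv), which skewness annihilates. -/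
lemma B_J_right {v v' : EN} (hv : (h.toLocal m).Hor v) (hv' : (h.toLocal m).Hor v')
    (hJ : inclDeriv μ c m v' = S.J (m : M) (inclDeriv μ c m v)) :
    (h.toLocal m).B P v v' = 0 := by
  rw [(h.toLocal m).B_comm, ← h.A_J m hP hv hv' hJ]
  have h1 := hP.A_swap hv' hv'
  have h2 : (2 : ℝ) • (h.toLocal m).A P v' v' = 0 := by
    rw [two_smul]
    exact eq_neg_iff_add_eq_zero.1 h1
  exact (smul_eq_zero.1 h2).resolve_left two_ne_zero

lemma B_J_J {v v' : EN} (hv : (h.toLocal m).Hor v) (hv' : (h.toLocal m).Hor v')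
    (hJ : inclDeriv μ c m v' = S.J (m : M) (inclDeriv μ c m v)) :
    (h.toLocal m).B P v' v' = (h.toLocal m).B P v v := by
  have hJ' : inclDeriv μ c m (-v) = S.J (m : M) (inclDeriv μ c m v') := by
    rw [hJ, S.J_sq]
    exact (inclDeriv (E := E) (EN := EN) μ c m).map_neg v
  have hn : (h.toLocal m).A P (-v) v' = (h.toLocal m).B P (-v) v := h.A_J m hP hv hv' hJ
  rw [← h.A_J m hP hv' hv.neg hJ', hP.A_swap hv' hv.neg, hn, ← neg_one_smul ℝ v,
    LocalKahlerQuotient.B_smul_left, neg_one_smul, neg_neg]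

/-- The plane is the complex line of `v`. There A(v, Jv), B(v,v) and B(Jv, Jv) coincide and the
mixed term vanishes, so the factor is 3 + 1. -/
lemma exists_plane {v : EN} (hv : (h.toLocal m).Hor v)
    (hv1 : S.metric (m : M) (inclDeriv μ c m v) (inclDeriv μ c m v) = 1) :
    ∃ Pl : Submodule ℝ (TangentSpace 𝓘(ℝ, EQ) (quotientProj G μ c m)),
      Module.finrank ℝ Pl = 2 ∧
      T.sectionalCurvature Pl - S.sectionalCurvature (S.horizontalLift G μ c EN m Pl) =
        4 * S.metric (m : M) ((h.toLocal m).B P v v) ((h.toLocal m).B P v v) := by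
  obtain ⟨v', hv', hJ⟩ := h.exists_hor_J m hv
  have h1 : S.metric (m : M) (inclDeriv μ c m v') (inclDeriv μ c m v') = 1 := by
    rw [hJ, S.J_isometry, hv1]
  have h2 : S.metric (m : M) (inclDeriv μ c m v) (inclDeriv μ c m v') = 0 := by
    rw [hJ]
    have h3 := S.J_isometry (m : M) (inclDeriv μ c m v) (S.J (m : M) (inclDeriv μ c m v))
    rw [S.J_sq, map_neg, S.metric_symm] at h3
    linarith
  rw [← h.metric_projDeriv m hv hv] at hv1
  rw [← h.metric_projDeriv m hv' hv'] at h1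
  rw [← h.metric_projDeriv m hv hv'] at h2
  refine ⟨_, T.finrank_span_of_orthonormal hv1 h1 h2, ?_⟩
  rw [h.sectionalCurvature_sub m hP hv hv' ⟨hv1, h1, h2, rfl⟩, h.A_J m hP hv hv' hJ,
    h.B_J_right m hP hv hv' hJ, h.B_J_J m hP hv hv' hJ]
  have h0 : S.metric (m : M) (0 : E) (0 : E) = 0 := (S.metric (m : M) (0 : E)).map_zero
  rw [h0]
  ring

omit hP in
lemma metric_B_le {C : ℝ} (hC0 : 0 ≤ C)
    (hC : ∀ v : EN, (h.toLocal m).Hor v →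
      S.metric (m : M) (inclDeriv μ c m v) (inclDeriv μ c m v) = 1 →
      S.metric (m : M) ((h.toLocal m).B P v v) ((h.toLocal m).B P v v) ≤ C) {v w : EN}
    (hv : (h.toLocal m).Hor v) (hw : (h.toLocal m).Hor w) :
    S.metric (m : M) ((h.toLocal m).B P v w) ((h.toLocal m).B P v w) ≤
      C * S.metric (m : M) (inclDeriv μ c m v) (inclDeriv μ c m v) *
        S.metric (m : M) (inclDeriv μ c m w) (inclDeriv μ c m w) := by
  simp only [← h.toLocal_g_fderiv, ← h.toLocal_g] at hC ⊢
  have hz : ∀ u, (h.toLocal m).B P 0 u = 0 := fun u ↦ by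
    simpa using (h.toLocal m).B_smul_left P 0 0 u
  by_cases hv0 : v = 0
  · rw [hv0, hz]
    simp
  by_cases hw0 : w = 0
  · rw [hw0, (h.toLocal m).B_comm, hz]
    simp
  obtain ⟨r, hr, hrv, hr1⟩ := (h.toLocal m).exists_unit hv0
  obtain ⟨s, hs, hsw, hs1⟩ := (h.toLocal m).exists_unit hw0
  have h1 := (h.toLocal m).g_B_le hC0 hC (hv.smul r⁻¹) (hw.smul s⁻¹) hr1 hs1
  rw [LocalKahlerQuotient.B_smul_left, LocalKahlerQuotient.B_smul_right] at h1
  simp only [map_smul, smul_apply, smul_eq_mul] at h1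
  rw [hrv, hsw]
  have h2 : ∀ b : ℝ, b = (r⁻¹ * (s⁻¹ * (r⁻¹ * (s⁻¹ * b)))) * (r ^ 2 * s ^ 2) := fun b ↦ by
    field_simp
  rw [h2 ((h.toLocal m).g _ _ _), mul_assoc C]
  refine mul_le_mul_of_nonneg_right (le_trans (le_of_eq ?_) h1) (by positivity)
  ring

/-- Every horizontal y is J of the horizontal vector −Jy, so each value of the O'Neill tensor is a
value of `B` on vectors of the same lengths. -/
lemma oneillNorm_le {C : ℝ} (hC0 : 0 ≤ C)
    (hC : ∀ v : EN, (h.toLocal m).Hor v →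
      S.metric (m : M) (inclDeriv μ c m v) (inclDeriv μ c m v) = 1 →
      S.metric (m : M) ((h.toLocal m).B P v v) ((h.toLocal m).B P v v) ≤ C) :
    S.oneillNorm G μ (m : M) ≤ ENNReal.ofReal √C := by
  refine iSup_le fun X ↦ iSup_le fun Y ↦ iSup_le fun Z ↦ iSup_le fun hX ↦ iSup_le fun hY ↦
    iSup_le fun hZ ↦ ENNReal.ofReal_le_ofReal ?_
  obtain ⟨x, hx, rfl⟩ := h.exists_hor_of_mem_horizontal m hZ.1
  obtain ⟨y, hy, rfl⟩ := h.exists_hor_of_mem_horizontal m hZ.2.1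
  obtain ⟨y', hy', hJ⟩ := h.exists_hor_J m hy
  have hJ' : inclDeriv μ c m y = S.J (m : M) (inclDeriv μ c m (-y')) := by
    have h1 : inclDeriv μ c m (-y') = -inclDeriv (E := E) μ c m y' :=
      (inclDeriv (E := E) (EN := EN) μ c m).map_neg y'
    rw [h1, map_neg, hJ, S.J_sq, neg_neg]
  have hZ' : S.metric (m : M) Z Z = S.metric (m : M) ((h.toLocal m).B P x (-y'))
      ((h.toLocal m).B P x (-y')) := by
    rw [h.eq_A_of_isONeill m hP hy hZ, h.A_J m hP hy'.neg hy hJ']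
  have hB := h.metric_B_le m hC0 hC hx hy'.neg
  have hl : S.metric (m : M) (inclDeriv μ c m (-y')) (inclDeriv μ c m (-y')) =
      S.metric (m : M) (inclDeriv μ c m y) (inclDeriv μ c m y) := by
    rw [hJ', S.J_isometry]
  rw [hl, ← hZ'] at hB
  have hX' := S.metric_pos _ _ hX
  have hY' := S.metric_pos _ _ hY
  unfold WeakRiemannianStructure.length
  rw [div_le_iff₀ (mul_pos (Real.sqrt_pos.2 hX') (Real.sqrt_pos.2 hY')), ← mul_assoc,
    ← Real.sqrt_mul hC0, ← Real.sqrt_mul (by positivity)]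
  exact Real.sqrt_le_sqrt hB

lemma oneillNorm_sq_le_iSup (hnt : Nontrivial (TangentSpace 𝓘(ℝ, EQ) (quotientProj G μ c m))) :
    ((S.oneillNorm G μ (m : M) ^ 2 : ℝ≥0∞) : EReal) ≤
      ⨆ Pl : {Pl : Submodule ℝ (TangentSpace 𝓘(ℝ, EQ) (quotientProj G μ c m)) //
          Module.finrank ℝ Pl = 2},
        ((T.sectionalCurvature Pl.1
          - S.sectionalCurvature (S.horizontalLift G μ c EN m Pl.1) : ℝ) : EReal) := by
  set R := ⨆ Pl : {Pl : Submodule ℝ (TangentSpace 𝓘(ℝ, EQ) (quotientProj G μ c m)) //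
          Module.finrank ℝ Pl = 2},
        ((T.sectionalCurvature Pl.1
          - S.sectionalCurvature (S.horizontalLift G μ c EN m Pl.1) : ℝ) : EReal) with hR
  have hle : ∀ v : EN, (h.toLocal m).Hor v →
      S.metric (m : M) (inclDeriv μ c m v) (inclDeriv μ c m v) = 1 →
      ((4 * S.metric (m : M) ((h.toLocal m).B P v v) ((h.toLocal m).B P v v) : ℝ) : EReal) ≤ R := by
    intro v hv hv1
    obtain ⟨Pl, hPl, h1⟩ := h.exists_plane m hP hv hv1
    rw [← h1]
    exact le_iSup_of_le ⟨Pl, hPl⟩ le_rfl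
  obtain ⟨q, hq⟩ := exists_ne (0 : TangentSpace 𝓘(ℝ, EQ) (quotientProj G μ c m))
  obtain ⟨r, hr⟩ := T.exists_normalize hq
  obtain ⟨v, hv, hvq⟩ := h.exists_hor_projDeriv m (r • q)
  rw [← hvq, h.metric_projDeriv m hv hv] at hr
  -- The supremum over an empty family would be −∞; the nonzero vector `q` supplies a complex line,
  -- on which the difference of curvatures is nonnegative.
  have h0 : (0 : EReal) ≤ R := by
    refine le_trans ?_ (hle v hv hr)
    exact EReal.coe_nonneg.2 (mul_nonneg (by norm_num) (S.metric_nonneg (m : M) _))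
  by_cases htop : R = ⊤
  · rw [htop]
    exact le_top
  lift R to ℝ using ⟨htop, fun hbot ↦ by simp [hbot] at h0⟩ with C
  have hC0 : 0 ≤ C := EReal.coe_nonneg.1 h0
  -- Complex lines give 4|B(v,v)|² ≤ C; the weaker |B(v,v)|² ≤ C is all that the claim needs.
  have h1 := h.oneillNorm_le m hP hC0 fun v hv hv1 ↦ by
    have h2 := EReal.coe_le_coe_iff.1 (hle v hv hv1)
    have h3 := S.metric_nonneg (m : M) ((h.toLocal m).B P v v)
    linarith
  calc ((S.oneillNorm G μ (m : M) ^ 2 : ℝ≥0∞) : EReal)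
      ≤ ((ENNReal.ofReal √C ^ 2 : ℝ≥0∞) : EReal) :=
        EReal.coe_ennreal_le_coe_ennreal_iff.2 (pow_le_pow_left' h1 2)
    _ = C := by
      rw [← ENNReal.ofReal_pow (Real.sqrt_nonneg C), Real.sq_sqrt hC0, EReal.coe_ennreal_ofReal,
        max_eq_left hC0]

end IsKahlerReduction

end

theorem mainTheorem6
    {E : Type*} [NormedAddCommGroup E] [NormedSpace ℝ E] [CompleteSpace E]
    {M : Type*} [TopologicalSpace M] [T2Space M] [ChartedSpace E M] [IsManifold 𝓘(ℝ, E) ∞ M]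
    {EG : Type*} [NormedAddCommGroup EG] [NormedSpace ℝ EG] [CompleteSpace EG]
    {G : Type*} [TopologicalSpace G] [ChartedSpace EG G] [Group G] [LieGroup 𝓘(ℝ, EG) ∞ G]
    [MulAction G M] [ContMDiffSMul 𝓘(ℝ, EG) 𝓘(ℝ, E) ∞ G M]
    (S : WeakKahlerStructure E M)
    (μ : M → (EG →L[ℝ] ℝ)) (hμ : S.IsMomentMap G μ)
    (c : EG →L[ℝ] ℝ) (hc : ∀ a : G, coadjointAction a c = c)
    -- the level set of the moment map is a submanifold
    {EN : Type*} [NormedAddCommGroup EN] [NormedSpace ℝ EN] [CompleteSpace EN]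
    [ChartedSpace EN (LevelSet μ c)] [IsManifold 𝓘(ℝ, EN) ∞ (LevelSet μ c)]
    (hN : IsLevelSubmanifold E EN μ c)
    -- on which the action is free, proper, isometric and elliptic
    (hG : S.IsGoodOnLevel EN G μ c)
    -- the Kähler quotient, with its quotient metric and Levi-Civita connection
    {EQ : Type*} [NormedAddCommGroup EQ] [NormedSpace ℝ EQ] [CompleteSpace EQ]
    [ChartedSpace EQ (KahlerQuotient G μ c)] [IsManifold 𝓘(ℝ, EQ) ∞ (KahlerQuotient G μ c)]
    (T : WeakRiemannianStructure EQ (KahlerQuotient G μ c))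
    (hT : S.IsKahlerQuotientStructure G μ c EN T)
    (m : LevelSet μ c) :
    (∀ P : Submodule ℝ (TangentSpace 𝓘(ℝ, EQ) (quotientProj G μ c m)), Module.finrank ℝ P = 2 →
      ENNReal.ofReal
          |T.sectionalCurvature P - S.sectionalCurvature (S.horizontalLift G μ c EN m P)| ≤
        5 * S.oneillNorm G μ (m : M) ^ 2) ∧
    (Nontrivial (TangentSpace 𝓘(ℝ, EQ) (quotientProj G μ c m)) →
      ((S.oneillNorm G μ (m : M) ^ 2 : ℝ≥0∞) : EReal) ≤
        ⨆ P : {P : Submodule ℝ (TangentSpace 𝓘(ℝ, EQ) (quotientProj G μ c m)) //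
            Module.finrank ℝ P = 2},
          ((T.sectionalCurvature P.1
            - S.sectionalCurvature (S.horizontalLift G μ c EN m P.1) : ℝ) : EReal)) := by
  have h : IsKahlerReduction S G μ c EN T := ⟨hμ, hc, hN, hG.elliptic, hT⟩
  obtain ⟨P, hP⟩ := (h.toLocal m).exists_isVertProj
  exact ⟨fun _ hPl ↦ h.abs_sectionalCurvature_sub_le m hP hPl, h.oneillNorm_sq_le_iSup m hP⟩
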